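/- **Fuzzy numbers.** A fuzzy number is a function $u:\mathbb R\to[0,1]$ that is normal ($u(x)=1$ for some $x$), convex ($u(\lambda x+(1-\lambda)y)\ge\min\{u(x),u(y)\}$ for $\lambda\in[0,1]$), upper semicontinuous, and for which $[u]^0:=\overline{\{u>0\}}$ is compact. Let $\mathbf R_{\mathcal F}$ be the set of fuzzy numbers, $[u]^r=\{u\ge r\}=[u_-(r),u_+(r)]$ for $0<r\le1$, $[u]^0=[u_-(0),u_+(0)]$, and put $$(u\oplus v)(x)=\sup_{y+z=x}\min\{u(y),v(z)\},\qquad (\lambda\odot u)(x)=u(x/\lambda)\ (\lambda\neq0),\qquad 0\odot u=\tilde 0:=\chi_{\{0\}},$$ $$D(u,v)=\sup_{r\in[0,1]}\max\{|u_-(r)-v_-(r)|,|u_+(r)-v_+(r)|\}.$$ **Operations.** Let $X$ be a set with operations $\oplus$, $\odot$ (scalars in $\mathbb R$), an element $\tilde0$ and a metric $d$. Write $u\ominus v$ for the element $w$ with $u=v\oplus w$, when it exists, and $\|x\|=d(\tilde0,x)$. Let $L(X)$ be the set of maps $A:X\to X$ with $A(x\oplus y)=A(x)\oplus A(y)$ and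 $A(\lambda\odot x)=\lambda\odot A(x)$ for all $x,y\in X$, $\lambda\in\mathbb R$, that are continuous at every point, and $\Phi(A,B)=\sup\{d(A(x),B(x)):\|x\|\le1\}$. **Derivatives.** Let $f:I\to X$, $I\subseteq\mathbb R$ an interval, $t\in I$. In each of the following cases, $L\in X$ is a derivative of $f$ at $t$ if the two differences exist for all sufficiently small $h>0$ and, as $h\searrow0$, 1. $\frac1h\odot(f(t+h)\ominus f(t))\to L$ and $\frac1h\odot(f(t)\ominus f(t-h))\to L$; 2. $-\frac1h\odot(f(t)\ominus f(t+h))\to L$ and $-\frac1h\odot(f(t-h)\ominus f(t))\to L$; 3. $\frac1h\odot(f(t+h)\ominus f(t))\to L$ and $-\frac1h\odot(f(t-h)\ominus f(t))\to L$; 4. $\frac1h\odot(f(t)\ominus f(t-h))\to L$ and $-\frac1h\odot(f(t)\ominus f(t+h))\to L$. At an endpoint of $I$ only the condition that involves points of $I$ is imposed. Hukuhara differentiability is case 1; generalized differentiability at $t$ means that one of the four cases holds. **The spaces.** Let $a<b$ be real. Let $(X,\oplus,\odot,d)$, with operations taken pointwise or componentwise, be any of the following: * $(\mathbf R_{\mathcal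 F},D)$; * $C([a,b];\mathbf R_{\mathcal F})$, the continuous functions, with $D^*(f,g)=\sup_xD(f(x),g(x))$; * $C^p([a,b];\mathbf R_{\mathcal F})$, $p\in\mathbb N$, the functions with continuous derivatives $f',\dots,f^{(p)}$, where all derivatives, at all points, are in one and the same fixed case among 1–4, with $\sum_{i=0}^pD^*(f^{(i)},g^{(i)})$; * $L^p([a,b];\mathbf R_{\mathcal F})$, $1\le p<\infty$, the (classes modulo equality almost everywhere of) functions $f$ such that $x\mapsto f(x)_\pm(r)$ is Lebesgue measurable for every $r\in[0,1]$ and $\int_a^bD(\tilde0,f(x))^p\,dx<\infty$, with $\left(\int_a^bD(f(x),g(x))^p\,dx\right)^{1/p}$; * $l^p_{\mathbf R_{\mathcal F}}$, $1\le p<\infty$, the sequences in $\mathbf R_{\mathcal F}$ with $\sum_nD(\tilde0,x_n)^p<\infty$, with $\left(\sum_nD(x_n,y_n)^p\right)^{1/p}$; * the bounded sequences, the convergent sequences, and the sequences converging to $\tilde0$ in $\mathbf R_{\mathcal F}$, each with $\sup_nD(x_n,y_n)$; * any finite Cartesian product of such spaces, with the maximum of the metrics. **Theorem 3.9.** Let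 $X$ be one of these spaces and $A\in L(X)$. Then: (i) For every $t\in\mathbb R$ there is a unique $T(t)=e^{t\odot A}\in L(X)$ with $$\lim_{m\to\infty}\Phi\Big(T(t),\sum_{p=0}^m\frac{t^p}{p!}\odot A^p\Big)=0,$$ where $\sum$ is the sum with respect to $\oplus$, $A^0=I$ and $A^p=A\circ\dots\circ A$ ($p$ times). (ii) $T(t+s)=T(t)\circ T(s)$ for all $t,s\ge0$ and for all $t,s\le0$. (iii) For all $x\in X$, $\lim_{h\searrow0}\frac1h\odot[T(h)(x)\ominus x]=A(x)$ in the metric $d$; in particular the differences exist for all small $h>0$. (iv) $T(0)=I$, and $t\mapsto T(t)$ is continuous on $\mathbb R$ with respect to $\Phi$. For every $x\in X$, the function $t\mapsto T(t)(x)$ is generalized differentiable at every $t\in\mathbb R$ with derivative $A[T(t)(x)]$. More exactly, with this derivative, it is Hukuhara differentiable on $[0,\infty)$ (from the right at $t=0$), and differentiable in the sense of case 2 at every $t<0$. (v) Let $u_0\in X$ and let $g:\mathbb R\to X$ be continuous. Then for every $t\in\mathbb R$ the oriented Riemann integral $\int_0^tT(t-s)(g(s))\,ds$ (the limit in $X$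 of the sums $\sum_i(s_{i+1}-s_i)\odot T(t-\xi_i)(g(\xi_i))$ over tagged partitions running monotonically from $0$ to $t$, as the mesh tends to $0$) exists, and $$u(t)=T(t)(u_0)\oplus\int_0^tT(t-s)(g(s))\,ds$$ satisfies $u(0)=u_0$ and is generalized differentiable at every $t\in\mathbb R$ with $u'(t)=A[u(t)]\oplus g(t)$. More exactly, with this derivative, $u$ is Hukuhara differentiable on $[0,\infty)$ (from the right at $t=0$) and differentiable in the sense of case 2 at every $t<0$. -/

import Mathlib

open Set Filter Topology MeasureTheory
open scoped Nat ENNReal Pointwise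

noncomputable section

/-! ## Fuzzy numbers -/

/-- A fuzzy number: a fuzzy subset of the real line that is normal, convex, upper semicontinuous
and has compact closed support. -/
structure FuzzyNumber where
  toFun : ℝ → ℝ
  mem_Icc : ∀ x, toFun x ∈ Icc (0 : ℝ) 1
  normal : ∃ x, toFun x = 1
  convex : ∀ x y t : ℝ, t ∈ Icc (0 : ℝ) 1 →
    min (toFun x) (toFun y) ≤ toFun (t * x + (1 - t) * y)
  usc : UpperSemicontinuous toFun
  compact : IsCompact (closure {x | 0 < toFun x})

namespace FuzzyNumber

instance : CoeFun FuzzyNumber (fun _ => ℝ → ℝ) := ⟨toFun⟩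

theorem ext_fun {u v : FuzzyNumber} (h : ∀ x, u x = v x) : u = v := by
  cases u; cases v
  congr
  exact funext h

/-- The level sets `[u]^r`: the superlevel set for `r ≠ 0`, the closed support for `r = 0`. -/
def level (u : FuzzyNumber) (r : ℝ) : Set ℝ :=
  if r = 0 then closure {x | 0 < u x} else {x | r ≤ u x}

/-- The left endpoint `u₋(r)` of the level set. -/
def lower (u : FuzzyNumber) (r : ℝ) : ℝ := sInf (u.level r)

/-- The right endpoint `u₊(r)` of the level set. -/
def upper (u : FuzzyNumber) (r : ℝ) : ℝ := sSup (u.level r)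

/-- The metric `D(u,v) = sup_{r ∈ [0,1]} max (|u₋(r) - v₋(r)|) (|u₊(r) - v₊(r)|)`. -/
instance : Dist FuzzyNumber :=
  ⟨fun u v => ⨆ r : Icc (0 : ℝ) 1, max |u.lower r - v.lower r| |u.upper r - v.upper r|⟩

/-- The fuzzy number `χ_{0}`. -/
instance : Zero FuzzyNumber :=
  ⟨{ toFun := fun x => if x = 0 then 1 else 0
     mem_Icc := by intro x; split_ifs <;> simp
     normal := ⟨0, by simp⟩
     convex := by
       intro x y t ht
       by_cases hx : x = 0 <;> by_cases hy : y = 0 <;> simp [hx, hy]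
       all_goals split_ifs <;> norm_num
     usc := by
       rw [upperSemicontinuous_iff_isClosed_preimage]
       intro r
       by_cases h0 : r ≤ 0
       · convert isClosed_univ
         ext x
         simp only [mem_preimage, mem_Ici, mem_univ, iff_true]
         split_ifs <;> linarith
       · by_cases h1 : r ≤ 1
         · convert isClosed_singleton (x := (0 : ℝ))
           ext x
           simp only [mem_preimage, mem_Ici, mem_singleton_iff]
           split_ifs with h <;> simp [h] <;> linarith
         · convert isClosed_empty
           ext x
           simp only [mem_preimage, mem_Ici, mem_empty_iff_false, iff_false]
           split_ifs <;> linarith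
     compact := by
       have : {x : ℝ | (0 : ℝ) < if x = 0 then 1 else 0} = {0} := by
         ext x
         simp only [mem_ofPred_eq, mem_singleton_iff]
         split_ifs with h <;> simp [h]
       rw [this]
       simp }⟩

theorem zero_apply (x : ℝ) : (0 : FuzzyNumber) x = if x = 0 then 1 else 0 := rfl

theorem support_nonempty (u : FuzzyNumber) : {x | 0 < u x}.Nonempty := by
  obtain ⟨x, hx⟩ := u.normal
  exact ⟨x, by simp [hx]⟩

theorem isCompact_cut (u : FuzzyNumber) {r : ℝ} (hr : 0 < r) : IsCompact {x | r ≤ u x} := by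
  refine u.compact.of_isClosed_subset ?_ ?_
  · exact (upperSemicontinuous_iff_isClosed_preimage.1 u.usc) r
  · exact fun x hx => subset_closure (lt_of_lt_of_le hr hx)

theorem convex_cut (u : FuzzyNumber) (r : ℝ) : Convex ℝ {x | r ≤ u x} := by
  intro x hx y hy a b ha hb hab
  have := u.convex x y a ⟨ha, by linarith⟩
  have hb' : 1 - a = b := by linarith
  rw [hb'] at this
  exact (le_min hx hy).trans this

/-- The sup-min convolution of two membership functions. -/
def addFun (u v : ℝ → ℝ) (x : ℝ) : ℝ := sSup {m | ∃ y z, y + z = x ∧ m = min (u y) (v z)}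

theorem le_addFun (u v : FuzzyNumber) (y z : ℝ) : min (u y) (v z) ≤ addFun u v (y + z) := by
  refine le_csSup ⟨1, ?_⟩ ⟨y, z, rfl, rfl⟩
  rintro m ⟨y, z, -, rfl⟩
  exact (min_le_left _ _).trans (u.mem_Icc y).2

theorem addFun_mem (u v : FuzzyNumber) (x : ℝ) : addFun u v x ∈ Icc (0 : ℝ) 1 := by
  constructor
  · have := le_addFun u v x 0
    rw [add_zero] at this
    exact (le_min (u.mem_Icc _).1 (v.mem_Icc _).1).trans this
  · refine csSup_le ⟨_, x, 0, add_zero x, rfl⟩ ?_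
    rintro m ⟨y, z, -, rfl⟩
    exact (min_le_left _ _).trans (u.mem_Icc y).2

/-- The supremum in the sup-min convolution is attained where it is positive. -/
theorem exists_addFun (u v : FuzzyNumber) (x : ℝ) (hx : 0 < addFun u v x) :
    ∃ y z, y + z = x ∧ addFun u v x = min (u y) (v z) := by
  set r := addFun u v x
  have hne : {m | ∃ y z, y + z = x ∧ m = min (u y) (v z)}.Nonempty :=
    ⟨_, x, 0, add_zero x, rfl⟩
  set K := {y | r / 2 ≤ u y}
  have hK : IsCompact K := u.isCompact_cut (by positivity)
  have husc : UpperSemicontinuous fun y => min (u y) (v (x - y)) := by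
    have hc : Continuous fun y : ℝ => x - y := by fun_prop
    rw [upperSemicontinuous_iff_isClosed_preimage]
    intro s
    have h1 := (upperSemicontinuous_iff_isClosed_preimage.1 u.usc) s
    have h2 := ((upperSemicontinuous_iff_isClosed_preimage.1 v.usc) s).preimage hc
    convert h1.inter h2 using 1
    ext y
    simp
  have hbig : ∀ s < r, ∃ y, s < min (u y) (v (x - y)) := by
    intro s hs
    obtain ⟨m, ⟨y, z, hyz, rfl⟩, hm⟩ := exists_lt_of_lt_csSup hne hs
    refine ⟨y, ?_⟩
    have : x - y = z := by linarith
    rwa [this]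
  obtain ⟨y1, hy1⟩ := hbig (r / 2) (by linarith)
  have hKne : K.Nonempty := ⟨y1, (hy1.trans_le (min_le_left _ _)).le⟩
  obtain ⟨y0, -, hmax⟩ := (husc.upperSemicontinuousOn K).exists_isMaxOn hKne hK
  refine ⟨y0, x - y0, by ring, ?_⟩
  apply le_antisymm
  · by_contra! hlt
    obtain ⟨y2, hy2⟩ := hbig (max (min (u y0) (v (x - y0))) (r / 2))
      (max_lt hlt (by linarith))
    have h2K : y2 ∈ K :=
      ((le_max_right _ _).trans_lt (hy2.trans_le (min_le_left _ _))).le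
    have := hmax h2K
    simp only [mem_ofPred_eq] at this
    exact absurd ((le_max_left _ _).trans_lt hy2) (not_lt.2 this)
  · have := le_addFun u v y0 (x - y0)
    rwa [add_sub_cancel] at this

theorem cut_addFun (u v : FuzzyNumber) {r : ℝ} (hr : 0 < r) :
    {x | r ≤ addFun u v x} = {x | r ≤ u x} + {x | r ≤ v x} := by
  ext x
  rw [Set.mem_add]
  constructor
  · intro hx
    obtain ⟨y, z, hyz, h⟩ := exists_addFun u v x (hr.trans_le hx)
    have hx' : r ≤ min (u y) (v z) := by rw [← h]; exact hx
    exact ⟨y, hx'.trans (min_le_left _ _), z, hx'.trans (min_le_right _ _), hyz⟩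
  · rintro ⟨y, hy, z, hz, rfl⟩
    exact (le_min hy hz).trans (le_addFun u v y z)

theorem support_addFun (u v : FuzzyNumber) :
    {x | 0 < addFun u v x} = {x | 0 < u x} + {x | 0 < v x} := by
  ext x
  rw [Set.mem_add]
  constructor
  · intro hx
    obtain ⟨y, z, hyz, h⟩ := exists_addFun u v x hx
    have hx' : 0 < min (u y) (v z) := by rw [← h]; exact hx
    exact ⟨y, hx'.trans_le (min_le_left _ _), z, hx'.trans_le (min_le_right _ _), hyz⟩
  · rintro ⟨y, hy, z, hz, rfl⟩
    exact (lt_min hy hz).trans_le (le_addFun u v y z)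

/-- Addition: `(u ⊕ v)(x) = sup_{y + z = x} min (u y) (v z)`. -/
instance : Add FuzzyNumber :=
  ⟨fun u v =>
    { toFun := addFun u v
      mem_Icc := addFun_mem u v
      normal := by
        obtain ⟨y, hy⟩ := u.normal
        obtain ⟨z, hz⟩ := v.normal
        refine ⟨y + z, le_antisymm (addFun_mem u v _).2 ?_⟩
        have := le_addFun u v y z
        rwa [hy, hz, min_self] at this
      convex := by
        intro x y t ht
        rcases le_or_gt (min (addFun u v x) (addFun u v y)) 0 with h | h
        · exact h.trans (addFun_mem u v _).1
        · have hc : Convex ℝ {z | min (addFun u v x) (addFun u v y) ≤ addFun u v z} := by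
            rw [cut_addFun u v h]
            exact (u.convex_cut _).add (v.convex_cut _)
          have hx : x ∈ {z | min (addFun u v x) (addFun u v y) ≤ addFun u v z} := by simp
          have hy : y ∈ {z | min (addFun u v x) (addFun u v y) ≤ addFun u v z} := by simp
          exact hc hx hy ht.1 (by linarith [ht.2]) (by ring)
      usc := by
        rw [upperSemicontinuous_iff_isClosed_preimage]
        intro r
        rcases le_or_gt r 0 with h | h
        · convert isClosed_univ
          ext x
          simpa using h.trans (addFun_mem u v x).1
        · have := cut_addFun u v h
          change IsClosed {x | r ≤ addFun u v x}
          rw [this]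
          exact ((u.isCompact_cut h).add (v.isCompact_cut h)).isClosed
      compact := by
        have hK := u.compact.add v.compact
        refine hK.of_isClosed_subset isClosed_closure (closure_minimal ?_ hK.isClosed)
        rw [support_addFun]
        exact Set.add_subset_add subset_closure subset_closure }⟩

theorem add_apply (u v : FuzzyNumber) (x : ℝ) : (u + v) x = addFun u v x := rfl

/-- Scalar multiplication: `(c ⊙ u)(x) = u (x / c)` for `c ≠ 0`, and `0 ⊙ u = χ_{0}`. -/
instance : SMul ℝ FuzzyNumber :=
  ⟨fun c u =>
    if hc : c = 0 then 0 else
    { toFun := fun x => u (x / c)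
      mem_Icc := fun x => u.mem_Icc _
      normal := by
        obtain ⟨x, hx⟩ := u.normal
        exact ⟨x * c, by rw [mul_div_cancel_right₀ _ hc, hx]⟩
      convex := by
        intro x y t ht
        have := u.convex (x / c) (y / c) t ht
        convert this using 2
        ring
      usc := u.usc.comp (by fun_prop : Continuous fun x : ℝ => x / c)
      compact := by
        have hcont : Continuous fun x : ℝ => x * c := by fun_prop
        refine (u.compact.image hcont).of_isClosed_subset isClosed_closure
          (closure_minimal ?_ (u.compact.image hcont).isClosed)
        intro x hx
        exact ⟨x / c, subset_closure hx, div_mul_cancel₀ x hc⟩ }⟩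

theorem smul_apply {c : ℝ} (hc : c ≠ 0) (u : FuzzyNumber) (x : ℝ) : (c • u) x = u (x / c) := by
  change (dite (c = 0) _ _ : FuzzyNumber) x = _
  rw [dif_neg hc]

theorem zero_smul' (u : FuzzyNumber) : (0 : ℝ) • u = 0 := by
  change (dite ((0 : ℝ) = 0) _ _ : FuzzyNumber) = _
  rw [dif_pos rfl]

/-! ### Algebra of fuzzy numbers -/

theorem ext_cut {u v : FuzzyNumber} (h : ∀ r, 0 < r → {x | r ≤ u x} = {x | r ≤ v x}) :
    u = v := by
  apply ext_fun
  intro x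
  apply le_antisymm
  · rcases (u.mem_Icc x).1.eq_or_lt with h0 | h0
    · rw [← h0]; exact (v.mem_Icc x).1
    · have hx : x ∈ {y | u x ≤ u y} := le_refl (u x)
      rw [h _ h0] at hx
      exact hx
  · rcases (v.mem_Icc x).1.eq_or_lt with h0 | h0
    · rw [← h0]; exact (u.mem_Icc x).1
    · have hx : x ∈ {y | v x ≤ v y} := le_refl (v x)
      rw [← h _ h0] at hx
      exact hx

theorem cut_add (u v : FuzzyNumber) {r : ℝ} (hr : 0 < r) :
    {x | r ≤ (u + v) x} = {x | r ≤ u x} + {x | r ≤ v x} := cut_addFun u v hr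

theorem add_add_add_comm' (u v w e : FuzzyNumber) : (u + v) + (w + e) = (u + w) + (v + e) := by
  apply ext_cut
  intro r hr
  simp only [cut_add _ _ hr]
  exact add_add_add_comm _ _ _ _

theorem zero_add_zero' : (0 : FuzzyNumber) + 0 = 0 := by
  apply ext_cut
  intro r hr
  rw [cut_add _ _ hr]
  have : {x | r ≤ (0 : FuzzyNumber) x} = {0} ∨ {x | r ≤ (0 : FuzzyNumber) x} = ∅ := by
    by_cases h1 : r ≤ 1
    · left
      ext x
      simp only [zero_apply, mem_ofPred_eq, mem_singleton_iff]
      split_ifs with h <;> simp [h] <;> linarith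
    · right
      ext x
      simp only [zero_apply, mem_ofPred_eq, mem_empty_iff_false, iff_false]
      split_ifs <;> linarith
  rcases this with h | h <;> rw [h] <;> simp

theorem cut_smul {c : ℝ} (hc : c ≠ 0) (u : FuzzyNumber) (r : ℝ) :
    {x | r ≤ (c • u) x} = c • {x | r ≤ u x} := by
  ext x
  rw [Set.mem_smul_set_iff_inv_smul_mem₀ hc]
  simp only [mem_ofPred_eq, smul_apply hc, smul_eq_mul, div_eq_inv_mul]

theorem smul_add' (c : ℝ) (u v : FuzzyNumber) : c • (u + v) = c • u + c • v := by
  by_cases hc : c = 0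
  · subst hc
    simp only [zero_smul', zero_add_zero']
  · apply ext_cut
    intro r hr
    rw [cut_add _ _ hr, cut_smul hc, cut_smul hc, cut_smul hc, cut_add _ _ hr, smul_add]

theorem smul_zero' (c : ℝ) : c • (0 : FuzzyNumber) = 0 := by
  by_cases hc : c = 0
  · subst hc
    exact zero_smul' _
  · apply ext_fun
    intro x
    rw [smul_apply hc, zero_apply, zero_apply]
    simp [hc]

theorem smul_smul' (c e : ℝ) (u : FuzzyNumber) : c • e • u = (c * e) • u := by
  by_cases hc : c = 0
  · subst hc
    simp only [zero_smul', zero_mul]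
  by_cases he : e = 0
  · subst he
    simp only [zero_smul', mul_zero, smul_zero']
  apply ext_fun
  intro x
  rw [smul_apply hc, smul_apply he, smul_apply (mul_ne_zero hc he), div_div]

/-! ### Endpoints of level sets and the metric -/

theorem lower_of_pos (u : FuzzyNumber) {r : ℝ} (hr : 0 < r) : u.lower r = sInf {x | r ≤ u x} := by
  rw [lower, level, if_neg hr.ne']

theorem upper_of_pos (u : FuzzyNumber) {r : ℝ} (hr : 0 < r) : u.upper r = sSup {x | r ≤ u x} := by
  rw [upper, level, if_neg hr.ne']

theorem support_bddBelow (u : FuzzyNumber) : BddBelow {x | 0 < u x} :=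
  u.compact.bddBelow.mono subset_closure

theorem support_bddAbove (u : FuzzyNumber) : BddAbove {x | 0 < u x} :=
  u.compact.bddAbove.mono subset_closure

theorem lower_zero (u : FuzzyNumber) : u.lower 0 = sInf {x | 0 < u x} := by
  rw [lower, level, if_pos rfl]
  have h := (isGLB_csInf u.support_nonempty u.support_bddBelow)
  rw [IsGLB, ← lowerBounds_closure] at h
  exact IsGLB.csInf_eq h u.support_nonempty.closure

theorem upper_zero (u : FuzzyNumber) : u.upper 0 = sSup {x | 0 < u x} := by
  rw [upper, level, if_pos rfl]
  have h := (isLUB_csSup u.support_nonempty u.support_bddAbove)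
  rw [IsLUB, ← upperBounds_closure] at h
  exact IsLUB.csSup_eq h u.support_nonempty.closure

theorem cut_nonempty (u : FuzzyNumber) {r : ℝ} (hr : r ≤ 1) : {x | r ≤ u x}.Nonempty := by
  obtain ⟨x, hx⟩ := u.normal
  exact ⟨x, by simp [hx, hr]⟩

theorem lower_add (u v : FuzzyNumber) {r : ℝ} (hr : r ∈ Icc (0 : ℝ) 1) :
    (u + v).lower r = u.lower r + v.lower r := by
  rcases hr.1.eq_or_lt with h | h
  · subst h
    rw [lower_zero, lower_zero, lower_zero]
    have : {x | 0 < (u + v) x} = {x | 0 < u x} + {x | 0 < v x} := support_addFun u v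
    rw [this, csInf_add u.support_nonempty u.support_bddBelow v.support_nonempty
      v.support_bddBelow]
  · rw [lower_of_pos _ h, lower_of_pos _ h, lower_of_pos _ h, cut_add _ _ h,
      csInf_add (u.cut_nonempty hr.2) (u.isCompact_cut h).bddBelow (v.cut_nonempty hr.2)
      (v.isCompact_cut h).bddBelow]

theorem upper_add (u v : FuzzyNumber) {r : ℝ} (hr : r ∈ Icc (0 : ℝ) 1) :
    (u + v).upper r = u.upper r + v.upper r := by
  rcases hr.1.eq_or_lt with h | h
  · subst h
    rw [upper_zero, upper_zero, upper_zero]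
    have : {x | 0 < (u + v) x} = {x | 0 < u x} + {x | 0 < v x} := support_addFun u v
    rw [this, csSup_add u.support_nonempty u.support_bddAbove v.support_nonempty
      v.support_bddAbove]
  · rw [upper_of_pos _ h, upper_of_pos _ h, upper_of_pos _ h, cut_add _ _ h,
      csSup_add (u.cut_nonempty hr.2) (u.isCompact_cut h).bddAbove (v.cut_nonempty hr.2)
      (v.isCompact_cut h).bddAbove]

theorem lower_zero_number {r : ℝ} (hr : r ∈ Icc (0 : ℝ) 1) : (0 : FuzzyNumber).lower r = 0 := by
  have := lower_add 0 0 hr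
  rw [zero_add_zero'] at this
  linarith

theorem upper_zero_number {r : ℝ} (hr : r ∈ Icc (0 : ℝ) 1) : (0 : FuzzyNumber).upper r = 0 := by
  have := upper_add 0 0 hr
  rw [zero_add_zero'] at this
  linarith

theorem support_smul {c : ℝ} (hc : c ≠ 0) (u : FuzzyNumber) :
    {x | 0 < (c • u) x} = c • {x | 0 < u x} := by
  ext x
  rw [Set.mem_smul_set_iff_inv_smul_mem₀ hc]
  simp only [mem_ofPred_eq, smul_apply hc, smul_eq_mul, div_eq_inv_mul]

theorem lower_upper_smul (c : ℝ) (u : FuzzyNumber) {r : ℝ} (hr : r ∈ Icc (0 : ℝ) 1) :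
    (0 ≤ c ∧ (c • u).lower r = c * u.lower r ∧ (c • u).upper r = c * u.upper r) ∨
    (c ≤ 0 ∧ (c • u).lower r = c * u.upper r ∧ (c • u).upper r = c * u.lower r) := by
  by_cases hc : c = 0
  · subst hc
    left
    simp [zero_smul', lower_zero_number hr, upper_zero_number hr]
  rcases hr.1.eq_or_lt with h | h
  · subst h
    rw [lower_zero, lower_zero, upper_zero, upper_zero, support_smul hc]
    rcases le_total 0 c with h0 | h0
    · left
      rw [Real.sInf_smul_of_nonneg h0, Real.sSup_smul_of_nonneg h0]
      simp [h0]
    · right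
      rw [Real.sInf_smul_of_nonpos h0, Real.sSup_smul_of_nonpos h0]
      simp [h0]
  · rw [lower_of_pos _ h, lower_of_pos _ h, upper_of_pos _ h, upper_of_pos _ h, cut_smul hc]
    rcases le_total 0 c with h0 | h0
    · left
      rw [Real.sInf_smul_of_nonneg h0, Real.sSup_smul_of_nonneg h0]
      simp [h0]
    · right
      rw [Real.sInf_smul_of_nonpos h0, Real.sSup_smul_of_nonpos h0]
      simp [h0]

theorem endpoint_mem (u : FuzzyNumber) {r : ℝ} (hr : r ∈ Icc (0 : ℝ) 1) :
    u.lower 0 ≤ u.lower r ∧ u.lower r ≤ u.upper r ∧ u.upper r ≤ u.upper 0 := by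
  rcases hr.1.eq_or_lt with h | h
  · subst h
    refine ⟨le_rfl, ?_, le_rfl⟩
    rw [lower_zero, upper_zero]
    exact csInf_le_csSup u.support_nonempty u.support_bddBelow u.support_bddAbove
  · have hsub : {x | r ≤ u x} ⊆ {x | 0 < u x} := fun x hx => h.trans_le hx
    rw [lower_of_pos _ h, upper_of_pos _ h, lower_zero, upper_zero]
    exact ⟨csInf_le_csInf u.support_bddBelow (u.cut_nonempty hr.2) hsub,
      csInf_le_csSup (u.cut_nonempty hr.2) (u.isCompact_cut h).bddBelow
        (u.isCompact_cut h).bddAbove,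
      csSup_le_csSup u.support_bddAbove (u.cut_nonempty hr.2) hsub⟩

theorem dist_def (u v : FuzzyNumber) :
    dist u v = ⨆ r : Icc (0 : ℝ) 1, max |u.lower r - v.lower r| |u.upper r - v.upper r| := rfl

theorem dist_bdd (u v : FuzzyNumber) :
    BddAbove (range fun r : Icc (0 : ℝ) 1 =>
      max |u.lower r - v.lower r| |u.upper r - v.upper r|) := by
  refine ⟨|u.lower 0| + |u.upper 0| + |v.lower 0| + |v.upper 0|, ?_⟩
  rintro _ ⟨r, rfl⟩
  obtain ⟨h1, h2, h3⟩ := u.endpoint_mem r.2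
  obtain ⟨h4, h5, h6⟩ := v.endpoint_mem r.2
  have := neg_abs_le (u.lower 0)
  have := le_abs_self (u.upper 0)
  have := neg_abs_le (v.lower 0)
  have := le_abs_self (v.upper 0)
  have := abs_nonneg (u.lower 0)
  have := abs_nonneg (u.upper 0)
  have := abs_nonneg (v.lower 0)
  have := abs_nonneg (v.upper 0)
  refine max_le (abs_le.2 ⟨?_, ?_⟩) (abs_le.2 ⟨?_, ?_⟩) <;> linarith

theorem le_dist (u v : FuzzyNumber) {r : ℝ} (hr : r ∈ Icc (0 : ℝ) 1) :
    |u.lower r - v.lower r| ≤ dist u v ∧ |u.upper r - v.upper r| ≤ dist u v :=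
  max_le_iff.1 (le_ciSup (dist_bdd u v) ⟨r, hr⟩)

theorem dist_le (u v : FuzzyNumber) (M : ℝ)
    (h : ∀ r ∈ Icc (0 : ℝ) 1, |u.lower r - v.lower r| ≤ M ∧ |u.upper r - v.upper r| ≤ M) :
    dist u v ≤ M := by
  have : Nonempty (Icc (0 : ℝ) 1) := ⟨⟨0, by simp⟩⟩
  exact ciSup_le fun r => max_le (h r r.2).1 (h r r.2).2

theorem dist_nonneg' (u v : FuzzyNumber) : 0 ≤ dist u v :=
  (abs_nonneg _).trans (le_dist u v (r := 0) (by simp)).1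

theorem dist_self' (u : FuzzyNumber) : dist u u = 0 :=
  le_antisymm (dist_le _ _ _ (by simp)) (dist_nonneg' _ _)

theorem dist_add_add_le' (u v w e : FuzzyNumber) :
    dist (u + v) (w + e) ≤ dist u w + dist v e := by
  apply dist_le
  intro r hr
  rw [lower_add _ _ hr, lower_add _ _ hr, upper_add _ _ hr, upper_add _ _ hr]
  obtain ⟨h1, h2⟩ := le_dist u w hr
  obtain ⟨h3, h4⟩ := le_dist v e hr
  rw [add_sub_add_comm, add_sub_add_comm]
  exact ⟨(abs_add_le _ _).trans (add_le_add h1 h3), (abs_add_le _ _).trans (add_le_add h2 h4)⟩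

theorem dist_smul_smul_le (c : ℝ) (u v : FuzzyNumber) :
    dist (c • u) (c • v) ≤ |c| * dist u v := by
  by_cases hc : c = 0
  · subst hc
    simp [zero_smul', dist_self']
  apply dist_le
  intro r hr
  obtain ⟨h1, h2⟩ := le_dist u v hr
  have key : ∀ a b : ℝ, |a - b| ≤ dist u v → |c * a - c * b| ≤ |c| * dist u v := by
    intro a b h
    rw [← mul_sub, abs_mul]
    gcongr
  rcases lower_upper_smul c u hr with ⟨h0, e1, e2⟩ | ⟨h0, e1, e2⟩ <;>
  rcases lower_upper_smul c v hr with ⟨h0', e1', e2'⟩ | ⟨h0', e1', e2'⟩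
  · rw [e1, e2, e1', e2']; exact ⟨key _ _ h1, key _ _ h2⟩
  · exact absurd (le_antisymm h0' h0) hc
  · exact absurd (le_antisymm h0 h0') hc
  · rw [e1, e2, e1', e2']; exact ⟨key _ _ h2, key _ _ h1⟩

theorem dist_zero_eq (u : FuzzyNumber) : dist 0 u = max |u.lower 0| |u.upper 0| := by
  apply le_antisymm
  · apply dist_le
    intro r hr
    obtain ⟨h1, h2, h3⟩ := u.endpoint_mem hr
    rw [lower_zero_number hr, upper_zero_number hr, zero_sub, zero_sub, abs_neg, abs_neg]
    have ha : |u.lower 0| ≤ max |u.lower 0| |u.upper 0| := le_max_left _ _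
    have hb : |u.upper 0| ≤ max |u.lower 0| |u.upper 0| := le_max_right _ _
    have := neg_abs_le (u.lower 0)
    have := le_abs_self (u.upper 0)
    exact ⟨abs_le.2 ⟨by linarith, by linarith⟩, abs_le.2 ⟨by linarith, by linarith⟩⟩
  · have h0 : (0 : ℝ) ∈ Icc (0 : ℝ) 1 := by simp
    have := le_dist 0 u h0
    rw [lower_zero_number h0, upper_zero_number h0, zero_sub, zero_sub, abs_neg, abs_neg] at this
    exact max_le this.1 this.2

theorem dist_zero_add_le (u v : FuzzyNumber) : dist 0 (u + v) ≤ dist 0 u + dist 0 v := by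
  have := dist_add_add_le' 0 0 u v
  rwa [zero_add_zero'] at this

theorem dist_zero_smul_le (c : ℝ) (u : FuzzyNumber) : dist 0 (c • u) ≤ |c| * dist 0 u := by
  have := dist_smul_smul_le c 0 u
  rwa [smul_zero'] at this

end FuzzyNumber

/-! ## Operators, differences, derivatives and integrals

These notions only use the operations `⊕`, `⊙`, the element `0` and the distance of the space. They
are used below for the concrete spaces of fuzzy-number-valued functions and sequences. -/

section Generic

variable {X : Type} [Add X] [Zero X] [SMul ℝ X] [Dist X]

/-- `A` is linear and continuous at each point. -/
structure IsContLinOp (A : X → X) : Prop where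
  map_add : ∀ x y, A (x + y) = A x + A y
  map_smul : ∀ (c : ℝ) x, A (c • x) = c • A x
  continuous : ∀ x, ∀ ε > 0, ∃ δ > 0, ∀ y, dist y x < δ → dist (A y) (A x) < ε

/-- The operator metric `Φ(A,B) = sup {d(A x, B x) : ‖x‖ ≤ 1}` where `‖x‖ = d(0,x)`. It takes values
in `[0,∞]`, so that the supremum is the true one for arbitrary maps. -/
def opDist (A B : X → X) : ℝ≥0∞ :=
  ⨆ x : {x : X // dist 0 x ≤ 1}, ENNReal.ofReal (dist (A x) (B x))

/-- The partial sum `∑_{p=0}^{m} (t^p/p!) ⊙ A^p`. -/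
def expSum (A : X → X) (t : ℝ) : ℕ → X → X
  | 0, x => (t ^ 0 / (0 ! : ℝ)) • (A^[0] x)
  | m + 1, x => expSum A t m x + (t ^ (m + 1) / ((m + 1)! : ℝ)) • (A^[m + 1] x)

/-- `S = e^{t ⊙ A}`: the operator `S` belongs to the space of linear operators that are continuous
everywhere, and the partial sums of the exponential series converge to it in the metric `Φ`. -/
def IsExpOp (A : X → X) (t : ℝ) (S : X → X) : Prop :=
  IsContLinOp S ∧ Tendsto (fun m => opDist S (expSum A t m)) atTop (𝓝 0)

/-- For all sufficiently small `h > 0` the difference `p h ⊖ q h` exists (it is the `w` with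
`p h = q h ⊕ w`), and `c h ⊙ (p h ⊖ q h) → L` as `h ↘ 0`. -/
def HDiffTendsto (p q : ℝ → X) (c : ℝ → ℝ) (L : X) : Prop :=
  ∃ w : ℝ → X, (∀ᶠ h in 𝓝[>] (0 : ℝ), p h = q h + w h) ∧
    Tendsto (fun h => dist (c h • w h) L) (𝓝[>] (0 : ℝ)) (𝓝 0)

/-- The four cases of generalized differentiability. -/
inductive DiffKind
  | one | two | three | four

/-- The condition on the right of `t`: `(f(t+h) ⊖ f(t))/h → L` in cases 1 and 3,
`(f(t) ⊖ f(t+h))/(-h) → L` in cases 2 and 4. -/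
def DiffKind.Right (f : ℝ → X) (L : X) (t : ℝ) : DiffKind → Prop
  | .one | .three => HDiffTendsto (fun h => f (t + h)) (fun _ => f t) (fun h => 1 / h) L
  | .two | .four => HDiffTendsto (fun _ => f t) (fun h => f (t + h)) (fun h => -(1 / h)) L

/-- The condition on the left of `t`: `(f(t) ⊖ f(t-h))/h → L` in cases 1 and 4,
`(f(t-h) ⊖ f(t))/(-h) → L` in cases 2 and 3. -/
def DiffKind.Left (f : ℝ → X) (L : X) (t : ℝ) : DiffKind → Prop
  | .one | .four => HDiffTendsto (fun _ => f t) (fun h => f (t - h)) (fun h => 1 / h) L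
  | .two | .three => HDiffTendsto (fun h => f (t - h)) (fun _ => f t) (fun h => -(1 / h)) L

/-- `L` is the derivative of `f` at the point `t` of the interval `I`, in the given case; the
condition is one-sided at an endpoint of `I`. -/
def HasKindDeriv (k : DiffKind) (I : Set ℝ) (f : ℝ → X) (L : X) (t : ℝ) : Prop :=
  ((∃ s ∈ I, t < s) → k.Right f L t) ∧ ((∃ s ∈ I, s < t) → k.Left f L t)

/-- Hukuhara differentiability (case 1) at the point `t` of the interval `I`. -/
def HasHukuharaDeriv (I : Set ℝ) (f : ℝ → X) (L : X) (t : ℝ) : Prop :=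
  HasKindDeriv .one I f L t

/-- Generalized differentiability at `t` of a function on the real line: one of the four cases. -/
def HasGenDeriv (f : ℝ → X) (L : X) (t : ℝ) : Prop :=
  ∃ k : DiffKind, HasKindDeriv k univ f L t

/-- The Riemann sum `∑_{i<n} (τ_{i+1} - τ_i) ⊙ f(ξ_i)`. -/
def riemannSum (f : ℝ → X) (τ ξ : ℕ → ℝ) : ℕ → X
  | 0 => 0
  | n + 1 => riemannSum f τ ξ n + (τ (n + 1) - τ n) • f (ξ n)

/-- `L` is the (oriented) Riemann integral `∫_α^β f(s) ds`: the limit of the Riemann sums over the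
tagged partitions running monotonically from `α` to `β`, as the mesh tends to `0`. -/
def HasRiemannIntegral (f : ℝ → X) (α β : ℝ) (L : X) : Prop :=
  ∀ ε > 0, ∃ δ > 0, ∀ (n : ℕ) (τ ξ : ℕ → ℝ), τ 0 = α → τ n = β →
    ((∀ i < n, τ i ≤ τ (i + 1)) ∨ (∀ i < n, τ (i + 1) ≤ τ i)) →
    (∀ i < n, ξ i ∈ uIcc (τ i) (τ (i + 1)) ∧ |τ (i + 1) - τ i| < δ) →
    dist (riemannSum f τ ξ n) L < ε

end Generic

/-! ## The spaces -/

namespace FuzzyNumber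

theorem HDiffTendsto.add {p q p' q' : ℝ → FuzzyNumber} {c : ℝ → ℝ} {L L' : FuzzyNumber}
    (h : HDiffTendsto p q c L) (h' : HDiffTendsto p' q' c L') :
    HDiffTendsto (fun s => p s + p' s) (fun s => q s + q' s) c (L + L') := by
  obtain ⟨w, h1, h2⟩ := h
  obtain ⟨w', h1', h2'⟩ := h'
  refine ⟨fun s => w s + w' s, ?_, ?_⟩
  · filter_upwards [h1, h1'] with s hs hs'
    rw [hs, hs', add_add_add_comm']
  · have := h2.add h2'
    rw [add_zero] at this
    refine squeeze_zero (fun _ => dist_nonneg' _ _) (fun s => ?_) this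
    rw [smul_add']
    exact dist_add_add_le' _ _ _ _

theorem HDiffTendsto.smul {p q : ℝ → FuzzyNumber} {c : ℝ → ℝ} {L : FuzzyNumber}
    (e : ℝ) (h : HDiffTendsto p q c L) :
    HDiffTendsto (fun s => e • p s) (fun s => e • q s) c (e • L) := by
  obtain ⟨w, h1, h2⟩ := h
  refine ⟨fun s => e • w s, ?_, ?_⟩
  · filter_upwards [h1] with s hs
    rw [hs, smul_add']
  · have := h2.const_mul |e|
    rw [mul_zero] at this
    refine squeeze_zero (fun _ => dist_nonneg' _ _) (fun s => ?_) this
    rw [smul_smul', mul_comm, ← smul_smul']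
    exact dist_smul_smul_le _ _ _

theorem HDiffTendsto.zero (c : ℝ → ℝ) :
    HDiffTendsto (fun _ => (0 : FuzzyNumber)) (fun _ => 0) c 0 := by
  refine ⟨fun _ => 0, Eventually.of_forall fun _ => zero_add_zero'.symm, ?_⟩
  simp only [smul_zero', dist_self']
  exact tendsto_const_nhds

theorem HasKindDeriv.add {k : DiffKind} {I : Set ℝ} {f g : ℝ → FuzzyNumber} {L L' : FuzzyNumber}
    {t : ℝ} (h : HasKindDeriv k I f L t) (h' : HasKindDeriv k I g L' t) :
    HasKindDeriv k I (fun s => f s + g s) (L + L') t := by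
  refine ⟨fun hs => ?_, fun hs => ?_⟩
  · have h1 := h.1 hs
    have h2 := h'.1 hs
    cases k <;> exact HDiffTendsto.add h1 h2
  · have h1 := h.2 hs
    have h2 := h'.2 hs
    cases k <;> exact HDiffTendsto.add h1 h2

theorem HasKindDeriv.smul {k : DiffKind} {I : Set ℝ} {f : ℝ → FuzzyNumber} {L : FuzzyNumber}
    {t : ℝ} (e : ℝ) (h : HasKindDeriv k I f L t) :
    HasKindDeriv k I (fun s => e • f s) (e • L) t := by
  refine ⟨fun hs => ?_, fun hs => ?_⟩
  · have h1 := h.1 hs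
    cases k <;> exact HDiffTendsto.smul e h1
  · have h1 := h.2 hs
    cases k <;> exact HDiffTendsto.smul e h1

theorem HasKindDeriv.zero (k : DiffKind) (I : Set ℝ) (t : ℝ) :
    HasKindDeriv k I (fun _ => (0 : FuzzyNumber)) 0 t := by
  refine ⟨fun hs => ?_, fun hs => ?_⟩ <;> cases k <;> exact HDiffTendsto.zero _

end FuzzyNumber

open FuzzyNumber

/-- The space `C([a,b]; R_F)` of continuous fuzzy-number-valued functions. -/
structure FuzzyC (a b : ℝ) where
  toFun : Icc a b → FuzzyNumber
  cont : ∀ x, Tendsto (fun y => dist (toFun y) (toFun x)) (𝓝 x) (𝓝 0)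

namespace FuzzyC

variable {a b : ℝ}

instance : Zero (FuzzyC a b) :=
  ⟨⟨fun _ => 0, fun _ => by simp only [dist_self']; exact tendsto_const_nhds⟩⟩

instance : Add (FuzzyC a b) :=
  ⟨fun f g => ⟨fun x => f.toFun x + g.toFun x, fun x => by
    have := (f.cont x).add (g.cont x)
    rw [add_zero] at this
    exact squeeze_zero (fun _ => dist_nonneg' _ _) (fun _ => dist_add_add_le' _ _ _ _) this⟩⟩

instance : SMul ℝ (FuzzyC a b) :=
  ⟨fun c f => ⟨fun x => c • f.toFun x, fun x => by
    have := (f.cont x).const_mul |c|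
    rw [mul_zero] at this
    exact squeeze_zero (fun _ => dist_nonneg' _ _) (fun _ => dist_smul_smul_le _ _ _) this⟩⟩

/-- `D*(f,g) = sup_x D(f x, g x)`. -/
instance : Dist (FuzzyC a b) := ⟨fun f g => ⨆ x, dist (f.toFun x) (g.toFun x)⟩

end FuzzyC

/-- The space `C^p([a,b]; R_F)`, all derivatives being of the same kind `k`. Since a function
determines its derivatives, a function of this class is recorded together with its derivatives, as
`(f, f', …, f^{(p)})`; derivatives at the endpoints are one-sided. -/
structure FuzzyCp (a b : ℝ) (hab : a < b) (p : ℕ) (k : DiffKind) where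
  der : Fin (p + 1) → FuzzyC a b
  hasDeriv : ∀ (i : Fin p) (x : Icc a b),
    HasKindDeriv k (Icc a b) (IccExtend hab.le (der i.castSucc).toFun) ((der i.succ).toFun x) x

namespace FuzzyCp

variable {a b : ℝ} {hab : a < b} {p : ℕ} {k : DiffKind}

instance : Zero (FuzzyCp a b hab p k) :=
  ⟨⟨fun _ => 0, fun _ _ => HasKindDeriv.zero _ _ _⟩⟩

instance : Add (FuzzyCp a b hab p k) :=
  ⟨fun f g => ⟨fun i => f.der i + g.der i, fun i x =>
    HasKindDeriv.add (f.hasDeriv i x) (g.hasDeriv i x)⟩⟩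

instance : SMul ℝ (FuzzyCp a b hab p k) :=
  ⟨fun c f => ⟨fun i => c • f.der i, fun i x => HasKindDeriv.smul c (f.hasDeriv i x)⟩⟩

/-- `D*_p(f,g) = ∑_{i ≤ p} D*(f^{(i)}, g^{(i)})`. -/
instance : Dist (FuzzyCp a b hab p k) := ⟨fun f g => ∑ i, dist (f.der i) (g.der i)⟩

end FuzzyCp

/-- Lebesgue measure on `[a,b]`. -/
abbrev lebIcc (a b : ℝ) : Measure ℝ := volume.restrict (Icc a b)

/-- Representatives of the elements of `L^p([a,b]; R_F)`: functions all of whose level endpoints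
are Lebesgue measurable on `[a,b]`, with `∫_a^b D(0, f x)^p dx < ∞`. -/
structure PreFuzzyLp (a b p : ℝ) where
  toFun : ℝ → FuzzyNumber
  meas : ∀ r ∈ Icc (0 : ℝ) 1, AEMeasurable (fun x => (toFun x).lower r) (lebIcc a b) ∧
    AEMeasurable (fun x => (toFun x).upper r) (lebIcc a b)
  memLp : MemLp (fun x => dist 0 (toFun x)) (ENNReal.ofReal p) (lebIcc a b)

namespace PreFuzzyLp

variable {a b p : ℝ}

theorem aesm_norm {f : ℝ → FuzzyNumber}
    (h : ∀ r ∈ Icc (0 : ℝ) 1, AEMeasurable (fun x => (f x).lower r) (lebIcc a b) ∧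
      AEMeasurable (fun x => (f x).upper r) (lebIcc a b)) :
    AEStronglyMeasurable (fun x => dist 0 (f x)) (lebIcc a b) := by
  simp only [dist_zero_eq]
  obtain ⟨h1, h2⟩ := h 0 (by simp)
  exact ((measurable_abs.comp_aemeasurable h1).max
    (measurable_abs.comp_aemeasurable h2)).aestronglyMeasurable

instance : Zero (PreFuzzyLp a b p) :=
  ⟨{ toFun := fun _ => 0
     meas := fun _ _ => ⟨aemeasurable_const, aemeasurable_const⟩
     memLp := by simp [dist_self'] }⟩

theorem meas_add (f g : PreFuzzyLp a b p) : ∀ r ∈ Icc (0 : ℝ) 1,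
    AEMeasurable (fun x => (f.toFun x + g.toFun x).lower r) (lebIcc a b) ∧
      AEMeasurable (fun x => (f.toFun x + g.toFun x).upper r) (lebIcc a b) := by
  intro r hr
  simp only [lower_add _ _ hr, upper_add _ _ hr]
  exact ⟨(f.meas r hr).1.add (g.meas r hr).1, (f.meas r hr).2.add (g.meas r hr).2⟩

theorem meas_smul (c : ℝ) (f : PreFuzzyLp a b p) : ∀ r ∈ Icc (0 : ℝ) 1,
    AEMeasurable (fun x => (c • f.toFun x).lower r) (lebIcc a b) ∧
      AEMeasurable (fun x => (c • f.toFun x).upper r) (lebIcc a b) := by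
  intro r hr
  by_cases hc : c = 0
  · subst hc
    simp only [zero_smul']
    exact ⟨aemeasurable_const, aemeasurable_const⟩
  rcases lt_or_gt_of_ne hc with h0 | h0
  · have e : ∀ u : FuzzyNumber, (c • u).lower r = c * u.upper r ∧
        (c • u).upper r = c * u.lower r := fun u => by
      rcases lower_upper_smul c u hr with h | h
      · exact absurd h.1 (not_le.2 h0)
      · exact h.2
    simp only [(e _).1, (e _).2]
    exact ⟨(f.meas r hr).2.const_mul c, (f.meas r hr).1.const_mul c⟩
  · have e : ∀ u : FuzzyNumber, (c • u).lower r = c * u.lower r ∧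
        (c • u).upper r = c * u.upper r := fun u => by
      rcases lower_upper_smul c u hr with h | h
      · exact h.2
      · exact absurd h.1 (not_le.2 h0)
    simp only [(e _).1, (e _).2]
    exact ⟨(f.meas r hr).1.const_mul c, (f.meas r hr).2.const_mul c⟩

instance : Add (PreFuzzyLp a b p) :=
  ⟨fun f g =>
    { toFun := fun x => f.toFun x + g.toFun x
      meas := meas_add f g
      memLp := by
        refine (f.memLp.add g.memLp).mono (aesm_norm (meas_add f g)) ?_
        refine Eventually.of_forall fun x => ?_
        rw [Real.norm_of_nonneg (dist_nonneg' _ _)]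
        exact (dist_zero_add_le _ _).trans (le_abs_self _) }⟩

instance : SMul ℝ (PreFuzzyLp a b p) :=
  ⟨fun c f =>
    { toFun := fun x => c • f.toFun x
      meas := meas_smul c f
      memLp := by
        refine (f.memLp.const_mul |c|).mono (aesm_norm (meas_smul c f)) ?_
        refine Eventually.of_forall fun x => ?_
        rw [Real.norm_of_nonneg (dist_nonneg' _ _)]
        exact (dist_zero_smul_le _ _).trans (le_abs_self _) }⟩

/-- Equality almost everywhere on `[a,b]`. -/
instance setoid (a b p : ℝ) : Setoid (PreFuzzyLp a b p) where
  r f g := f.toFun =ᵐ[lebIcc a b] g.toFun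
  iseqv := ⟨fun _ => EventuallyEq.rfl, fun h => h.symm, fun h h' => h.trans h'⟩

end PreFuzzyLp

/-- The space `L^p([a,b]; R_F)`, functions being identified if they agree almost everywhere. -/
def FuzzyLp (a b p : ℝ) : Type := Quotient (PreFuzzyLp.setoid a b p)

namespace FuzzyLp

variable {a b p : ℝ}

instance : Zero (FuzzyLp a b p) := ⟨Quotient.mk _ 0⟩

instance : Add (FuzzyLp a b p) :=
  ⟨Quotient.map₂ (· + ·) (fun f f' (hf : f.toFun =ᵐ[lebIcc a b] f'.toFun) g g'
      (hg : g.toFun =ᵐ[lebIcc a b] g'.toFun) => by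
    change (fun x => f.toFun x + g.toFun x) =ᵐ[lebIcc a b] fun x => f'.toFun x + g'.toFun x
    filter_upwards [hf, hg] with x h1 h2
    rw [h1, h2])⟩

instance : SMul ℝ (FuzzyLp a b p) :=
  ⟨fun c => Quotient.map (c • ·) (fun f f' (hf : f.toFun =ᵐ[lebIcc a b] f'.toFun) => by
    change (fun x => c • f.toFun x) =ᵐ[lebIcc a b] fun x => c • f'.toFun x
    filter_upwards [hf] with x h1
    rw [h1])⟩

/-- `D_p(f,g) = (∫_a^b D(f x, g x)^p dx)^{1/p}`. -/
instance : Dist (FuzzyLp a b p) :=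
  ⟨Quotient.lift₂
    (fun f g => (eLpNorm (fun x => dist (f.toFun x) (g.toFun x)) (ENNReal.ofReal p)
      (lebIcc a b)).toReal)
    (fun f g f' g' (hf : f.toFun =ᵐ[lebIcc a b] f'.toFun)
      (hg : g.toFun =ᵐ[lebIcc a b] g'.toFun) => by
      congr 1
      apply eLpNorm_congr_ae
      filter_upwards [hf, hg] with x h1 h2
      rw [h1, h2])⟩

end FuzzyLp

/-- The sequence space `l^p` of fuzzy numbers. -/
def FuzzySeqLp (p : ℝ) : Type :=
  {x : ℕ → FuzzyNumber // Memℓp (fun n => dist 0 (x n)) (ENNReal.ofReal p)}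

namespace FuzzySeqLp

variable {p : ℝ}

theorem memℓp_mono {f g : ℕ → ℝ} {q : ℝ≥0∞} (hg : Memℓp g q) (h : ∀ n, |f n| ≤ |g n|) :
    Memℓp f q := by
  rcases q.trichotomy with rfl | rfl | hq
  · refine memℓp_zero ((memℓp_zero_iff.1 hg).subset fun n hn hg0 => hn ?_)
    have := h n
    rw [hg0, abs_zero] at this
    exact abs_eq_zero.1 (le_antisymm this (abs_nonneg _))
  · obtain ⟨M, hM⟩ := memℓp_infty_iff.1 hg
    refine memℓp_infty ⟨M, ?_⟩
    rintro _ ⟨n, rfl⟩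
    exact (h n).trans (hM ⟨n, rfl⟩)
  · refine memℓp_gen (Summable.of_nonneg_of_le (fun n => by positivity) (fun n => ?_)
      (hg.summable hq))
    exact Real.rpow_le_rpow (norm_nonneg _) (h n) hq.le

instance : Zero (FuzzySeqLp p) :=
  ⟨⟨fun _ => 0, by simp only [dist_self']; exact zero_memℓp⟩⟩

instance : Add (FuzzySeqLp p) :=
  ⟨fun x y => ⟨fun n => x.1 n + y.1 n, by
    refine memℓp_mono (x.2.add y.2) fun n => ?_
    rw [abs_of_nonneg (dist_nonneg' _ _)]
    exact (dist_zero_add_le _ _).trans (le_abs_self _)⟩⟩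

instance : SMul ℝ (FuzzySeqLp p) :=
  ⟨fun c x => ⟨fun n => c • x.1 n, by
    refine memℓp_mono (x.2.const_smul |c|) fun n => ?_
    rw [abs_of_nonneg (dist_nonneg' _ _)]
    exact (dist_zero_smul_le _ _).trans (le_abs_self _)⟩⟩

/-- `ρ_p(x,y) = (∑ D(x_n, y_n)^p)^{1/p}`. -/
instance : Dist (FuzzySeqLp p) := ⟨fun x y => (∑' n, dist (x.1 n) (y.1 n) ^ p) ^ (1 / p)⟩

end FuzzySeqLp

/-- The space `m` of bounded sequences of fuzzy numbers. -/
def FuzzyBdd : Type := {x : ℕ → FuzzyNumber // ∃ M > 0, ∀ n, dist 0 (x n) ≤ M}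

namespace FuzzyBdd

instance : Zero FuzzyBdd := ⟨⟨fun _ => 0, 1, one_pos, fun _ => by simp [dist_self']⟩⟩

instance : Add FuzzyBdd :=
  ⟨fun x y => ⟨fun n => x.1 n + y.1 n, by
    obtain ⟨M, h0, h⟩ := x.2
    obtain ⟨M', h0', h'⟩ := y.2
    exact ⟨M + M', add_pos h0 h0', fun n =>
      (dist_zero_add_le _ _).trans (add_le_add (h n) (h' n))⟩⟩⟩

instance : SMul ℝ FuzzyBdd :=
  ⟨fun c x => ⟨fun n => c • x.1 n, by
    obtain ⟨M, h0, h⟩ := x.2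
    refine ⟨|c| * M + 1, by positivity, fun n => ?_⟩
    have := mul_le_mul_of_nonneg_left (h n) (abs_nonneg c)
    linarith [dist_zero_smul_le c (x.1 n)]⟩⟩

/-- `μ(x,y) = sup_n D(x_n, y_n)`. -/
instance : Dist FuzzyBdd := ⟨fun x y => ⨆ n, dist (x.1 n) (y.1 n)⟩

end FuzzyBdd

/-- The space `c` of convergent sequences of fuzzy numbers. -/
def FuzzyConv : Type :=
  {x : ℕ → FuzzyNumber // ∃ l, Tendsto (fun n => dist (x n) l) atTop (𝓝 0)}

theorem tendsto_dist_add {x y : ℕ → FuzzyNumber} {l l' : FuzzyNumber}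
    (h : Tendsto (fun n => dist (x n) l) atTop (𝓝 0))
    (h' : Tendsto (fun n => dist (y n) l') atTop (𝓝 0)) :
    Tendsto (fun n => dist (x n + y n) (l + l')) atTop (𝓝 0) := by
  have := h.add h'
  rw [add_zero] at this
  exact squeeze_zero (fun _ => dist_nonneg' _ _) (fun _ => dist_add_add_le' _ _ _ _) this

theorem tendsto_dist_smul (c : ℝ) {x : ℕ → FuzzyNumber} {l : FuzzyNumber}
    (h : Tendsto (fun n => dist (x n) l) atTop (𝓝 0)) :
    Tendsto (fun n => dist (c • x n) (c • l)) atTop (𝓝 0) := by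
  have := h.const_mul |c|
  rw [mul_zero] at this
  exact squeeze_zero (fun _ => dist_nonneg' _ _) (fun _ => dist_smul_smul_le _ _ _) this

theorem tendsto_dist_zero :
    Tendsto (fun _ : ℕ => dist (0 : FuzzyNumber) 0) atTop (𝓝 0) := by
  simp only [dist_self']
  exact tendsto_const_nhds

namespace FuzzyConv

instance : Zero FuzzyConv := ⟨⟨fun _ => 0, 0, tendsto_dist_zero⟩⟩

instance : Add FuzzyConv :=
  ⟨fun x y => ⟨fun n => x.1 n + y.1 n, by
    obtain ⟨l, h⟩ := x.2
    obtain ⟨l', h'⟩ := y.2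
    exact ⟨l + l', tendsto_dist_add h h'⟩⟩⟩

instance : SMul ℝ FuzzyConv :=
  ⟨fun c x => ⟨fun n => c • x.1 n, by
    obtain ⟨l, h⟩ := x.2
    exact ⟨c • l, tendsto_dist_smul c h⟩⟩⟩

/-- `μ(x,y) = sup_n D(x_n, y_n)`. -/
instance : Dist FuzzyConv := ⟨fun x y => ⨆ n, dist (x.1 n) (y.1 n)⟩

end FuzzyConv

/-- The space of sequences of fuzzy numbers that converge to zero. -/
def FuzzyNull : Type :=
  {x : ℕ → FuzzyNumber // Tendsto (fun n => dist (x n) 0) atTop (𝓝 0)}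

namespace FuzzyNull

instance : Zero FuzzyNull := ⟨⟨fun _ => 0, tendsto_dist_zero⟩⟩

instance : Add FuzzyNull :=
  ⟨fun x y => ⟨fun n => x.1 n + y.1 n, by
    have := tendsto_dist_add x.2 y.2
    rwa [zero_add_zero'] at this⟩⟩

instance : SMul ℝ FuzzyNull :=
  ⟨fun c x => ⟨fun n => c • x.1 n, by
    have := tendsto_dist_smul c x.2
    rwa [smul_zero'] at this⟩⟩

/-- `μ(x,y) = sup_n D(x_n, y_n)`. -/
instance : Dist FuzzyNull := ⟨fun x y => ⨆ n, dist (x.1 n) (y.1 n)⟩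

end FuzzyNull

/-- A carrier with `⊕`, `0`, `⊙` and a distance. This only packages the data, so that the list of
spaces below can be written down. -/
structure FuzzySpace where
  carrier : Type
  [instAdd : Add carrier]
  [instZero : Zero carrier]
  [instSMul : SMul ℝ carrier]
  [instDist : Dist carrier]

namespace FuzzySpace

instance : CoeSort FuzzySpace Type := ⟨carrier⟩

attribute [instance] instAdd instZero instSMul instDist

/-- Finite Cartesian product with the box metric. -/
def prod {n : ℕ} (Y : Fin n → FuzzySpace) : FuzzySpace where
  carrier := ∀ i, Y i
  instAdd := ⟨fun x y i => x i + y i⟩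
  instZero := ⟨fun _ => 0⟩
  instSMul := ⟨fun c x i => c • x i⟩
  instDist := ⟨fun x y => ⨆ i, dist (x i) (y i)⟩

/-- The list of spaces: `R_F`, `C([a,b]; R_F)`, `C^p([a,b]; R_F)`, `L^p([a,b]; R_F)`, `l^p`, `m`,
`c`, the null sequences, and finite Cartesian products. -/
inductive IsStandard : FuzzySpace → Prop
  | number : IsStandard ⟨FuzzyNumber⟩
  | cont (a b : ℝ) (hab : a < b) : IsStandard ⟨FuzzyC a b⟩
  | contDiff (a b : ℝ) (hab : a < b) (p : ℕ) (k : DiffKind) : IsStandard ⟨FuzzyCp a b hab p k⟩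
  | lebesgue (a b : ℝ) (hab : a < b) (p : ℝ) (hp : 1 ≤ p) : IsStandard ⟨FuzzyLp a b p⟩
  | seqLp (p : ℝ) (hp : 1 ≤ p) : IsStandard ⟨FuzzySeqLp p⟩
  | bounded : IsStandard ⟨FuzzyBdd⟩
  | convergent : IsStandard ⟨FuzzyConv⟩
  | null : IsStandard ⟨FuzzyNull⟩
  | prod (n : ℕ) (Y : Fin n → FuzzySpace) (hY : ∀ i, IsStandard (Y i)) : IsStandard (prod Y)

end FuzzySpace

end

/-! The only property of the spaces that matters is that each is a complete metric cone: a
commutative monoid with real scalars, distributive over sums of nonnegative scalars, whose metric is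
complete, translation invariant and homogeneous. The proof therefore splits into the theorem for
cones (`coneExp_spec`) and the cone laws for the listed spaces (`ConeLaws.of_isStandard`).

A translation invariant metric makes the monoid cancellative, so a cone embeds isometrically in a
Banach space (`emb`), with sums and nonnegative multiples preserved. By completeness the image is a
closed convex cone, so absolutely convergent series and integrals of continuous functions, computed
in the Banach space, have their values in the cone. This yields `e^{tA}` as a series; its semigroup
law is the Cauchy product, valid for parameters of equal sign.

Hukuhara differences exist for an explicit reason: `T(h)x` is `x` plus the tail of its series, and
the tail is `hAx + O(h²)` (`exists_coneExp_eq_add`). Since `u(t+h) = T(h)u(t) + ∫_t^{t+h}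
T(t+h-s)g(s) ds` (`duhamel_increment`), the difference of `u(t+h)` and `u(t)` exists and is
`h(Au(t)+g(t)) + o(h)`. The same formula based at `t-h` gives the left derivative. Reversing time
replaces `A` and `g` by `-A` and `-g(-s)` and turns case 1 into case 2; at `0` the two halves fit
together as case 3.

Among the cone laws, completeness is the substantial one. Fuzzy numbers correspond to monotone
endpoint functions with one-sided continuity, and these conditions survive uniform limits. Spaces
with a supremum metric are closed in products. For `C^p`, differentiability in a fixed case must
pass to uniform limits (`hasKindDeriv_of_tendsto`): case 1 with a continuous derivative amounts to
an integral formula, case 2 is its reflection, and in cases 3 and 4 the length of the support has a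
local extremum at every point, hence is constant, the derivative is a real number and the
differences can be reversed. For `L^p` and `l^p` the Riesz–Fischer argument applies. -/

set_option linter.unusedSectionVars false

/-! ## Complete metric cones -/

/-- A complete metric cone: a commutative monoid with real scalars, distributive over sums of
nonnegative scalars, and a complete translation invariant homogeneous metric. -/
class MetricCone (X : Type) [AddCommMonoid X] [DistribMulAction ℝ X] [MetricSpace X] : Prop where
  zero_smul : ∀ x : X, (0 : ℝ) • x = 0
  add_smul : ∀ (c e : ℝ) (x : X), 0 ≤ c → 0 ≤ e → (c + e) • x = c • x + e • x
  dist_add_right : ∀ x y z : X, dist (x + z) (y + z) = dist x y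
  dist_smul : ∀ (c : ℝ) (x y : X), dist (c • x) (c • y) = |c| * dist x y
  complete : CompleteSpace X

namespace MetricCone

variable {X : Type} [AddCommMonoid X] [DistribMulAction ℝ X] [MetricSpace X] [MetricCone X]

instance (priority := 100) instCompleteSpace : CompleteSpace X := complete

theorem dist_add_left (z x y : X) : dist (z + x) (z + y) = dist x y := by
  rw [add_comm z x, add_comm z y, dist_add_right]

theorem dist_add_add_le (x y z w : X) : dist (x + y) (z + w) ≤ dist x z + dist y w := by
  refine (dist_triangle _ (z + y) _).trans ?_
  rw [dist_add_right, dist_add_left]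

theorem dist_zero_smul (c : ℝ) (x : X) : dist 0 (c • x) = |c| * dist 0 x := by
  rw [← dist_smul, smul_zero]

/-- For scalars of equal sign this is an equality, by distributivity and invariance. For opposite
signs only the triangle inequality through `0` is available, and it can be strict, for instance when
`(-1) • x = x`. -/
theorem dist_smul_smul_le (c e : ℝ) (x : X) : dist (c • x) (e • x) ≤ |c - e| * dist 0 x := by
  have key : ∀ c e : ℝ, 0 ≤ c → c ≤ e → dist (c • x) (e • x) = |c - e| * dist 0 x := by
    intro c e hc hce
    have h := add_smul c (e - c) x hc (by linarith)
    rw [add_sub_cancel] at h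
    rw [h]
    nth_rw 1 [← add_zero (c • x)]
    rw [dist_add_left, dist_zero_smul, abs_sub_comm]
  have key2 : ∀ c e : ℝ, 0 ≤ c → 0 ≤ e → dist (c • x) (e • x) = |c - e| * dist 0 x := by
    intro c e hc he
    rcases le_total c e with h | h
    · exact key c e hc h
    · rw [dist_comm, abs_sub_comm, key e c he h]
  have key3 : ∀ c e : ℝ, 0 ≤ c → e ≤ 0 → dist (c • x) (e • x) ≤ |c - e| * dist 0 x := by
    intro c e hc he
    refine (dist_triangle _ 0 _).trans ?_
    rw [dist_comm, dist_zero_smul, dist_zero_smul, ← add_mul]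
    rw [abs_of_nonneg hc, abs_of_nonpos he, abs_of_nonneg (by linarith), sub_eq_add_neg]
  rcases le_total 0 c with hc | hc <;> rcases le_total 0 e with he | he
  · exact (key2 c e hc he).le
  · exact key3 c e hc he
  · rw [dist_comm, abs_sub_comm]; exact key3 e c he hc
  · have h := key2 (-c) (-e) (by linarith) (by linarith)
    have h2 := dist_smul (-1) ((-c) • x) ((-e) • x)
    simp only [smul_smul, neg_mul, one_mul, neg_neg, abs_neg, abs_one] at h2
    rw [h2, h, ← abs_neg]
    ring_nf
    rfl

instance (priority := 100) instContinuousAdd : ContinuousAdd X := by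
  refine ⟨continuous_iff_continuousAt.2 fun p => ?_⟩
  rw [ContinuousAt, tendsto_iff_dist_tendsto_zero]
  have h1 : Tendsto (fun q : X × X => dist q.1 p.1 + dist q.2 p.2) (𝓝 p) (𝓝 0) := by
    have : Continuous fun q : X × X => dist q.1 p.1 + dist q.2 p.2 := by fun_prop
    simpa using this.tendsto p
  exact squeeze_zero (fun _ => dist_nonneg) (fun _ => dist_add_add_le _ _ _ _) h1

instance (priority := 100) instContinuousSMul : ContinuousSMul ℝ X := by
  refine ⟨continuous_iff_continuousAt.2 fun p => ?_⟩
  rw [ContinuousAt, tendsto_iff_dist_tendsto_zero]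
  have h1 : Tendsto (fun q : ℝ × X => |q.1| * dist q.2 p.2 + |q.1 - p.1| * dist 0 p.2) (𝓝 p)
      (𝓝 0) := by
    have : Continuous fun q : ℝ × X => |q.1| * dist q.2 p.2 + |q.1 - p.1| * dist 0 p.2 := by
      fun_prop
    simpa using this.tendsto p
  refine squeeze_zero (fun _ => dist_nonneg) (fun q => ?_) h1
  refine (dist_triangle _ (q.1 • p.2) _).trans ?_
  rw [dist_smul]
  exact add_le_add le_rfl (dist_smul_smul_le _ _ _)

/-! ### The Banach envelope -/

section Envelope

open scoped NNReal

/-- The action of the nonnegative scalars is a module structure. -/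
noncomputable instance (priority := 100) instModuleNNReal : Module ℝ≥0 X where
  add_smul c e x := add_smul (c : ℝ) e x c.2 e.2
  zero_smul x := zero_smul x

theorem nnreal_smul_def (c : ℝ≥0) (x : X) : c • x = (c : ℝ) • x := rfl

/-- The evaluation of a formal nonnegative combination. -/
noncomputable def evalPos : (X →₀ ℝ≥0) →ₗ[ℝ≥0] X := Finsupp.linearCombination ℝ≥0 id

theorem evalPos_single (x : X) (c : ℝ≥0) : evalPos (Finsupp.single x c) = (c : ℝ) • x := by
  simp [evalPos, nnreal_smul_def]

/-- The distance between the positive and negative parts of a formal combination. -/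
noncomputable def formalNorm (v : X →₀ ℝ) : ℝ :=
  dist (evalPos (v.mapRange Real.toNNReal Real.toNNReal_zero))
    (evalPos ((-v).mapRange Real.toNNReal Real.toNNReal_zero))

/-- Two decompositions satisfy `v⁺ + Q = v⁻ + P`, and translation invariance cancels the common
terms. Hence the seminorm laws can be checked with any convenient decomposition, including one with
overlapping parts. -/
theorem formalNorm_eq {v : X →₀ ℝ} (P Q : X →₀ ℝ≥0) (h : ∀ x, (P x : ℝ) - Q x = v x) :
    formalNorm v = dist (evalPos P) (evalPos Q) := by
  have e : v.mapRange Real.toNNReal Real.toNNReal_zero + Q =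
      (-v).mapRange Real.toNNReal Real.toNNReal_zero + P := by
    ext x
    have := h x
    simp only [Finsupp.coe_add, Pi.add_apply, Finsupp.mapRange_apply, NNReal.coe_add,
      Finsupp.coe_neg, Pi.neg_apply, Real.coe_toNNReal']
    rcases le_total 0 (v x) with h0 | h0
    · rw [max_eq_left h0, max_eq_right (by linarith)]; linarith
    · rw [max_eq_right h0, max_eq_left (by linarith)]; linarith
  rw [formalNorm, ← dist_add_right _ _ (evalPos Q), ← map_add, e, map_add, dist_add_left]

theorem exists_pos_neg (v : X →₀ ℝ) : ∃ P Q : X →₀ ℝ≥0, ∀ x, (P x : ℝ) - Q x = v x := by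
  refine ⟨v.mapRange Real.toNNReal Real.toNNReal_zero,
    (-v).mapRange Real.toNNReal Real.toNNReal_zero, fun x => ?_⟩
  simp only [Finsupp.mapRange_apply, Finsupp.coe_neg, Pi.neg_apply, Real.coe_toNNReal']
  rcases le_total 0 (v x) with h0 | h0
  · rw [max_eq_left h0, max_eq_right (by linarith)]; linarith
  · rw [max_eq_right h0, max_eq_left (by linarith)]; linarith

theorem formalNorm_single_sub (x y : X) :
    formalNorm (Finsupp.single x 1 - Finsupp.single y 1 : X →₀ ℝ) = dist x y := by
  classical
  rw [formalNorm_eq (Finsupp.single x 1) (Finsupp.single y 1) fun z => ?_, evalPos_single,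
    evalPos_single, NNReal.coe_one, one_smul, one_smul]
  simp only [Finsupp.single_apply, Finsupp.coe_sub, Pi.sub_apply]
  split_ifs <;> simp

theorem formalNorm_single_add (x y : X) :
    formalNorm (Finsupp.single (x + y) 1 - (Finsupp.single x 1 + Finsupp.single y 1) : X →₀ ℝ) =
      0 := by
  classical
  rw [formalNorm_eq (Finsupp.single (x + y) 1) (Finsupp.single x 1 + Finsupp.single y 1)
    fun z => ?_, map_add, evalPos_single, evalPos_single, evalPos_single]
  · simp
  simp only [Finsupp.single_apply, Finsupp.coe_sub, Pi.sub_apply, Finsupp.coe_add, Pi.add_apply,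
    NNReal.coe_add]
  split_ifs <;> simp

theorem formalNorm_single_smul (c : ℝ≥0) (x : X) :
    formalNorm (Finsupp.single ((c : ℝ) • x) 1 - (c : ℝ) • Finsupp.single x 1 : X →₀ ℝ) = 0 := by
  classical
  rw [formalNorm_eq (Finsupp.single ((c : ℝ) • x) 1) (Finsupp.single x c) fun z => ?_,
    evalPos_single, evalPos_single]
  · simp
  simp only [Finsupp.single_apply, Finsupp.coe_sub, Pi.sub_apply, Finsupp.coe_smul, Pi.smul_apply]
  split_ifs <;> simp

variable (X) in
/-- The seminorm on formal combinations that induces the metric of the cone. -/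
noncomputable def formalSeminorm : Seminorm ℝ (X →₀ ℝ) :=
  Seminorm.ofSMulLE formalNorm
    (by rw [formalNorm_eq (v := (0 : X →₀ ℝ)) 0 0 (by simp)]; simp)
    (fun v w => by
      obtain ⟨P, Q, h⟩ := exists_pos_neg v
      obtain ⟨P', Q', h'⟩ := exists_pos_neg w
      rw [formalNorm_eq P Q h, formalNorm_eq P' Q' h', formalNorm_eq (P + P') (Q + Q') fun x => by
        simp only [Finsupp.coe_add, Pi.add_apply, NNReal.coe_add, ← h x, ← h' x]; ring]
      rw [map_add, map_add]
      exact dist_add_add_le _ _ _ _)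
    (fun r v => by
      obtain ⟨P, Q, h⟩ := exists_pos_neg v
      rw [formalNorm_eq P Q h, Real.norm_eq_abs]
      have e : ∀ a : ℝ≥0, dist (evalPos (a • P)) (evalPos (a • Q)) =
          (a : ℝ) * dist (evalPos P) (evalPos Q) := fun a => by
        rw [map_smul, map_smul, nnreal_smul_def, nnreal_smul_def, dist_smul, NNReal.abs_eq]
      rcases le_total 0 r with h0 | h0
      · lift r to ℝ≥0 using h0
        rw [formalNorm_eq (v := (r : ℝ) • v) (r • P) (r • Q) fun x => by simp [← h x, mul_sub],
          e, NNReal.abs_eq]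
      · obtain ⟨a, ha⟩ : ∃ a : ℝ≥0, (a : ℝ) = -r := CanLift.prf _ (neg_nonneg.2 h0)
        obtain rfl : r = -a := by rw [ha, neg_neg]
        rw [formalNorm_eq (v := (-(a : ℝ)) • v) (a • Q) (a • P) fun x => by
          simp only [Finsupp.coe_smul, Pi.smul_apply, smul_eq_mul, NNReal.coe_mul, ← h x]
          ring, dist_comm, e, abs_neg, NNReal.abs_eq])

variable (X) in
/-- Formal combinations of elements of a cone, with the seminorm induced by its metric. -/
def PreEnvelope : Type := X →₀ ℝ

noncomputable instance : SeminormedAddCommGroup (PreEnvelope X) :=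
  (formalSeminorm X).toAddGroupSeminorm.toSeminormedAddCommGroup

noncomputable instance : NormedSpace ℝ (PreEnvelope X) where
  __ : Module ℝ (X →₀ ℝ) := inferInstance
  norm_smul_le c v := ((formalSeminorm X).smul' c v).le

variable (X) in
/-- The Banach space generated by a cone. -/
abbrev Envelope : Type := UniformSpace.Completion (PreEnvelope X)

/-- The generator of the formal combinations. -/
noncomputable def formalGen (x : X) : PreEnvelope X := (Finsupp.single x 1 : X →₀ ℝ)

/-- The canonical embedding of a cone in its envelope. -/
noncomputable def emb (x : X) : Envelope X := (formalGen x : PreEnvelope X)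

theorem norm_emb_sub (x y : X) : ‖emb x - emb y‖ = dist x y := by
  rw [emb, emb, ← UniformSpace.Completion.coe_sub, UniformSpace.Completion.norm_coe]
  exact formalNorm_single_sub x y

theorem dist_emb (x y : X) : dist (emb x) (emb y) = dist x y := by
  rw [dist_eq_norm, norm_emb_sub]

theorem isometry_emb : Isometry (emb : X → Envelope X) := Isometry.of_dist_eq dist_emb

theorem emb_injective : Function.Injective (emb : X → Envelope X) := isometry_emb.injective

theorem continuous_emb : Continuous (emb : X → Envelope X) := isometry_emb.continuous

theorem emb_add (x y : X) : emb (x + y) = emb x + emb y := by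
  rw [← sub_eq_zero, ← norm_eq_zero, emb, emb, emb, ← UniformSpace.Completion.coe_add,
    ← UniformSpace.Completion.coe_sub, UniformSpace.Completion.norm_coe]
  exact formalNorm_single_add x y

/-- The sign condition is essential: `(-1) • x` is in general not an additive inverse of `x` in the
cone, so its image need not be `-emb x`. -/
theorem emb_smul {c : ℝ} (hc : 0 ≤ c) (x : X) : emb (c • x) = c • emb x := by
  lift c to ℝ≥0 using hc
  rw [← sub_eq_zero, ← norm_eq_zero, emb, emb, ← UniformSpace.Completion.coe_smul,
    ← UniformSpace.Completion.coe_sub, UniformSpace.Completion.norm_coe]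
  exact formalNorm_single_smul c x

theorem emb_zero : emb (0 : X) = 0 := by
  simpa using emb_add (0 : X) 0

theorem norm_emb (x : X) : ‖emb x‖ = dist 0 x := by
  rw [← sub_zero (emb x), ← emb_zero, norm_emb_sub, dist_comm]

theorem emb_sum {ι : Type*} (s : Finset ι) (y : ι → X) :
    emb (∑ i ∈ s, y i) = ∑ i ∈ s, emb (y i) :=
  map_sum (⟨⟨emb, emb_zero⟩, emb_add⟩ : X →+ Envelope X) y s

/-- Completeness of the cone makes the isometry a closed embedding. This is what brings limits
formed in the envelope back to the cone. -/
theorem isClosed_image_emb {C : Set X} (hC : IsClosed C) :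
    IsClosed (emb '' C) := isometry_emb.isClosedEmbedding.isClosedMap _ hC

end Envelope

/-! ### Sums -/

/-- The images converge absolutely in the Banach envelope; the partial sums lie in the closed range
of `emb`, so the sum does too. -/
theorem summable_of_dist {ι : Type*} {y : ι → X} (h : Summable fun i => dist 0 (y i)) :
    Summable y := by
  have h1 : Summable fun i => emb (y i) := by
    refine Summable.of_norm ?_
    simpa only [norm_emb] using h
  obtain ⟨z, hz⟩ := h1
  have hmem : z ∈ Set.range (emb : X → Envelope X) := by
    rw [← image_univ]
    refine (isClosed_image_emb isClosed_univ).mem_of_tendsto hz (Eventually.of_forall fun s => ?_)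
    exact ⟨_, mem_univ _, emb_sum s y⟩
  obtain ⟨w, rfl⟩ := hmem
  refine ⟨w, ?_⟩
  rw [HasSum, isometry_emb.isUniformInducing.isInducing.tendsto_nhds_iff]
  refine hz.congr fun s => ?_
  exact (emb_sum s y).symm

theorem dist_sum_sum_le {ι : Type*} (s : Finset ι) (y y' : ι → X) :
    dist (∑ i ∈ s, y i) (∑ i ∈ s, y' i) ≤ ∑ i ∈ s, dist (y i) (y' i) := by
  classical
  induction s using Finset.induction_on with
  | empty => simp
  | insert a s ha ih =>
    rw [Finset.sum_insert ha, Finset.sum_insert ha, Finset.sum_insert ha]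
    exact (dist_add_add_le _ _ _ _).trans (add_le_add le_rfl ih)

theorem dist_le_of_hasSum {ι : Type*} {y y' : ι → X} {z z' : X} {b : ι → ℝ} {B : ℝ}
    (h : HasSum y z) (h' : HasSum y' z') (hb : HasSum b B)
    (hle : ∀ i, dist (y i) (y' i) ≤ b i) : dist z z' ≤ B :=
  le_of_tendsto_of_tendsto' (Tendsto.dist h h') hb fun s =>
    (dist_sum_sum_le s y y').trans (Finset.sum_le_sum fun i _ => hle i)

end MetricCone

/-! ## The exponential of an operator on a cone -/

section Exponential

open MetricCone

variable {X : Type} [AddCommMonoid X] [DistribMulAction ℝ X] [MetricSpace X] [MetricCone X]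

namespace IsContLinOp

variable {A B : X → X}

theorem continuous' (hA : IsContLinOp A) : Continuous A :=
  Metric.continuous_iff.2 fun x ε hε => hA.continuous x ε hε

theorem of_continuous (h1 : ∀ x y, A (x + y) = A x + A y) (h2 : ∀ (c : ℝ) x, A (c • x) = c • A x)
    (h3 : Continuous A) : IsContLinOp A :=
  ⟨h1, h2, fun x ε hε => Metric.continuous_iff.1 h3 x ε hε⟩

theorem map_zero (hA : IsContLinOp A) : A 0 = 0 := by
  have := hA.map_smul 0 0
  rwa [MetricCone.zero_smul, MetricCone.zero_smul] at this

/-- A linear operator as a homomorphism of monoids. -/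
def toHom (hA : IsContLinOp A) : X →+ X := ⟨⟨A, hA.map_zero⟩, hA.map_add⟩

theorem map_hasSum (hA : IsContLinOp A) {ι : Type*} {y : ι → X} {z : X} (h : HasSum y z) :
    HasSum (fun i => A (y i)) (A z) := h.map hA.toHom hA.continuous'

theorem id : IsContLinOp (fun x : X => x) :=
  of_continuous (fun _ _ => rfl) (fun _ _ => rfl) continuous_id

theorem comp (hA : IsContLinOp A) (hB : IsContLinOp B) : IsContLinOp fun x => A (B x) :=
  of_continuous (fun x y => by rw [hB.map_add, hA.map_add])
    (fun c x => by rw [hB.map_smul, hA.map_smul]) (hA.continuous'.comp hB.continuous')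

theorem iterate (hA : IsContLinOp A) (n : ℕ) : IsContLinOp A^[n] := by
  induction n with
  | zero => exact id
  | succ n ih => rw [Function.iterate_succ']; exact hA.comp ih

theorem smul (hA : IsContLinOp A) (c : ℝ) : IsContLinOp fun x => c • A x :=
  of_continuous (fun x y => by rw [hA.map_add, smul_add])
    (fun e x => by rw [hA.map_smul, smul_smul, smul_smul, mul_comm])
    (hA.continuous'.const_smul c)

theorem add (hA : IsContLinOp A) (hB : IsContLinOp B) : IsContLinOp fun x => A x + B x :=
  of_continuous (fun x y => by rw [hA.map_add, hB.map_add, add_add_add_comm])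
    (fun e x => by rw [hA.map_smul, hB.map_smul, smul_add])
    (hA.continuous'.add hB.continuous')

theorem exists_bound (hA : IsContLinOp A) : ∃ M : ℝ, 0 ≤ M ∧ ∀ x, dist 0 (A x) ≤ M * dist 0 x := by
  obtain ⟨δ, hδ, h⟩ := hA.continuous 0 1 one_pos
  refine ⟨2 / δ, by positivity, fun x => ?_⟩
  rcases eq_or_ne x 0 with rfl | hx
  · simp [hA.map_zero]
  have hx' : 0 < dist 0 x := dist_pos.2 hx.symm
  -- Scales `x` to norm `δ / 2`, strictly inside the ball where continuity at `0` applies; this is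
  -- the origin of the bound `2 / δ`.
  set c := δ / (2 * dist 0 x) with hc
  have hc0 : 0 < c := by positivity
  have h1 : dist (c • x) 0 < δ := by
    rw [dist_comm, dist_zero_smul, abs_of_pos hc0, hc]
    field_simp
    linarith
  have h2 := h _ h1
  rw [hA.map_zero, hA.map_smul, dist_comm, dist_zero_smul, abs_of_pos hc0, hc] at h2
  rw [div_mul_eq_mul_div, div_lt_one (by positivity)] at h2
  rw [div_mul_eq_mul_div, le_div_iff₀ hδ]
  linarith

end IsContLinOp

theorem dist_iterate_le {A : X → X} {M : ℝ} (hM : 0 ≤ M) (h : ∀ x, dist 0 (A x) ≤ M * dist 0 x)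
    (n : ℕ) (x : X) : dist 0 (A^[n] x) ≤ M ^ n * dist 0 x := by
  induction n with
  | zero => simp
  | succ n ih =>
    rw [Function.iterate_succ_apply', pow_succ']
    calc _ ≤ M * dist 0 (A^[n] x) := h _
      _ ≤ M * (M ^ n * dist 0 x) := by gcongr
      _ = _ := by ring

/-- The `p`-th term of the exponential series. -/
noncomputable def expTerm (A : X → X) (t : ℝ) (x : X) (p : ℕ) : X :=
  (t ^ p / (p ! : ℝ)) • (A^[p] x)

/-- The exponential `e^{t ⊙ A}` as the sum of its series. -/
noncomputable def coneExp (A : X → X) (t : ℝ) (x : X) : X := ∑' p, expTerm A t x p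

section Bound

variable {A : X → X} {M : ℝ}

theorem dist_expTerm_le (hM : 0 ≤ M) (h : ∀ x, dist 0 (A x) ≤ M * dist 0 x) (t : ℝ) (x : X)
    (p : ℕ) : dist 0 (expTerm A t x p) ≤ (|t| * M) ^ p / (p ! : ℝ) * dist 0 x := by
  rw [expTerm, dist_zero_smul, abs_div, abs_pow, Nat.abs_cast, mul_pow]
  calc _ ≤ |t| ^ p / (p ! : ℝ) * (M ^ p * dist 0 x) := by
        gcongr; exact dist_iterate_le hM h p x
    _ = _ := by ring

theorem hasSum_exp_series (c : ℝ) : HasSum (fun p : ℕ => c ^ p / (p ! : ℝ)) (Real.exp c) := by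
  rw [Real.exp_eq_exp_ℝ]
  exact NormedSpace.expSeries_div_hasSum_exp c

theorem hasSum_expTerm (hA : IsContLinOp A) (t : ℝ) (x : X) :
    HasSum (expTerm A t x) (coneExp A t x) := by
  obtain ⟨M, hM, h⟩ := hA.exists_bound
  exact (summable_of_dist (Summable.of_nonneg_of_le (fun _ => dist_nonneg)
    (dist_expTerm_le hM h t x) ((hasSum_exp_series (|t| * M)).summable.mul_right _))).hasSum

end Bound

variable {A : X → X}

theorem expSum_eq_sum (A : X → X) (t : ℝ) (m : ℕ) (x : X) :
    expSum A t m x = ∑ p ∈ Finset.range (m + 1), expTerm A t x p := by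
  induction m with
  | zero => simp [expSum, expTerm]
  | succ m ih => rw [Finset.sum_range_succ, ← ih]; rfl

theorem isContLinOp_expSum (hA : IsContLinOp A) (t : ℝ) (m : ℕ) : IsContLinOp (expSum A t m) := by
  induction m with
  | zero => exact (hA.iterate 0).smul _
  | succ m ih => exact ih.add ((hA.iterate (m + 1)).smul _)

/-- Without subtraction the two sides are compared as series: the partial sum is padded with zeros,
so that the termwise distances vanish up to `m` and are dominated by the real exponential series
afterwards. -/
theorem dist_coneExp_expSum_le (hA : IsContLinOp A) {M : ℝ} (hM : 0 ≤ M)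
    (h : ∀ x, dist 0 (A x) ≤ M * dist 0 x) (t : ℝ) (m : ℕ) (x : X) :
    dist (coneExp A t x) (expSum A t m x) ≤
      (∑' p, (|t| * M) ^ (p + (m + 1)) / ((p + (m + 1))! : ℝ)) * dist 0 x := by
  rw [expSum_eq_sum]
  have h1 : HasSum (fun p => if p < m + 1 then expTerm A t x p else 0)
      (∑ p ∈ Finset.range (m + 1), if p < m + 1 then expTerm A t x p else 0) :=
    hasSum_sum_of_ne_finset_zero fun p hp => if_neg (by simpa using hp)
  rw [Finset.sum_congr rfl (g := expTerm A t x)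
    (fun p hp => if_pos (by simpa using hp))] at h1
  have hs := (hasSum_exp_series (|t| * M)).summable
  have h2 := (((summable_nat_add_iff (m + 1)).2 hs).hasSum)
  have h3 : HasSum (fun p : ℕ => if p < m + 1 then 0 else (|t| * M) ^ p / (p ! : ℝ))
      (∑' p, (|t| * M) ^ (p + (m + 1)) / ((p + (m + 1))! : ℝ)) := by
    rw [← hasSum_nat_add_iff' (m + 1)]
    convert h2 using 1
    · funext p
      rw [if_neg (by omega)]
    · rw [Finset.sum_eq_zero (fun p hp => if_pos (by simpa using hp)), sub_zero]
  refine dist_le_of_hasSum (hasSum_expTerm hA t x) h1 (h3.mul_right (dist 0 x)) fun p => ?_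
  split_ifs with hp
  · simp
  · rw [dist_comm]
    exact dist_expTerm_le hM h t x p

theorem opDist_le {A B : X → X} {c : ℝ} (hc : 0 ≤ c) (h : ∀ x, dist (A x) (B x) ≤ c * dist 0 x) :
    opDist A B ≤ ENNReal.ofReal c := by
  refine iSup_le fun x => ENNReal.ofReal_le_ofReal ((h x).trans ?_)
  exact mul_le_of_le_one_right hc x.2

theorem tendsto_exp_tail (c : ℝ) :
    Tendsto (fun m : ℕ => ∑' p, c ^ (p + (m + 1)) / ((p + (m + 1))! : ℝ)) atTop (𝓝 0) :=
  (tendsto_sum_nat_add fun p : ℕ => c ^ p / (p ! : ℝ)).comp (tendsto_add_atTop_nat 1)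

/-- A bound on `dist 0 (A x)` gives no modulus of continuity at other points, since differences
cannot be formed. Continuity comes instead from the partial sums, which converge uniformly on
bounded sets. -/
theorem continuous_coneExp (hA : IsContLinOp A) (t : ℝ) : Continuous (coneExp A t) := by
  obtain ⟨M, hM, h⟩ := hA.exists_bound
  refine continuous_iff_continuousAt.2 fun x => ?_
  have hloc : TendstoUniformlyOn (fun m x => expSum A t m x) (coneExp A t) atTop
      (Metric.ball x 1) := by
    rw [Metric.tendstoUniformlyOn_iff]
    intro ε hε
    have h1 := (tendsto_exp_tail (|t| * M)).mul_const (dist 0 x + 1)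
    rw [zero_mul] at h1
    filter_upwards [h1.eventually_lt_const hε] with m hm y hy
    refine ((dist_coneExp_expSum_le hA hM h t m y).trans ?_).trans_lt hm
    refine mul_le_mul_of_nonneg_left ?_ (tsum_nonneg fun p => by positivity)
    have := dist_triangle 0 x y
    rw [Metric.mem_ball, dist_comm] at hy
    linarith
  exact (hloc.continuousOn (Frequently.of_forall fun m =>
    (isContLinOp_expSum hA t m).continuous'.continuousOn)).continuousAt
      (Metric.ball_mem_nhds x one_pos)

theorem isContLinOp_coneExp (hA : IsContLinOp A) (t : ℝ) : IsContLinOp (coneExp A t) := by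
  refine IsContLinOp.of_continuous (fun x y => ?_) (fun c x => ?_) (continuous_coneExp hA t)
  · refine (hasSum_expTerm hA t (x + y)).unique ?_
    convert (hasSum_expTerm hA t x).add (hasSum_expTerm hA t y) using 2 with p
    rw [expTerm, (hA.iterate p).map_add, smul_add]; rfl
  · refine (hasSum_expTerm hA t (c • x)).unique ?_
    convert (IsContLinOp.id.smul c).map_hasSum (hasSum_expTerm hA t x) using 2 with p
    rw [expTerm, (hA.iterate p).map_smul, expTerm, smul_comm]

theorem isExpOp_coneExp (hA : IsContLinOp A) (t : ℝ) : IsExpOp A t (coneExp A t) := by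
  obtain ⟨M, hM, h⟩ := hA.exists_bound
  refine ⟨isContLinOp_coneExp hA t, ?_⟩
  have h1 := ENNReal.tendsto_ofReal (tendsto_exp_tail (|t| * M))
  rw [ENNReal.ofReal_zero] at h1
  refine tendsto_of_tendsto_of_tendsto_of_le_of_le tendsto_const_nhds h1 (fun _ => zero_le)
    fun m => opDist_le (tsum_nonneg fun p => by positivity) (dist_coneExp_expSum_le hA hM h t m)

theorem dist_le_of_opDist {S T : X → X} (hS : IsContLinOp S) (hT : IsContLinOp T) {c : ℝ}
    (hc : 0 ≤ c) (h : opDist S T ≤ ENNReal.ofReal c) (x : X) : dist (S x) (T x) ≤ c * dist 0 x := by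
  rcases eq_or_ne x 0 with rfl | hx
  · simp [hS.map_zero, hT.map_zero]
  have hx' : 0 < dist 0 x := dist_pos.2 hx.symm
  have h1 : dist 0 ((dist 0 x)⁻¹ • x) ≤ 1 := by
    rw [dist_zero_smul, abs_of_pos (by positivity), inv_mul_cancel₀ hx'.ne']
  have h2 := (le_iSup (fun y : {x : X // dist 0 x ≤ 1} => ENNReal.ofReal (dist (S y) (T y)))
    ⟨_, h1⟩).trans h
  rw [ENNReal.ofReal_le_ofReal_iff hc] at h2
  simp only [hS.map_smul, hT.map_smul, MetricCone.dist_smul] at h2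
  rwa [abs_of_pos (by positivity), inv_mul_le_iff₀ hx', mul_comm] at h2

theorem IsExpOp.unique (hA : IsContLinOp A) {t : ℝ} {S : X → X} (hS : IsExpOp A t S) :
    S = coneExp A t := by
  funext x
  have key : Tendsto (fun m => expSum A t m x) atTop (𝓝 (S x)) := by
    rw [Metric.tendsto_atTop]
    intro ε hε
    have hpos : 0 < ε / (dist 0 x + 1) := by positivity
    obtain ⟨N, hN⟩ := eventually_atTop.1
      (hS.2.eventually_lt_const (ENNReal.ofReal_pos.2 hpos))
    refine ⟨N, fun m hm => ?_⟩
    have := dist_le_of_opDist hS.1 (isContLinOp_expSum hA t m) hpos.le (hN m hm).le x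
    rw [dist_comm]
    refine this.trans_lt ?_
    rw [div_mul_eq_mul_div, div_lt_iff₀ (by positivity)]
    nlinarith
  refine tendsto_nhds_unique key ?_
  simp only [expSum_eq_sum]
  exact (hasSum_expTerm hA t x).tendsto_sum_nat.comp (tendsto_add_atTop_nat 1)

theorem iterate_coneExp (hA : IsContLinOp A) (t : ℝ) (x : X) (p : ℕ) :
    HasSum (fun q => (t ^ q / (q ! : ℝ)) • A^[p + q] x) (A^[p] (coneExp A t x)) := by
  convert (hA.iterate p).map_hasSum (hasSum_expTerm hA t x) using 2 with q
  rw [expTerm, (hA.iterate p).map_smul, Function.iterate_add_apply]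

theorem sum_smul_of_nonneg {ι : Type*} (s : Finset ι) (c : ι → ℝ) (hc : ∀ i ∈ s, 0 ≤ c i) (x : X) :
    (∑ i ∈ s, c i) • x = ∑ i ∈ s, c i • x := by
  classical
  induction s using Finset.induction_on with
  | empty => simp [MetricCone.zero_smul]
  | insert a s ha ih =>
    rw [Finset.sum_insert ha, Finset.sum_insert ha, MetricCone.add_smul,
      ih fun i hi => hc i (Finset.mem_insert_of_mem hi)]
    · exact hc a (Finset.mem_insert_self a s)
    · exact Finset.sum_nonneg fun i hi => hc i (Finset.mem_insert_of_mem hi)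

/-- The absolutely convergent double series `F` is summed by rows, giving the composition, and along
antidiagonals, giving the binomial expansion of `(t + s) ^ n`. -/
theorem coneExp_add_of_nonneg (hA : IsContLinOp A) {t s : ℝ} (ht : 0 ≤ t) (hs : 0 ≤ s) (x : X) :
    coneExp A (t + s) x = coneExp A t (coneExp A s x) := by
  obtain ⟨M, hM, h⟩ := hA.exists_bound
  set F : ℕ × ℕ → X := fun i => (t ^ i.1 / (i.1 ! : ℝ)) • (s ^ i.2 / (i.2 ! : ℝ)) • A^[i.1 + i.2] x
    with hF
  have hsum : Summable F := by
    refine summable_of_dist (Summable.of_nonneg_of_le (fun _ => dist_nonneg) (fun i => ?_)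
      (((hasSum_exp_series (t * M)).summable.mul_of_nonneg
        (hasSum_exp_series (s * M)).summable (fun _ => by positivity)
        (fun _ => by positivity)).mul_right (dist 0 x)))
    rw [hF, dist_zero_smul, dist_zero_smul, abs_of_nonneg (by positivity),
      abs_of_nonneg (by positivity)]
    calc _ ≤ t ^ i.1 / (i.1 ! : ℝ) * (s ^ i.2 / (i.2 ! : ℝ) * (M ^ (i.1 + i.2) * dist 0 x)) := by
          gcongr; exact dist_iterate_le hM h _ x
      _ = _ := by rw [pow_add, mul_pow, mul_pow]; ring
  obtain ⟨z, hz⟩ := hsum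
  have h1 : HasSum (expTerm A t (coneExp A s x)) z := by
    refine hz.prod_fiberwise fun p => ?_
    exact (IsContLinOp.id.smul (t ^ p / (p ! : ℝ))).map_hasSum (iterate_coneExp hA s x p)
  have h2 : HasSum (expTerm A (t + s) x) z := by
    have h3 := (Finset.HasAntidiagonal.sigmaAntidiagonalEquivProd (A := ℕ)).hasSum_iff.2 hz
    refine h3.sigma fun n => ?_
    convert hasSum_fintype _
    refine Eq.trans ?_ (Finset.sum_coe_sort (Finset.HasAntidiagonal.antidiagonal n) F).symm
    rw [expTerm]
    have e : ∀ i ∈ Finset.HasAntidiagonal.antidiagonal n,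
        F i = (t ^ i.1 / (i.1 ! : ℝ) * (s ^ i.2 / (i.2 ! : ℝ))) • A^[n] x := by
      intro i hi
      rw [hF, ← Finset.HasAntidiagonal.mem_antidiagonal.1 hi, mul_smul]
    -- The signs of `t` and `s` matter here: collecting coefficients of one vector is legitimate
    -- only if they are nonnegative.
    rw [Finset.sum_congr rfl e, ← sum_smul_of_nonneg _ _ (fun _ _ => by positivity)]
    congr 1
    rw [add_pow, Finset.sum_div, Finset.Nat.sum_antidiagonal_eq_sum_range_succ_mk]
    refine Finset.sum_congr rfl fun k hk => ?_
    have hk' : k ≤ n := Nat.lt_succ_iff.1 (Finset.mem_range.1 hk)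
    have : (n ! : ℝ) = n.choose k * k ! * (n - k)! := by
      exact_mod_cast (Nat.choose_mul_factorial_mul_factorial hk').symm
    rw [this]
    have : (n.choose k : ℝ) ≠ 0 := by exact_mod_cast (Nat.choose_pos hk').ne'
    field_simp
  exact ((hasSum_expTerm hA (t + s) x).unique h2).trans
    ((hasSum_expTerm hA t _).unique h1).symm

/-- The opposite operator. -/
def negOp (A : X → X) (x : X) : X := (-1 : ℝ) • A x

theorem isContLinOp_negOp (hA : IsContLinOp A) : IsContLinOp (negOp A) := hA.smul (-1)

/-- Homogeneity gives `(-A)^p = (-1)^p A^p` without any additivity in scalars. Through this identity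
every statement for negative times reduces to nonnegative ones. -/
theorem coneExp_negOp (hA : IsContLinOp A) (t : ℝ) (x : X) :
    coneExp (negOp A) t x = coneExp A (-t) x := by
  have e : ∀ p, (negOp A)^[p] x = ((-1 : ℝ) ^ p) • A^[p] x := by
    intro p
    induction p with
    | zero => simp
    | succ p ih =>
      rw [Function.iterate_succ_apply', ih, negOp, hA.map_smul, smul_smul, pow_succ', 
        Function.iterate_succ_apply']
  rw [coneExp, coneExp]
  congr 1
  funext p
  rw [expTerm, expTerm, e, smul_smul, neg_pow]
  congr 1
  ring

theorem coneExp_add_of_nonpos (hA : IsContLinOp A) {t s : ℝ} (ht : t ≤ 0) (hs : s ≤ 0) (x : X) :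
    coneExp A (t + s) x = coneExp A t (coneExp A s x) := by
  have := coneExp_add_of_nonneg (isContLinOp_negOp hA) (neg_nonneg.2 ht) (neg_nonneg.2 hs) x
  simp only [coneExp_negOp hA] at this
  simpa [add_comm] using this

theorem coneExp_zero (hA : IsContLinOp A) (x : X) : coneExp A 0 x = x := by
  refine (hasSum_expTerm hA 0 x).unique ?_
  convert hasSum_single (f := expTerm A 0 x) 0 fun p hp => ?_
  · simp [expTerm]
  · simp [expTerm, hp, MetricCone.zero_smul]

/-- Termwise, `|t ^ p - s ^ p| ≤ |t - s| p R ^ (p - 1)` with `R = max |t| |s|`. The majorant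
vanishes at `p = 0`, and shifting the index sums the rest to `|t - s| M e^{RM}`. -/
theorem dist_coneExp_coneExp_le (hA : IsContLinOp A) {M : ℝ} (hM : 0 ≤ M)
    (h : ∀ x, dist 0 (A x) ≤ M * dist 0 x) (t s : ℝ) (x : X) :
    dist (coneExp A t x) (coneExp A s x) ≤
      |t - s| * (M * Real.exp (max |t| |s| * M)) * dist 0 x := by
  set R := max |t| |s|
  have hb : HasSum (fun p : ℕ => |t - s| * p * R ^ (p - 1) / (p ! : ℝ) * M ^ p)
      (0 + |t - s| * (M * Real.exp (R * M))) := by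
    have := HasSum.zero_add (f := fun p : ℕ => |t - s| * p * R ^ (p - 1) / (p ! : ℝ) * M ^ p)
      (m := |t - s| * (M * Real.exp (R * M))) (by
        refine (((hasSum_exp_series (R * M)).mul_left M).mul_left |t - s|).congr_fun fun p => ?_
        rw [Nat.factorial_succ, Nat.cast_mul, Nat.add_sub_cancel]
        field_simp
        ring)
    simpa using this
  rw [zero_add] at hb
  refine dist_le_of_hasSum (hasSum_expTerm hA t x) (hasSum_expTerm hA s x)
    (hb.mul_right (dist 0 x)) fun p => ?_
  refine (MetricCone.dist_smul_smul_le _ _ _).trans ?_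
  rw [← sub_div, abs_div, Nat.abs_cast]
  calc _ ≤ |t - s| * p * R ^ (p - 1) / (p ! : ℝ) * (M ^ p * dist 0 x) := by
        gcongr
        · exact abs_pow_sub_pow_le t s p
        · exact dist_iterate_le hM h p x
    _ = _ := by ring

theorem tendsto_opDist_coneExp (hA : IsContLinOp A) (t : ℝ) :
    Tendsto (fun s => opDist (coneExp A s) (coneExp A t)) (𝓝 t) (𝓝 0) := by
  obtain ⟨M, hM, h⟩ := hA.exists_bound
  have hc : Continuous fun s : ℝ => |s - t| * (M * Real.exp (max |s| |t| * M)) := by fun_prop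
  have h1 := ENNReal.tendsto_ofReal (hc.tendsto t)
  simp only [sub_self, abs_zero, zero_mul, ENNReal.ofReal_zero] at h1
  exact tendsto_of_tendsto_of_tendsto_of_le_of_le tendsto_const_nhds h1 (fun _ => zero_le)
    fun s => opDist_le (by positivity) fun x => dist_coneExp_coneExp_le hA hM h s t x

theorem continuous_uncurry_coneExp (hA : IsContLinOp A) :
    Continuous fun q : ℝ × X => coneExp A q.1 q.2 := by
  obtain ⟨M, hM, h⟩ := hA.exists_bound
  refine continuous_iff_continuousAt.2 fun q => ?_
  rw [ContinuousAt, tendsto_iff_dist_tendsto_zero]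
  have hc : Continuous fun r : ℝ × X =>
      |r.1 - q.1| * (M * Real.exp (max |r.1| |q.1| * M)) * dist 0 r.2 +
        dist (coneExp A q.1 r.2) (coneExp A q.1 q.2) := by
    have := continuous_coneExp hA q.1
    fun_prop
  have h1 := hc.tendsto q
  simp only [sub_self, abs_zero, zero_mul, dist_self, add_zero] at h1
  refine squeeze_zero (fun _ => dist_nonneg) (fun r => ?_) h1
  exact (dist_triangle _ (coneExp A q.1 r.2) _).trans
    (add_le_add (dist_coneExp_coneExp_le hA hM h _ _ _) le_rfl)

/-- The Hukuhara difference is the series started at `p = 1`, so it always exists. Its error against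
the linear term is the series started at `p = 2`, estimated with `(p + 2)! ≥ p!`. -/
theorem exists_coneExp_eq_add (hA : IsContLinOp A) {M : ℝ} (hM : 0 ≤ M)
    (h : ∀ x, dist 0 (A x) ≤ M * dist 0 x) (t : ℝ) (x : X) :
    ∃ w, coneExp A t x = x + w ∧
      dist w (t • A x) ≤ (|t| * M) ^ 2 * Real.exp (|t| * M) * dist 0 x := by
  have hb := hasSum_exp_series (|t| * M)
  have hs : Summable fun p => expTerm A t x (p + 2) := by
    refine summable_of_dist (Summable.of_nonneg_of_le (fun _ => dist_nonneg)
      (fun p => dist_expTerm_le hM h t x (p + 2)) ?_)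
    exact ((summable_nat_add_iff 2).2 hb.summable).mul_right _
  obtain ⟨z, hz⟩ := hs
  have h1 : HasSum (fun p => expTerm A t x (p + 1)) (expTerm A t x 1 + z) :=
    HasSum.zero_add (f := fun p => expTerm A t x (p + 1)) hz
  refine ⟨expTerm A t x 1 + z, ?_, ?_⟩
  · rw [(hasSum_expTerm hA t x).unique h1.zero_add]
    simp [expTerm]
  · have e : t • A x = expTerm A t x 1 + 0 := by simp [expTerm]
    rw [e, MetricCone.dist_add_left, dist_comm]
    refine dist_le_of_hasSum hasSum_zero hz ((hb.mul_left ((|t| * M) ^ 2)).mul_right (dist 0 x))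
      fun p => (dist_expTerm_le hM h t x (p + 2)).trans ?_
    gcongr
    rw [← mul_div_assoc, ← pow_add, add_comm 2 p]
    gcongr
    omega

end Exponential

/-! ## Riemann integrals in a cone -/

section Integral

open MetricCone

variable {X : Type} [AddCommMonoid X] [DistribMulAction ℝ X] [MetricSpace X] [MetricCone X]

theorem le_of_forall_succ_le {τ : ℕ → ℝ} {n : ℕ} (h : ∀ i < n, τ i ≤ τ (i + 1)) {i j : ℕ}
    (hij : i ≤ j) (hj : j ≤ n) : τ i ≤ τ j := by
  induction j, hij using Nat.le_induction with
  | base => exact le_rfl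
  | succ j _ ih => exact (ih (by omega)).trans (h j (by omega))

theorem emb_riemannSum {F : ℝ → X} {τ ξ : ℕ → ℝ} {n : ℕ} (h : ∀ i < n, τ i ≤ τ (i + 1)) :
    emb (riemannSum F τ ξ n) = ∑ i ∈ Finset.range n, (τ (i + 1) - τ i) • emb (F (ξ i)) := by
  induction n with
  | zero => exact emb_zero
  | succ n ih =>
    rw [riemannSum, emb_add, emb_smul (sub_nonneg.2 (h n n.lt_succ_self)),
      ih fun i hi => h i (by omega), Finset.sum_range_succ]

/-- On each cell uniform continuity keeps the tagged value within `η` of the integrand, so the total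
error is at most `η (β - α)`. The summand `1` in the denominator of `η` covers `α = β`. -/
theorem hasRiemannIntegral_of_emb {F : ℝ → X} (hF : Continuous F) {α β : ℝ} (hαβ : α ≤ β) {L : X}
    (hL : emb L = ∫ s in α..β, emb (F s)) : HasRiemannIntegral F α β L := by
  intro ε hε
  have hcont : Continuous fun s => emb (F s) := continuous_emb.comp hF
  set η := ε / (β - α + 1)
  have hη : 0 < η := div_pos hε (by linarith)
  obtain ⟨δ, hδ, hunif⟩ := Metric.uniformContinuousOn_iff.1
    (isCompact_Icc.uniformContinuousOn_of_continuous hF.continuousOn (s := Icc α β)) η hη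
  refine ⟨δ, hδ, fun n τ ξ h0 hn hmon hξ => ?_⟩
  have hmon' : ∀ i < n, τ i ≤ τ (i + 1) := by
    rcases hmon with h | h
    · exact h
    -- A decreasing partition from `α` to `β ≥ α` is constant, hence also increasing.
    · intro i hi
      have key : ∀ {i j : ℕ}, i ≤ j → j ≤ n → τ j ≤ τ i := fun {i j} hij hj =>
        neg_le_neg_iff.1 (le_of_forall_succ_le (τ := fun k => -τ k)
          (fun k hk => neg_le_neg (h k hk)) hij hj)
      have h1 := key (Nat.zero_le i) hi.le
      have h2 := key (show i + 1 ≤ n from hi) le_rfl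
      linarith
  have hmem : ∀ i ≤ n, τ i ∈ Icc α β := fun i hi =>
    ⟨h0 ▸ le_of_forall_succ_le hmon' (Nat.zero_le i) hi, hn ▸ le_of_forall_succ_le hmon' hi le_rfl⟩
  have hint : ∀ a b, IntervalIntegrable (fun s => emb (F s)) volume a b :=
    fun a b => hcont.intervalIntegrable a b
  have hsum := intervalIntegral.sum_integral_adjacent_intervals (a := τ) (n := n)
    fun k _ => hint (τ k) (τ (k + 1))
  rw [h0, hn, ← hL] at hsum
  rw [← dist_emb, emb_riemannSum hmon', ← hsum, dist_eq_norm, ← Finset.sum_sub_distrib]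
  have hle : ∀ i ∈ Finset.range n, ‖(τ (i + 1) - τ i) • emb (F (ξ i)) -
      ∫ s in τ i..τ (i + 1), emb (F s)‖ ≤ η * (τ (i + 1) - τ i) := by
    intro i hi
    have hi' := Finset.mem_range.1 hi
    have hm := hmon' i hi'
    obtain ⟨hx, hmesh⟩ := hξ i hi'
    rw [uIcc_of_le hm] at hx
    rw [abs_of_nonneg (by linarith)] at hmesh
    have e : (τ (i + 1) - τ i) • emb (F (ξ i)) = ∫ _ in τ i..τ (i + 1), emb (F (ξ i)) := by simp
    rw [e, ← intervalIntegral.integral_sub (by simp) (hint _ _)]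
    have hb := intervalIntegral.norm_integral_le_of_norm_le_const (a := τ i) (b := τ (i + 1))
      (f := fun s => emb (F (ξ i)) - emb (F s)) (C := η) fun s hs => by
        rw [uIoc_of_le hm] at hs
        rw [norm_emb_sub]
        have m1 := hmem i hi'.le
        have m2 := hmem (i + 1) hi'
        refine (hunif (ξ i) ⟨m1.1.trans hx.1, hx.2.trans m2.2⟩ s
          ⟨m1.1.trans hs.1.le, hs.2.trans m2.2⟩ ?_).le
        rw [Real.dist_eq, abs_lt]
        constructor <;> linarith [hs.1, hs.2, hx.1, hx.2]
    rwa [abs_of_nonneg (by linarith)] at hb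
  refine (norm_sum_le_of_le _ hle).trans_lt ?_
  rw [← Finset.mul_sum, Finset.sum_range_sub, h0, hn, div_mul_eq_mul_div,
    div_lt_iff₀ (by linarith)]
  nlinarith

/-- The mean value of the integrand lies in the closed convex set `emb '' C`; multiplying by the
length of the interval stays in the cone. Besides the whole space, `C` will be the subcone of
elements with support of length zero. -/
theorem exists_emb_eq_integral {C : Set X} (hC : IsClosed C) (h0 : (0 : X) ∈ C)
    (hadd : ∀ x ∈ C, ∀ y ∈ C, x + y ∈ C) (hsmul : ∀ c : ℝ, 0 ≤ c → ∀ x ∈ C, c • x ∈ C)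
    {F : ℝ → X} (hF : Continuous F) {α β : ℝ} (hFC : ∀ s ∈ Ioc α β, F s ∈ C)
    (hαβ : α ≤ β) :
    ∃ L ∈ C, emb L = ∫ s in α..β, emb (F s) := by
  rcases hαβ.eq_or_lt with rfl | hlt
  · exact ⟨0, h0, by rw [emb_zero, intervalIntegral.integral_same]⟩
  have hconv : Convex ℝ (emb '' C) := by
    rintro _ ⟨x, hx, rfl⟩ _ ⟨y, hy, rfl⟩ a b ha hb -
    exact ⟨a • x + b • y, hadd _ (hsmul a ha x hx) _ (hsmul b hb y hy),
      by rw [emb_add, emb_smul ha, emb_smul hb]⟩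
  have hmem := hconv.set_average_mem (isClosed_image_emb hC) (μ := volume) (t := Ioc α β)
    (f := fun s => emb (F s)) (by simpa using hlt) (by simp)
    (ae_restrict_of_forall_mem measurableSet_Ioc fun s hs => ⟨F s, hFC s hs, rfl⟩)
    ((continuous_emb.comp hF).integrableOn_Ioc)
  obtain ⟨L, hL, e⟩ := hmem
  refine ⟨(β - α) • L, hsmul _ (by linarith) _ hL, ?_⟩
  rw [emb_smul (by linarith), e, ← uIoc_of_le hαβ, interval_average_eq, smul_smul,
    mul_inv_cancel₀ (by linarith), one_smul]

theorem exists_hasRiemannIntegral_of_le {F : ℝ → X} (hF : Continuous F) {α β : ℝ} (hαβ : α ≤ β) :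
    ∃ L, HasRiemannIntegral F α β L ∧ emb L = ∫ s in α..β, emb (F s) := by
  obtain ⟨L, -, hL⟩ := exists_emb_eq_integral isClosed_univ (mem_univ (0 : X))
    (fun _ _ _ _ => mem_univ _) (fun _ _ _ _ => mem_univ _) hF (fun _ _ => mem_univ _) hαβ
  exact ⟨L, hasRiemannIntegral_of_emb hF hαβ hL, hL⟩

/-- An equidistant partition finer than both mesh bounds tests the two limits on the same sum. -/
theorem HasRiemannIntegral.unique {F : ℝ → X} {α β : ℝ} {L L' : X}
    (h : HasRiemannIntegral F α β L) (h' : HasRiemannIntegral F α β L') : L = L' := by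
  refine eq_of_forall_dist_le fun ε hε => ?_
  obtain ⟨δ, hδ, H⟩ := h (ε / 2) (by linarith)
  obtain ⟨δ', hδ', H'⟩ := h' (ε / 2) (by linarith)
  obtain ⟨n, hn⟩ := exists_nat_gt (|β - α| / min δ δ')
  have hm : 0 < min δ δ' := lt_min hδ hδ'
  have hn0 : (0 : ℝ) < n := lt_of_le_of_lt (by positivity) hn
  set τ : ℕ → ℝ := fun i => α + i * ((β - α) / n) with hτ
  have hstep : ∀ i, τ (i + 1) - τ i = (β - α) / n := fun i => by
    simp only [hτ]; push_cast; ring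
  have hmesh : |(β - α) / n| < min δ δ' := by
    rw [abs_div, abs_of_pos hn0, div_lt_iff₀ hn0]
    rw [div_lt_iff₀ hm] at hn
    linarith
  have e0 : τ 0 = α := by simp [hτ]
  have en : τ n = β := by simp only [hτ]; field_simp; ring
  have hmon : (∀ i < n, τ i ≤ τ (i + 1)) ∨ (∀ i < n, τ (i + 1) ≤ τ i) := by
    rcases le_total 0 ((β - α) / n) with h | h
    · exact Or.inl fun i _ => by linarith [hstep i]
    · exact Or.inr fun i _ => by linarith [hstep i]
  have h1 := H n τ τ e0 en hmon fun i _ =>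
    ⟨left_mem_uIcc, by rw [hstep]; exact hmesh.trans_le (min_le_left _ _)⟩
  have h2 := H' n τ τ e0 en hmon fun i _ =>
    ⟨left_mem_uIcc, by rw [hstep]; exact hmesh.trans_le (min_le_right _ _)⟩
  have := dist_triangle_left L L' (riemannSum F τ τ n)
  linarith

theorem HasRiemannIntegral.emb_eq {F : ℝ → X} (hF : Continuous F) {α β : ℝ} (hαβ : α ≤ β) {L : X}
    (h : HasRiemannIntegral F α β L) : emb L = ∫ s in α..β, emb (F s) := by
  obtain ⟨L', h', e⟩ := exists_hasRiemannIntegral_of_le hF hαβ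
  rw [h.unique h', e]

/-- The substitution `s ↦ -s` changes the sign of the increments, which `(-1) •` absorbs by
associativity of scalars alone. It reduces integrals run backwards to increasing partitions. -/
theorem HasRiemannIntegral.reflect {F : ℝ → X} {α β : ℝ} {L : X}
    (h : HasRiemannIntegral F α β L) :
    HasRiemannIntegral (fun s => (-1 : ℝ) • F (-s)) (-α) (-β) L := by
  intro ε hε
  obtain ⟨δ, hδ, H⟩ := h ε hε
  refine ⟨δ, hδ, fun n τ ξ h0 hn hmon hξ => ?_⟩
  have e : ∀ m, riemannSum (fun s => (-1 : ℝ) • F (-s)) τ ξ m =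
      riemannSum F (fun i => -τ i) (fun i => -ξ i) m := by
    intro m
    induction m with
    | zero => rfl
    | succ m ih =>
      rw [riemannSum, riemannSum, ih, smul_smul]
      congr 2
      ring
  rw [e]
  refine H n _ _ (by simp [h0]) (by simp [hn]) ?_ fun i hi => ⟨?_, ?_⟩
  · rcases hmon with h | h
    · exact Or.inr fun i hi => neg_le_neg (h i hi)
    · exact Or.inl fun i hi => neg_le_neg (h i hi)
  · rcases mem_uIcc.1 (hξ i hi).1 with h | h
    · exact mem_uIcc.2 (Or.inr ⟨neg_le_neg h.2, neg_le_neg h.1⟩)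
    · exact mem_uIcc.2 (Or.inl ⟨neg_le_neg h.2, neg_le_neg h.1⟩)
  · rw [neg_sub_neg, abs_sub_comm]
    exact (hξ i hi).2

theorem exists_hasRiemannIntegral {F : ℝ → X} (hF : Continuous F) (α β : ℝ) :
    ∃ L, HasRiemannIntegral F α β L := by
  rcases le_total α β with h | h
  · obtain ⟨L, hL, -⟩ := exists_hasRiemannIntegral_of_le hF h
    exact ⟨L, hL⟩
  · obtain ⟨L, hL, -⟩ := exists_hasRiemannIntegral_of_le
      (F := fun s => (-1 : ℝ) • F (-s)) (by fun_prop) (neg_le_neg h)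
    refine ⟨L, ?_⟩
    simpa only [smul_smul, neg_neg, mul_neg, mul_one, one_smul] using hL.reflect

theorem HasRiemannIntegral.map {B : X → X} (hB : IsContLinOp B) {F : ℝ → X} {α β : ℝ} {L : X}
    (h : HasRiemannIntegral F α β L) : HasRiemannIntegral (fun s => B (F s)) α β (B L) := by
  intro ε hε
  obtain ⟨η, hη, hc⟩ := hB.continuous L ε hε
  obtain ⟨δ, hδ, H⟩ := h η hη
  refine ⟨δ, hδ, fun n τ ξ h0 hn hmon hξ => ?_⟩
  have e : ∀ m, riemannSum (fun s => B (F s)) τ ξ m = B (riemannSum F τ ξ m) := by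
    intro m
    induction m with
    | zero => exact hB.map_zero.symm
    | succ m ih => rw [riemannSum, riemannSum, ih, hB.map_add, hB.map_smul]
  rw [e]
  exact hc _ (H n τ ξ h0 hn hmon hξ)

theorem hasRiemannIntegral_zero (α β : ℝ) : HasRiemannIntegral (fun _ => (0 : X)) α β 0 := by
  intro ε hε
  refine ⟨1, one_pos, fun n τ ξ _ _ _ _ => ?_⟩
  have e : ∀ m, riemannSum (fun _ => (0 : X)) τ ξ m = 0 := by
    intro m
    induction m with
    | zero => rfl
    | succ m ih => rw [riemannSum, ih, smul_zero, add_zero]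
  rwa [e, dist_self]

/-! ## Variation of parameters -/

section Duhamel

variable {A : X → X} {g u J : ℝ → X} {u₀ : X}

theorem continuous_duhamel_integrand (hA : IsContLinOp A) (hg : Continuous g) (t : ℝ) :
    Continuous fun s => coneExp A (t - s) (g s) :=
  (continuous_uncurry_coneExp hA).comp
    (by fun_prop : Continuous fun s : ℝ => ((t - s, g s) : ℝ × X))

/-- Applying `e^{hA}` under the integral up to `t` shifts the kernel to `t + h - s`, by the
semigroup law for `h ≥ 0` and `t - s ≥ 0`. What remains of the integral up to `t + h` is `K`. -/
theorem duhamel_increment (hA : IsContLinOp A) (hg : Continuous g)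
    (hJ : ∀ t, 0 ≤ t → HasRiemannIntegral (fun s => coneExp A (t - s) (g s)) 0 t (J t))
    (hu : ∀ t, 0 ≤ t → u t = coneExp A t u₀ + J t) {t h : ℝ} (ht : 0 ≤ t) (hh : 0 ≤ h) :
    ∃ K, u (t + h) = coneExp A h (u t) + K ∧
      emb K = ∫ s in t..(t + h), emb (coneExp A (t + h - s) (g s)) := by
  have hc := continuous_duhamel_integrand hA hg (t + h)
  obtain ⟨K, -, hK⟩ := exists_hasRiemannIntegral_of_le hc (show t ≤ t + h by linarith)
  refine ⟨K, ?_, hK⟩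
  have h1 : emb (coneExp A h (J t)) = ∫ s in 0..t, emb (coneExp A (t + h - s) (g s)) := by
    have h2 := (hJ t ht).map (isContLinOp_coneExp hA h)
    have h3 := h2.emb_eq ((continuous_coneExp hA h).comp (continuous_duhamel_integrand hA hg t)) ht
    rw [h3]
    refine intervalIntegral.integral_congr fun s hs => ?_
    rw [uIcc_of_le ht] at hs
    rw [Function.comp_apply, ← coneExp_add_of_nonneg hA hh (by linarith [hs.2])]
    congr 2
    ring
  have h2 : J (t + h) = coneExp A h (J t) + K := by
    apply emb_injective
    rw [emb_add, h1, hK, (hJ (t + h) (by linarith)).emb_eq hc (by linarith)]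
    exact (intervalIntegral.integral_add_adjacent_intervals
      ((continuous_emb.comp hc).intervalIntegrable _ _)
      ((continuous_emb.comp hc).intervalIntegrable _ _)).symm
  rw [hu _ (by linarith), hu t ht, h2, (isContLinOp_coneExp hA h).map_add, add_comm t h,
    coneExp_add_of_nonneg hA hh ht, add_assoc]

/-- The difference is the series tail of `e^{hA} u(t)` plus the new piece of the integral. The
comparison value `y` is free, so that the base point may move with `h` while `y` stays fixed. -/
theorem duhamel_difference (hA : IsContLinOp A) (hg : Continuous g) {M : ℝ} (hM : 0 ≤ M)
    (hAM : ∀ x, dist 0 (A x) ≤ M * dist 0 x)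
    (hJ : ∀ t, 0 ≤ t → HasRiemannIntegral (fun s => coneExp A (t - s) (g s)) 0 t (J t))
    (hu : ∀ t, 0 ≤ t → u t = coneExp A t u₀ + J t) {t h : ℝ} (ht : 0 ≤ t) (hh : 0 < h) :
    ∃ w, u (t + h) = u t + w ∧ ∀ (y : X) (c : ℝ),
      (∀ s ∈ Icc t (t + h), dist (coneExp A (t + h - s) (g s)) y ≤ c) →
      dist ((1 / h) • w) (A (u t) + y) ≤ h * M ^ 2 * Real.exp (h * M) * dist 0 (u t) + c := by
  obtain ⟨K, hK, hKe⟩ := duhamel_increment hA hg hJ hu ht hh.le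
  obtain ⟨v, hv, hvd⟩ := exists_coneExp_eq_add hA hM hAM h (u t)
  refine ⟨v + K, by rw [hK, hv, add_assoc], fun y c hc => ?_⟩
  have h1 : dist K (h • y) ≤ c * h := by
    rw [← norm_emb_sub, hKe, emb_smul hh.le]
    have e : h • emb y = ∫ _ in t..(t + h), emb y := by simp
    rw [e, ← intervalIntegral.integral_sub _ (by simp)]
    · have := intervalIntegral.norm_integral_le_of_norm_le_const (a := t) (b := t + h)
        (f := fun s => emb (coneExp A (t + h - s) (g s)) - emb y) (C := c) fun s hs => by
          rw [uIoc_of_le (by linarith)] at hs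
          rw [norm_emb_sub]
          exact hc s ⟨hs.1.le, hs.2⟩
      rwa [add_sub_cancel_left, abs_of_pos hh] at this
    · exact (continuous_emb.comp (continuous_duhamel_integrand hA hg (t + h))).intervalIntegrable _ _
  have h2 : A (u t) + y = (1 / h) • (h • A (u t) + h • y) := by
    rw [← smul_add, smul_smul, one_div_mul_cancel hh.ne', one_smul]
  rw [h2, MetricCone.dist_smul, abs_of_pos (by positivity), one_div, inv_mul_le_iff₀ hh]
  rw [abs_of_pos hh] at hvd
  calc _ ≤ _ := MetricCone.dist_add_add_le _ _ _ _
    _ ≤ _ := add_le_add hvd h1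
    _ = _ := by ring

/-- Needed for the left derivative, whose difference is based at `t - h` and so involves `A (u (t -
h))`. -/
theorem duhamel_continuousOn (hA : IsContLinOp A) (hg : Continuous g)
    (hJ : ∀ t, 0 ≤ t → HasRiemannIntegral (fun s => coneExp A (t - s) (g s)) 0 t (J t))
    (hu : ∀ t, 0 ≤ t → u t = coneExp A t u₀ + J t) : ContinuousOn u (Ici 0) := by
  have hJc : ContinuousOn J (Ici 0) := by
    rw [isometry_emb.isUniformInducing.isInducing.continuousOn_iff]
    have hc : Continuous fun t => ∫ s in (0 : ℝ)..t, emb (coneExp A (t - s) (g s)) := by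
      refine intervalIntegral.continuous_parametric_intervalIntegral_of_continuous ?_ continuous_id
      exact continuous_emb.comp ((continuous_uncurry_coneExp hA).comp
        (by fun_prop : Continuous fun q : ℝ × ℝ => ((q.1 - q.2, g q.2) : ℝ × X)))
    exact hc.continuousOn.congr fun t ht =>
      (hJ t ht).emb_eq (continuous_duhamel_integrand hA hg t) ht
  have hT : Continuous fun t => coneExp A t u₀ :=
    (continuous_uncurry_coneExp hA).comp (by fun_prop : Continuous fun t : ℝ => (t, u₀))
  exact (hT.continuousOn.add hJc).congr fun t ht => hu t ht

theorem duhamel_hasHukuharaDeriv (hA : IsContLinOp A) (hg : Continuous g)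
    (hJ : ∀ t, 0 ≤ t → HasRiemannIntegral (fun s => coneExp A (t - s) (g s)) 0 t (J t))
    (hu : ∀ t, 0 ≤ t → u t = coneExp A t u₀ + J t) {t : ℝ} (ht : 0 ≤ t) :
    HasHukuharaDeriv (Ici 0) u (A (u t) + g t) t := by
  obtain ⟨M, hM, hAM⟩ := hA.exists_bound
  have hW : ∀ s h : ℝ, ∃ w, 0 ≤ s → 0 < h → u (s + h) = u s + w ∧ ∀ (y : X) (c : ℝ),
      (∀ r ∈ Icc s (s + h), dist (coneExp A (s + h - r) (g r)) y ≤ c) →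
      dist ((1 / h) • w) (A (u s) + y) ≤ h * M ^ 2 * Real.exp (h * M) * dist 0 (u s) + c := by
    intro s h
    by_cases hs : 0 ≤ s ∧ 0 < h
    · obtain ⟨w, hw⟩ := duhamel_difference hA hg hM hAM hJ hu hs.1 hs.2
      exact ⟨w, fun _ _ => hw⟩
    · exact ⟨0, fun h1 h2 => absurd ⟨h1, h2⟩ hs⟩
  choose W hW using hW
  have huc := duhamel_continuousOn hA hg hJ hu
  -- One limit serves both sides: the base point `θ h` is `t` for the right derivative and `t - h`
  -- for the left one.
  have key : ∀ θ : ℝ → ℝ, Tendsto θ (𝓝[>] 0) (𝓝 t) →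
      (∀ᶠ h in 𝓝[>] 0, 0 ≤ θ h ∧ t ∈ Icc (θ h) (θ h + h)) →
      Tendsto (fun h => dist ((1 / h) • W (θ h) h) (A (u t) + g t)) (𝓝[>] 0) (𝓝 0) := by
    intro θ hθ hev
    have hh0 : Tendsto (fun h : ℝ => h) (𝓝[>] 0) (𝓝 0) := nhdsWithin_le_nhds
    have hθ' : Tendsto θ (𝓝[>] 0) (𝓝[Ici 0] t) :=
      tendsto_nhdsWithin_iff.2 ⟨hθ, hev.mono fun h hh => hh.1⟩
    have huθ : Tendsto (fun h => u (θ h)) (𝓝[>] 0) (𝓝 (u t)) := (huc t ht).tendsto.comp hθ'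
    have hlim : Tendsto (fun h => h * M ^ 2 * Real.exp (h * M) * dist 0 (u (θ h)) +
        dist (A (u (θ h))) (A (u t))) (𝓝[>] 0) (𝓝 0) := by
      have h1 : Tendsto (fun h : ℝ => h * M ^ 2 * Real.exp (h * M)) (𝓝[>] 0) (𝓝 0) := by
        have : Continuous fun h : ℝ => h * M ^ 2 * Real.exp (h * M) := by fun_prop
        simpa using (this.tendsto 0).mono_left nhdsWithin_le_nhds
      have h2 := (h1.mul (tendsto_const_nhds (x := (0 : X)).dist huθ)).add
        (((hA.continuous'.tendsto (u t)).comp huθ).dist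
          (tendsto_const_nhds (x := A (u t))))
      simpa using h2
    rw [Metric.tendsto_nhds]
    intro ε hε
    have hjc := (continuous_uncurry_coneExp hA).comp
      (by fun_prop : Continuous fun q : ℝ × ℝ => ((q.1, g q.2) : ℝ × X))
    have hj0 := Metric.tendsto_nhds.1 (hjc.tendsto (0, t)) (ε / 3) (by positivity)
    rw [Metric.eventually_nhds_iff] at hj0
    obtain ⟨δ, hδ, hj⟩ := hj0
    filter_upwards [hev, hlim.eventually_lt_const (show 0 < ε / 3 by positivity),
      hh0.eventually_lt_const hδ, self_mem_nhdsWithin] with h hh hsmall hhδ hpos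
    replace hpos : 0 < h := hpos
    obtain ⟨-, hw⟩ := hW (θ h) h hh.1 hpos
    have hb := hw (g t) (ε / 3) fun r hr => by
      have := @hj (θ h + h - r, r) (by
        rw [Prod.dist_eq, max_lt_iff, Real.dist_eq, Real.dist_eq]
        dsimp only
        obtain ⟨a1, a2⟩ := hh.2
        obtain ⟨b1, b2⟩ := hr
        constructor <;> rw [abs_lt] <;> constructor <;> linarith)
      simp only [Function.comp_apply, coneExp_zero hA] at this
      exact this.le
    rw [Real.dist_0_eq_abs, abs_of_nonneg dist_nonneg]
    have htri := dist_triangle ((1 / h) • W (θ h) h) (A (u (θ h)) + g t) (A (u t) + g t)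
    rw [MetricCone.dist_add_right] at htri
    linarith
  refine ⟨fun _ => ?_, fun hs => ?_⟩
  · refine ⟨fun h => W t h, ?_, key (fun _ => t) tendsto_const_nhds ?_⟩
    · filter_upwards [self_mem_nhdsWithin] with h hh
      exact (hW t h ht hh).1
    · filter_upwards [self_mem_nhdsWithin] with h hh
      have hh' : 0 < h := hh
      exact ⟨ht, le_rfl, by linarith⟩
  · obtain ⟨s, hs0, hst⟩ := hs
    have hs0' : 0 ≤ s := hs0
    have ht0 : 0 < t := by linarith
    have hev : ∀ᶠ h in 𝓝[>] (0 : ℝ), h < t :=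
      nhdsWithin_le_nhds (eventually_lt_nhds ht0)
    refine ⟨fun h => W (t - h) h, ?_, key (fun h => t - h) ?_ ?_⟩
    · filter_upwards [self_mem_nhdsWithin, hev] with h hh hht
      have := (hW (t - h) h (by linarith) hh).1
      rwa [sub_add_cancel] at this
    · have : Continuous fun h : ℝ => t - h := by fun_prop
      simpa using (this.tendsto 0).mono_left (nhdsWithin_le_nhds (s := Ioi 0))
    · filter_upwards [self_mem_nhdsWithin, hev] with h hh hht
      have hh' : 0 < h := hh
      exact ⟨by linarith, by linarith, by linarith⟩

theorem HDiffTendsto.neg {p q : ℝ → X} {c : ℝ → ℝ} {L : X} (h : HDiffTendsto p q c L) :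
    HDiffTendsto p q (fun s => -c s) ((-1 : ℝ) • L) := by
  obtain ⟨w, h1, h2⟩ := h
  refine ⟨w, h1, ?_⟩
  refine h2.congr fun s => ?_
  rw [show (-c s) • w s = (-1 : ℝ) • c s • w s by rw [smul_smul, neg_one_mul],
    MetricCone.dist_smul]
  simp

/-- All differentiability statements for the solution given by the variation of parameters. -/
theorem duhamel_deriv (hA : IsContLinOp A) (hg : Continuous g)
    (hJ : ∀ t, HasRiemannIntegral (fun s => coneExp A (t - s) (g s)) 0 t (J t))
    (hu : ∀ t, u t = coneExp A t u₀ + J t) :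
    (∀ t : ℝ, HasGenDeriv u (A (u t) + g t) t) ∧
      (∀ t : ℝ, 0 ≤ t → HasHukuharaDeriv (Ici 0) u (A (u t) + g t) t) ∧
      (∀ t : ℝ, t < 0 → HasKindDeriv .two univ u (A (u t) + g t) t) := by
  have hpos : ∀ t : ℝ, 0 ≤ t → HasHukuharaDeriv (Ici 0) u (A (u t) + g t) t := fun t ht =>
    duhamel_hasHukuharaDeriv hA hg (fun t _ => hJ t) (fun t _ => hu t) ht
  -- The reversed function `s ↦ u (-s)` is again given by variation of parameters, for `negOp A` and
  -- the forcing `(-1) • g (-s)`.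
  have hJ' : ∀ t, HasRiemannIntegral
      (fun s => coneExp (negOp A) (t - s) ((-1 : ℝ) • g (-s))) 0 t (J (-t)) := by
    intro t
    have h := (hJ (-t)).reflect
    rw [neg_zero, neg_neg] at h
    convert h using 2 with s
    rw [coneExp_negOp hA, ← (isContLinOp_coneExp hA _).map_smul]
    congr 1
    ring
  have hneg : ∀ t : ℝ, 0 ≤ t → HasHukuharaDeriv (Ici 0) (fun s => u (-s))
      ((-1 : ℝ) • (A (u (-t)) + g (-t))) t := fun t ht => by
    rw [smul_add]
    exact duhamel_hasHukuharaDeriv (isContLinOp_negOp hA) (u₀ := u₀) (J := fun s => J (-s))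
      (by fun_prop) (fun t _ => hJ' t)
      (fun t _ => by rw [hu, coneExp_negOp hA]) ht
  -- The right derivative of the reversed function at `-t` becomes the left condition of case 2, and
  -- this includes `t = 0`.
  have hleft : ∀ t : ℝ, t ≤ 0 →
      HDiffTendsto (fun h => u (t - h)) (fun _ => u t) (fun h => -(1 / h)) (A (u t) + g t) := by
    intro t ht
    have h := ((hneg (-t) (by linarith)).1 ⟨-t + 1, by simp only [mem_Ici]; linarith, by linarith⟩)
    have h := HDiffTendsto.neg h
    simp only [smul_smul, neg_neg, neg_add_rev] at h
    convert h using 2 with s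
    · ring_nf
    · norm_num
  have htwo : ∀ t : ℝ, t < 0 → HasKindDeriv .two univ u (A (u t) + g t) t := by
    intro t ht
    refine ⟨fun _ => ?_, fun _ => hleft t ht.le⟩
    have h := ((hneg (-t) (by linarith)).2 ⟨0, by simp, by linarith⟩)
    have h := HDiffTendsto.neg h
    simp only [smul_smul, neg_neg, neg_sub] at h
    rw [neg_mul_neg, one_mul, one_smul] at h
    simpa only [DiffKind.Right, sub_neg_eq_add, add_comm] using h
  refine ⟨fun t => ?_, hpos, htwo⟩
  rcases lt_trichotomy t 0 with ht | rfl | ht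
  · exact ⟨.two, htwo t ht⟩
  -- At `0` the right condition of case 1 meets the left condition of case 2; together they are case
  -- 3.
  · exact ⟨.three, fun _ => (hpos 0 le_rfl).1 ⟨1, by simp, one_pos⟩, fun _ => hleft 0 le_rfl⟩
  · exact ⟨.one, fun _ => (hpos t ht.le).1 ⟨t + 1, by simp only [mem_Ici]; linarith, by linarith⟩,
      fun _ => (hpos t ht.le).2 ⟨0, by simp, ht⟩⟩

end Duhamel

/-- The exponential of an operator on a complete metric cone. -/
theorem coneExp_spec {A : X → X} (hA : IsContLinOp A) :
    ∃ T : ℝ → X → X,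
      (∀ t : ℝ, IsExpOp A t (T t)) ∧
      (∀ (t : ℝ) (S : X → X), IsExpOp A t S → S = T t) ∧
      (∀ t s : ℝ, (0 ≤ t ∧ 0 ≤ s) ∨ (t ≤ 0 ∧ s ≤ 0) → ∀ x : X, T (t + s) x = T t (T s x)) ∧
      (∀ x : X, HDiffTendsto (fun h => T h x) (fun _ => x) (fun h => 1 / h) (A x)) ∧
      (∀ t : ℝ, Tendsto (fun s => opDist (T s) (T t)) (𝓝 t) (𝓝 0)) ∧
      (∀ x : X, T 0 x = x) ∧
      (∀ (x : X) (t : ℝ), HasGenDeriv (fun s => T s x) (A (T t x)) t) ∧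
      (∀ (x : X) (t : ℝ), 0 ≤ t → HasHukuharaDeriv (Ici 0) (fun s => T s x) (A (T t x)) t) ∧
      (∀ (x : X) (t : ℝ), t < 0 → HasKindDeriv .two univ (fun s => T s x) (A (T t x)) t) ∧
      (∀ (u₀ : X) (g : ℝ → X), (∀ t, Tendsto (fun s => dist (g s) (g t)) (𝓝 t) (𝓝 0)) →
        (∀ t : ℝ, ∃ L : X, HasRiemannIntegral (fun s => T (t - s) (g s)) 0 t L) ∧
        ∀ u J : ℝ → X, (∀ t, HasRiemannIntegral (fun s => T (t - s) (g s)) 0 t (J t)) →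
          (∀ t, u t = T t u₀ + J t) →
          u 0 = u₀ ∧
          (∀ t : ℝ, HasGenDeriv u (A (u t) + g t) t) ∧
          (∀ t : ℝ, 0 ≤ t → HasHukuharaDeriv (Ici 0) u (A (u t) + g t) t) ∧
          (∀ t : ℝ, t < 0 → HasKindDeriv .two univ u (A (u t) + g t) t)) := by
  -- The orbits are the solutions with zero forcing; the generator formula is then the right
  -- derivative at `0`.
  have hom : ∀ x : X, (∀ t : ℝ, HasGenDeriv (fun s => coneExp A s x) (A (coneExp A t x)) t) ∧
      (∀ t : ℝ, 0 ≤ t → HasHukuharaDeriv (Ici 0) (fun s => coneExp A s x) (A (coneExp A t x)) t) ∧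
      (∀ t : ℝ, t < 0 → HasKindDeriv .two univ (fun s => coneExp A s x) (A (coneExp A t x)) t) := by
    intro x
    have h := duhamel_deriv (u := fun s => coneExp A s x) (u₀ := x) (g := fun _ => 0)
      (J := fun _ => 0) hA continuous_const (fun t => by
        simp only [(isContLinOp_coneExp hA _).map_zero]
        exact hasRiemannIntegral_zero 0 t) (fun t => (add_zero _).symm)
    simpa only [add_zero] using h
  refine ⟨coneExp A, isExpOp_coneExp hA, fun t S hS => hS.unique hA, ?_, fun x => ?_,
    tendsto_opDist_coneExp hA, coneExp_zero hA, fun x => (hom x).1, fun x => (hom x).2.1,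
    fun x => (hom x).2.2, fun u₀ g hg => ?_⟩
  · rintro t s (⟨ht, hs⟩ | ⟨ht, hs⟩) x
    · exact coneExp_add_of_nonneg hA ht hs x
    · exact coneExp_add_of_nonpos hA ht hs x
  · have h := ((hom x).2.1 0 le_rfl).1 ⟨1, by simp, one_pos⟩
    simpa only [DiffKind.Right, zero_add, coneExp_zero hA] using h
  · have hgc : Continuous g :=
      continuous_iff_continuousAt.2 fun t => tendsto_iff_dist_tendsto_zero.2 (hg t)
    refine ⟨fun t => exists_hasRiemannIntegral (continuous_duhamel_integrand hA hgc t) 0 t,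
      fun u J hJ hu => ⟨?_, duhamel_deriv hA hgc hJ hu⟩⟩
    have h0 : J 0 = 0 := emb_injective (by
      rw [(hJ 0).emb_eq (continuous_duhamel_integrand hA hgc 0) le_rfl, emb_zero,
        intervalIntegral.integral_same])
    rw [hu, h0, coneExp_zero hA, add_zero]

end Integral

/-! ## The cone of fuzzy numbers -/

namespace FuzzyNumber

theorem cut_eq_Icc (u : FuzzyNumber) {r : ℝ} (hr : r ∈ Ioc (0 : ℝ) 1) :
    {x | r ≤ u x} = Icc (u.lower r) (u.upper r) := by
  rw [lower_of_pos _ hr.1, upper_of_pos _ hr.1]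
  exact eq_Icc_of_connected_compact
    ⟨u.cut_nonempty hr.2, (u.convex_cut r).isPreconnected⟩ (u.isCompact_cut hr.1)

theorem le_apply_iff (u : FuzzyNumber) {r : ℝ} (hr : r ∈ Ioc (0 : ℝ) 1) (x : ℝ) :
    r ≤ u x ↔ u.lower r ≤ x ∧ x ≤ u.upper r :=
  Set.ext_iff.1 (u.cut_eq_Icc hr) x

/-- The cuts are compact intervals, so the endpoints determine them. The algebraic laws thereby
become identities between real numbers. -/
theorem ext_levels {u v : FuzzyNumber}
    (h : ∀ r ∈ Icc (0 : ℝ) 1, u.lower r = v.lower r ∧ u.upper r = v.upper r) : u = v := by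
  refine ext_cut fun r hr => ?_
  rcases le_or_gt r 1 with h1 | h1
  · rw [cut_eq_Icc u ⟨hr, h1⟩, cut_eq_Icc v ⟨hr, h1⟩, (h r ⟨hr.le, h1⟩).1, (h r ⟨hr.le, h1⟩).2]
  · ext x
    simp only [mem_ofPred_eq]
    have := (u.mem_Icc x).2
    have := (v.mem_Icc x).2
    constructor <;> intro <;> linarith

theorem lower_smul_of_nonneg {c : ℝ} (hc : 0 ≤ c) (u : FuzzyNumber) {r : ℝ}
    (hr : r ∈ Icc (0 : ℝ) 1) : (c • u).lower r = c * u.lower r ∧ (c • u).upper r = c * u.upper r := by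
  rcases lower_upper_smul c u hr with h | ⟨h, h1, h2⟩
  · exact h.2
  · obtain rfl := le_antisymm h hc
    simp [h1, h2]

theorem lower_smul_of_nonpos {c : ℝ} (hc : c ≤ 0) (u : FuzzyNumber) {r : ℝ}
    (hr : r ∈ Icc (0 : ℝ) 1) : (c • u).lower r = c * u.upper r ∧ (c • u).upper r = c * u.lower r := by
  rcases lower_upper_smul c u hr with ⟨h, h1, h2⟩ | h
  · obtain rfl := le_antisymm h hc
    simp [h1, h2]
  · exact h.2

noncomputable instance : AddCommMonoid FuzzyNumber where
  add_assoc u v w := ext_levels fun r hr => by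
    simp only [lower_add _ _ hr, upper_add _ _ hr, add_assoc, and_self]
  zero_add u := ext_levels fun r hr => by
    simp only [lower_add _ _ hr, upper_add _ _ hr, lower_zero_number hr, upper_zero_number hr,
      zero_add, and_self]
  add_zero u := ext_levels fun r hr => by
    simp only [lower_add _ _ hr, upper_add _ _ hr, lower_zero_number hr, upper_zero_number hr,
      add_zero, and_self]
  add_comm u v := ext_levels fun r hr => by
    simp only [lower_add _ _ hr, upper_add _ _ hr, add_comm, and_self]
  nsmul := nsmulRec

noncomputable instance : DistribMulAction ℝ FuzzyNumber where
  one_smul u := ext_levels fun r hr => by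
    simp [(lower_smul_of_nonneg zero_le_one u hr).1, (lower_smul_of_nonneg zero_le_one u hr).2]
  mul_smul c e u := (smul_smul' c e u).symm
  smul_zero := smul_zero'
  smul_add := smul_add'

theorem dist_comm' (u v : FuzzyNumber) : dist u v = dist v u := by
  simp only [dist_def, abs_sub_comm]

theorem dist_triangle' (u v w : FuzzyNumber) : dist u w ≤ dist u v + dist v w :=
  dist_le _ _ _ fun r hr =>
    ⟨(abs_sub_le _ (v.lower r) _).trans (add_le_add (le_dist u v hr).1 (le_dist v w hr).1),
      (abs_sub_le _ (v.upper r) _).trans (add_le_add (le_dist u v hr).2 (le_dist v w hr).2)⟩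

noncomputable instance : MetricSpace FuzzyNumber where
  dist_self := dist_self'
  dist_comm := dist_comm'
  dist_triangle := dist_triangle'
  eq_of_dist_eq_zero {u v} h := ext_levels fun r hr => by
    have := le_dist u v hr
    rw [h] at this
    exact ⟨sub_eq_zero.1 (abs_eq_zero.1 (le_antisymm this.1 (abs_nonneg _))),
      sub_eq_zero.1 (abs_eq_zero.1 (le_antisymm this.2 (abs_nonneg _)))⟩

/-- Reflection transfers the continuity properties of lower endpoints to upper ones. -/
theorem upper_eq_neg_lower (u : FuzzyNumber) {r : ℝ} (hr : r ∈ Icc (0 : ℝ) 1) :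
    u.upper r = -((-1 : ℝ) • u).lower r := by
  rw [(lower_smul_of_nonpos (by norm_num) u hr).1]
  ring

theorem level_antitone (u : FuzzyNumber) {q r : ℝ} (hq : 0 ≤ q) (hqr : q ≤ r) (hr : r ≤ 1) :
    u.lower q ≤ u.lower r ∧ u.upper r ≤ u.upper q := by
  rcases hq.eq_or_lt with rfl | hq
  · have := u.endpoint_mem ⟨hqr, hr⟩
    exact ⟨this.1, this.2.2⟩
  · have hsub : {x | r ≤ u x} ⊆ {x | q ≤ u x} := fun x hx => hqr.trans hx
    rw [lower_of_pos _ hq, lower_of_pos _ (hq.trans_le hqr), upper_of_pos _ hq,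
      upper_of_pos _ (hq.trans_le hqr)]
    exact ⟨csInf_le_csInf (u.isCompact_cut hq).bddBelow (u.cut_nonempty hr) hsub,
      csSup_le_csSup (u.isCompact_cut hq).bddAbove (u.cut_nonempty hr) hsub⟩

/-- Otherwise the point `u.lower r - ε` lies in every cut at a level `q < r`, so its membership
value is at least `r`, which puts it in the cut at `r`. -/
theorem lower_left_cont (u : FuzzyNumber) {r : ℝ} (hr : r ∈ Ioc (0 : ℝ) 1) {ε : ℝ} (hε : 0 < ε) :
    ∃ q ∈ Ico (0 : ℝ) r, u.lower r - ε < u.lower q := by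
  by_contra! h
  have h1 : r ≤ u (u.lower r - ε) := by
    refine le_of_forall_lt_imp_le_of_dense fun q hq => ?_
    rcases le_or_gt q 0 with h0 | h0
    · exact h0.trans (u.mem_Icc _).1
    · refine (u.le_apply_iff ⟨h0, hq.le.trans hr.2⟩ _).2 ⟨h q ⟨h0.le, hq⟩, ?_⟩
      have h2 := (u.level_antitone h0.le hq.le hr.2).2
      have h3 := (u.endpoint_mem (Ioc_subset_Icc_self hr)).2.1
      linarith
  have := ((u.le_apply_iff hr _).1 h1).1
  linarith

theorem lower_right_cont_zero (u : FuzzyNumber) {ε : ℝ} (hε : 0 < ε) :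
    ∃ q ∈ Ioc (0 : ℝ) 1, u.lower q < u.lower 0 + ε := by
  rw [lower_zero]
  obtain ⟨x, hx, hlt⟩ := exists_lt_of_csInf_lt u.support_nonempty
    (show sInf {x | 0 < u x} < sInf {x | 0 < u x} + ε by linarith)
  have hq : u x ∈ Ioc (0 : ℝ) 1 := ⟨hx, (u.mem_Icc x).2⟩
  exact ⟨u x, hq, ((u.le_apply_iff hq x).1 le_rfl).1.trans_lt hlt⟩

theorem upper_left_cont (u : FuzzyNumber) {r : ℝ} (hr : r ∈ Ioc (0 : ℝ) 1) {ε : ℝ} (hε : 0 < ε) :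
    ∃ q ∈ Ico (0 : ℝ) r, u.upper q < u.upper r + ε := by
  obtain ⟨q, hq, h⟩ := lower_left_cont ((-1 : ℝ) • u) hr hε
  refine ⟨q, hq, ?_⟩
  rw [u.upper_eq_neg_lower (Ioc_subset_Icc_self hr),
    u.upper_eq_neg_lower ⟨hq.1, hq.2.le.trans hr.2⟩]
  linarith

theorem upper_right_cont_zero (u : FuzzyNumber) {ε : ℝ} (hε : 0 < ε) :
    ∃ q ∈ Ioc (0 : ℝ) 1, u.upper 0 - ε < u.upper q := by
  obtain ⟨q, hq, h⟩ := lower_right_cont_zero ((-1 : ℝ) • u) hε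
  refine ⟨q, hq, ?_⟩
  rw [u.upper_eq_neg_lower (by simp), u.upper_eq_neg_lower (Ioc_subset_Icc_self hq)]
  linarith

/-! ### Reconstruction of a fuzzy number from its levels, and completeness. -/

/-- Families of intervals that are the level sets of a fuzzy number. -/
structure IsLevelFamily (l U : ℝ → ℝ) : Prop where
  le : l 1 ≤ U 1
  mono : ∀ q r, 0 ≤ q → q ≤ r → r ≤ 1 → l q ≤ l r ∧ U r ≤ U q
  lower_left : ∀ r ∈ Ioc (0 : ℝ) 1, ∀ ε > 0, ∃ q ∈ Ico (0 : ℝ) r, l r - ε < l q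
  upper_left : ∀ r ∈ Ioc (0 : ℝ) 1, ∀ ε > 0, ∃ q ∈ Ico (0 : ℝ) r, U q < U r + ε
  lower_zero : ∀ ε > 0, ∃ q ∈ Ioc (0 : ℝ) 1, l q < l 0 + ε
  upper_zero : ∀ ε > 0, ∃ q ∈ Ioc (0 : ℝ) 1, U 0 - ε < U q

section OfLevels

variable {l U : ℝ → ℝ}

/-- The membership function with given level sets. -/
noncomputable def levelFun (l U : ℝ → ℝ) (x : ℝ) : ℝ := sSup {r | r ∈ Icc (0 : ℝ) 1 ∧ l r ≤ x ∧ x ≤ U r}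

theorem levelFun_mem (l U : ℝ → ℝ) (x : ℝ) : levelFun l U x ∈ Icc (0 : ℝ) 1 :=
  ⟨Real.sSup_nonneg fun _ hr => hr.1.1, Real.sSup_le (fun _ hr => hr.1.2) zero_le_one⟩

theorem le_levelFun (l U : ℝ → ℝ) {r x : ℝ} (hr : r ∈ Icc (0 : ℝ) 1) (h : l r ≤ x ∧ x ≤ U r) :
    r ≤ levelFun l U x := le_csSup ⟨1, fun _ hr => hr.1.2⟩ ⟨hr, h⟩

theorem exists_of_lt_levelFun {x q : ℝ} (h0 : 0 ≤ q) (hq : q < levelFun l U x) :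
    ∃ r ∈ Icc (0 : ℝ) 1, q < r ∧ l r ≤ x ∧ x ≤ U r := by
  -- The supremum of the empty set is `0`, which cannot exceed `q ≥ 0`.
  have hne : {r | r ∈ Icc (0 : ℝ) 1 ∧ l r ≤ x ∧ x ≤ U r}.Nonempty := by
    by_contra hne
    rw [not_nonempty_iff_eq_empty] at hne
    rw [levelFun, hne, Real.sSup_empty] at hq
    linarith
  obtain ⟨r, hr, hlt⟩ := exists_lt_of_lt_csSup hne hq
  exact ⟨r, hr.1, hlt, hr.2⟩

/-- A point of the superlevel set lies in all intervals with `q < r`; left continuity of the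
endpoints puts it in the interval at `r`. -/
theorem IsLevelFamily.le_levelFun_iff (h : IsLevelFamily l U) {r : ℝ} (hr : r ∈ Ioc (0 : ℝ) 1)
    (x : ℝ) : r ≤ levelFun l U x ↔ l r ≤ x ∧ x ≤ U r := by
  refine ⟨fun hx => ?_, le_levelFun l U (Ioc_subset_Icc_self hr)⟩
  have key : ∀ q ∈ Ico (0 : ℝ) r, l q ≤ x ∧ x ≤ U q := fun q hq => by
    obtain ⟨s, hs, hqs, h1, h2⟩ := exists_of_lt_levelFun hq.1 (hq.2.trans_le hx)
    have := h.mono q s hq.1 hqs.le hs.2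
    exact ⟨this.1.trans h1, h2.trans this.2⟩
  constructor
  · refine le_of_forall_pos_le_add fun ε hε => ?_
    obtain ⟨q, hq, h1⟩ := h.lower_left r hr ε hε
    linarith [(key q hq).1]
  · refine le_of_forall_pos_le_add fun ε hε => ?_
    obtain ⟨q, hq, h1⟩ := h.upper_left r hr ε hε
    linarith [(key q hq).2]

theorem IsLevelFamily.support_subset (h : IsLevelFamily l U) :
    {x | 0 < levelFun l U x} ⊆ Icc (l 0) (U 0) := fun x hx => by
  obtain ⟨s, hs, hqs, h1, h2⟩ := exists_of_lt_levelFun le_rfl hx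
  have := h.mono 0 s le_rfl hqs.le hs.2
  exact ⟨this.1.trans h1, h2.trans this.2⟩

/-- The fuzzy number with given level sets. -/
noncomputable def ofLevels (h : IsLevelFamily l U) : FuzzyNumber where
  toFun := levelFun l U
  mem_Icc := levelFun_mem l U
  normal := ⟨l 1, le_antisymm (levelFun_mem l U _).2
    (le_levelFun l U (by simp) ⟨le_rfl, h.le⟩)⟩
  convex x y t ht := by
    rcases le_or_gt (min (levelFun l U x) (levelFun l U y)) 0 with h0 | h0
    · exact h0.trans (levelFun_mem l U _).1
    · have hr : min (levelFun l U x) (levelFun l U y) ∈ Ioc (0 : ℝ) 1 :=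
        ⟨h0, (min_le_left _ _).trans (levelFun_mem l U x).2⟩
      exact (h.le_levelFun_iff hr _).2 (convex_Icc (l _) (U _)
        ((h.le_levelFun_iff hr x).1 (min_le_left _ _))
        ((h.le_levelFun_iff hr y).1 (min_le_right _ _)) ht.1 (by linarith [ht.2]) (by ring))
  usc := by
    rw [upperSemicontinuous_iff_isClosed_preimage]
    intro r
    rcases le_or_gt r 0 with h0 | h0
    · convert isClosed_univ
      ext x
      simpa using h0.trans (levelFun_mem l U x).1
    rcases le_or_gt r 1 with h1 | h1
    · convert isClosed_Icc (a := l r) (b := U r)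
      ext x
      exact h.le_levelFun_iff ⟨h0, h1⟩ x
    · convert isClosed_empty
      ext x
      simpa using (levelFun_mem l U x).2.trans_lt h1
  compact := isCompact_Icc.of_isClosed_subset isClosed_closure
    (closure_minimal h.support_subset isClosed_Icc)

/-- Level `0` is separate, being the closed support and not a superlevel set; there right continuity
at `0` is used. -/
theorem lower_upper_ofLevels (h : IsLevelFamily l U) {r : ℝ} (hr : r ∈ Icc (0 : ℝ) 1) :
    (ofLevels h).lower r = l r ∧ (ofLevels h).upper r = U r := by
  have hpos : ∀ r ∈ Ioc (0 : ℝ) 1, (ofLevels h).lower r = l r ∧ (ofLevels h).upper r = U r := by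
    intro r hr
    have e : {x | r ≤ ofLevels h x} = Icc (l r) (U r) := Set.ext fun x => h.le_levelFun_iff hr x
    have hle : l r ≤ U r := (h.mono r 1 hr.1.le hr.2 le_rfl).1.trans
      (h.le.trans (h.mono r 1 hr.1.le hr.2 le_rfl).2)
    rw [lower_of_pos _ hr.1, upper_of_pos _ hr.1, e, csInf_Icc hle, csSup_Icc hle]
    exact ⟨rfl, rfl⟩
  rcases hr.1.eq_or_lt with rfl | h0
  · constructor
    · apply le_antisymm
      · refine le_of_forall_pos_le_add fun ε hε => ?_
        obtain ⟨q, hq, h1⟩ := h.lower_zero ε hε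
        have := ((ofLevels h).endpoint_mem (Ioc_subset_Icc_self hq)).1
        rw [(hpos q hq).1] at this
        linarith
      · rw [FuzzyNumber.lower_zero]
        exact le_csInf (ofLevels h).support_nonempty fun x hx => (h.support_subset hx).1
    · apply le_antisymm
      · rw [FuzzyNumber.upper_zero]
        exact csSup_le (ofLevels h).support_nonempty fun x hx => (h.support_subset hx).2
      · refine le_of_forall_pos_le_add fun ε hε => ?_
        obtain ⟨q, hq, h1⟩ := h.upper_zero ε hε
        have := ((ofLevels h).endpoint_mem (Ioc_subset_Icc_self hq)).2.2
        rw [(hpos q hq).2] at this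
        linarith
  · exact hpos r ⟨h0, hr.2⟩

end OfLevels

/-- Each condition involves at most two levels, so it passes from a uniformly close fuzzy number `v`
with a loss of two small errors. -/
theorem isLevelFamily_of_tendsto {u : ℕ → FuzzyNumber} {l U : ℝ → ℝ}
    (h : ∀ ε > 0, ∃ n, ∀ r ∈ Icc (0 : ℝ) 1, |(u n).lower r - l r| ≤ ε ∧ |(u n).upper r - U r| ≤ ε) :
    IsLevelFamily l U := by
  have key : ∀ ε > 0, ∃ v : FuzzyNumber, ∀ r ∈ Icc (0 : ℝ) 1,
      (v.lower r ≤ l r + ε ∧ l r ≤ v.lower r + ε) ∧ (v.upper r ≤ U r + ε ∧ U r ≤ v.upper r + ε) :=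
    fun ε hε => by
      obtain ⟨n, hn⟩ := h ε hε
      refine ⟨u n, fun r hr => ?_⟩
      obtain ⟨h1, h2⟩ := hn r hr
      rw [abs_le] at h1 h2
      exact ⟨⟨by linarith, by linarith⟩, by linarith, by linarith⟩
  have m0 : (0 : ℝ) ∈ Icc (0 : ℝ) 1 := by simp
  have m1 : (1 : ℝ) ∈ Icc (0 : ℝ) 1 := by simp
  constructor
  · refine le_of_forall_pos_le_add fun ε hε => ?_
    obtain ⟨v, hv⟩ := key (ε / 2) (by linarith)
    linarith [(hv 1 m1).1.2, (hv 1 m1).2.1, (v.endpoint_mem m1).2.1]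
  · intro q r hq hqr hr
    constructor <;> refine le_of_forall_pos_le_add fun ε hε => ?_
    all_goals
      obtain ⟨v, hv⟩ := key (ε / 2) (by linarith)
      have a := hv q ⟨hq, hqr.trans hr⟩
      have b := hv r ⟨hq.trans hqr, hr⟩
      have c := v.level_antitone hq hqr hr
    · linarith [a.1.2, b.1.1, c.1]
    · linarith [a.2.1, b.2.2, c.2]
  · intro r hr ε hε
    obtain ⟨v, hv⟩ := key (ε / 3) (by linarith)
    obtain ⟨q, hq, hlt⟩ := v.lower_left_cont hr (show 0 < ε / 3 by linarith)
    refine ⟨q, hq, ?_⟩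
    linarith [(hv r (Ioc_subset_Icc_self hr)).1.2, (hv q ⟨hq.1, hq.2.le.trans hr.2⟩).1.1]
  · intro r hr ε hε
    obtain ⟨v, hv⟩ := key (ε / 3) (by linarith)
    obtain ⟨q, hq, hlt⟩ := v.upper_left_cont hr (show 0 < ε / 3 by linarith)
    refine ⟨q, hq, ?_⟩
    linarith [(hv r (Ioc_subset_Icc_self hr)).2.1, (hv q ⟨hq.1, hq.2.le.trans hr.2⟩).2.2]
  · intro ε hε
    obtain ⟨v, hv⟩ := key (ε / 3) (by linarith)
    obtain ⟨q, hq, hlt⟩ := v.lower_right_cont_zero (show 0 < ε / 3 by linarith)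
    exact ⟨q, hq, by linarith [(hv 0 m0).1.1, (hv q (Ioc_subset_Icc_self hq)).1.2]⟩
  · intro ε hε
    obtain ⟨v, hv⟩ := key (ε / 3) (by linarith)
    obtain ⟨q, hq, hlt⟩ := v.upper_right_cont_zero (show 0 < ε / 3 by linarith)
    exact ⟨q, hq, by linarith [(hv 0 m0).2.2, (hv q (Ioc_subset_Icc_self hq)).2.1]⟩

instance : CompleteSpace FuzzyNumber := by
  refine Metric.complete_of_cauchySeq_tendsto fun u hu => ?_
  have hlim : ∀ r : ℝ, ∃ p : ℝ × ℝ, r ∈ Icc (0 : ℝ) 1 →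
      Tendsto (fun n => (u n).lower r) atTop (𝓝 p.1) ∧
        Tendsto (fun n => (u n).upper r) atTop (𝓝 p.2) := by
    intro r
    by_cases hr : r ∈ Icc (0 : ℝ) 1
    · have h1 : CauchySeq fun n => (u n).lower r := by
        rw [Metric.cauchySeq_iff] at hu ⊢
        intro ε hε
        obtain ⟨N, hN⟩ := hu ε hε
        exact ⟨N, fun m hm n hn => (le_dist _ _ hr).1.trans_lt (hN m hm n hn)⟩
      have h2 : CauchySeq fun n => (u n).upper r := by
        rw [Metric.cauchySeq_iff] at hu ⊢
        intro ε hε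
        obtain ⟨N, hN⟩ := hu ε hε
        exact ⟨N, fun m hm n hn => (le_dist _ _ hr).2.trans_lt (hN m hm n hn)⟩
      obtain ⟨a, ha⟩ := cauchySeq_tendsto_of_complete h1
      obtain ⟨b, hb⟩ := cauchySeq_tendsto_of_complete h2
      exact ⟨(a, b), fun _ => ⟨ha, hb⟩⟩
    · exact ⟨0, fun h => absurd h hr⟩
  choose p hp using hlim
  have key : ∀ ε > 0, ∃ N, ∀ n ≥ N, ∀ r ∈ Icc (0 : ℝ) 1,
      |(u n).lower r - (p r).1| ≤ ε ∧ |(u n).upper r - (p r).2| ≤ ε := by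
    intro ε hε
    obtain ⟨N, hN⟩ := Metric.cauchySeq_iff.1 hu ε hε
    refine ⟨N, fun n hn r hr => ⟨?_, ?_⟩⟩
    · refine le_of_tendsto ((tendsto_const_nhds.sub (hp r hr).1).abs) ?_
      filter_upwards [eventually_ge_atTop N] with m hm
      exact (le_dist _ _ hr).1.trans (hN n hn m hm).le
    · refine le_of_tendsto ((tendsto_const_nhds.sub (hp r hr).2).abs) ?_
      filter_upwards [eventually_ge_atTop N] with m hm
      exact (le_dist _ _ hr).2.trans (hN n hn m hm).le
  have hfam : IsLevelFamily (fun r => (p r).1) fun r => (p r).2 :=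
    isLevelFamily_of_tendsto (u := u) fun ε hε => by
      obtain ⟨N, hN⟩ := key ε hε
      exact ⟨N, hN N le_rfl⟩
  refine ⟨ofLevels hfam, Metric.tendsto_atTop.2 fun ε hε => ?_⟩
  obtain ⟨N, hN⟩ := key (ε / 2) (by linarith)
  refine ⟨N, fun n hn => ?_⟩
  refine (dist_le _ _ (ε / 2) fun r hr => ?_).trans_lt (by linarith)
  rw [(lower_upper_ofLevels hfam hr).1, (lower_upper_ofLevels hfam hr).2]
  exact hN n hn r hr

instance : MetricCone FuzzyNumber where
  zero_smul := zero_smul'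
  add_smul c e u hc he := ext_levels fun r hr => by
    rw [lower_add _ _ hr, upper_add _ _ hr, (lower_smul_of_nonneg (add_nonneg hc he) u hr).1,
      (lower_smul_of_nonneg (add_nonneg hc he) u hr).2, (lower_smul_of_nonneg hc u hr).1,
      (lower_smul_of_nonneg hc u hr).2, (lower_smul_of_nonneg he u hr).1,
      (lower_smul_of_nonneg he u hr).2]
    constructor <;> ring
  dist_add_right u v w := by
    simp only [dist_def]
    congr 1
    funext r
    rw [lower_add _ _ r.2, upper_add _ _ r.2, lower_add _ _ r.2, upper_add _ _ r.2,
      add_sub_add_right_eq_sub, add_sub_add_right_eq_sub]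
  dist_smul c u v := by
    refine le_antisymm (dist_smul_smul_le c u v) ?_
    rcases eq_or_ne c 0 with rfl | hc
    · simp
    -- The reverse inequality is the same estimate for the inverse scalar.
    have h := dist_smul_smul_le c⁻¹ (c • u) (c • v)
    simp only [smul_smul, inv_mul_cancel₀ hc, one_smul, abs_inv] at h
    rwa [le_inv_mul_iff₀ (abs_pos.2 hc)] at h
  complete := inferInstance

end FuzzyNumber

/-! ## Cones given by their laws -/

/-- The algebraic laws of a cone. -/
structure ConeAlgLaws (X : Type) [Add X] [Zero X] [SMul ℝ X] : Prop where
  add_comm : ∀ x y : X, x + y = y + x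
  add_assoc : ∀ x y z : X, x + y + z = x + (y + z)
  zero_add : ∀ x : X, 0 + x = x
  one_smul : ∀ x : X, (1 : ℝ) • x = x
  mul_smul : ∀ (c e : ℝ) (x : X), (c * e) • x = c • e • x
  smul_add : ∀ (c : ℝ) (x y : X), c • (x + y) = c • x + c • y
  zero_smul : ∀ x : X, (0 : ℝ) • x = 0
  add_smul : ∀ (c e : ℝ) (x : X), 0 ≤ c → 0 ≤ e → (c + e) • x = c • x + e • x

/-- The laws of a complete metric cone, for given operations and a given distance. -/
structure ConeLaws (X : Type) [Add X] [Zero X] [SMul ℝ X] [Dist X] : Prop extends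
    ConeAlgLaws X where
  dist_self : ∀ x : X, dist x x = 0
  dist_comm : ∀ x y : X, dist x y = dist y x
  dist_triangle : ∀ x y z : X, dist x z ≤ dist x y + dist y z
  eq_of_dist_eq_zero : ∀ x y : X, dist x y = 0 → x = y
  dist_add_right : ∀ x y z : X, dist (x + z) (y + z) = dist x y
  dist_smul : ∀ (c : ℝ) (x y : X), dist (c • x) (c • y) = |c| * dist x y
  complete : ∀ x : ℕ → X, (∀ ε > 0, ∃ N, ∀ m ≥ N, ∀ n ≥ N, dist (x m) (x n) < ε) →
    ∃ y, ∀ ε > 0, ∃ N, ∀ n ≥ N, dist (x n) y ≤ ε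

namespace ConeAlgLaws

variable {X : Type} [Add X] [Zero X] [SMul ℝ X]

theorem smul_zero (h : ConeAlgLaws X) (c : ℝ) : c • (0 : X) = 0 := by
  rw [← h.zero_smul 0, ← h.mul_smul, mul_zero]

/-- The monoid of a cone. -/
abbrev toAddCommMonoid (h : ConeAlgLaws X) : AddCommMonoid X where
  add_assoc := h.add_assoc
  add_comm := h.add_comm
  zero_add := h.zero_add
  add_zero x := by rw [h.add_comm, h.zero_add]
  nsmul := nsmulRec

/-- The action of the scalars on a cone. -/
abbrev toDistribMulAction (h : ConeAlgLaws X) :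
    @DistribMulAction ℝ X _ h.toAddCommMonoid.toAddMonoid :=
  letI := h.toAddCommMonoid
  { one_smul := h.one_smul
    mul_smul := h.mul_smul
    smul_zero := h.smul_zero
    smul_add := h.smul_add }

/-- The laws are equations, so they are inherited through an injective map that preserves the
operations coordinatewise. -/
theorem of_pi {S : Type} {Z : S → Type} [∀ s, Add (Z s)] [∀ s, Zero (Z s)]
    [∀ s, SMul ℝ (Z s)] (hZ : ∀ s, ConeAlgLaws (Z s)) (Ψ : X → ∀ s, Z s)
    (hinj : Function.Injective Ψ) (hadd : ∀ x y s, Ψ (x + y) s = Ψ x s + Ψ y s)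
    (hzero : ∀ s, Ψ 0 s = 0) (hsmul : ∀ (c : ℝ) x s, Ψ (c • x) s = c • Ψ x s) :
    ConeAlgLaws X where
  add_comm x y := hinj <| funext fun s => by simp only [hadd, (hZ s).add_comm (Ψ x s)]
  add_assoc x y z := hinj <| funext fun s => by simp only [hadd, (hZ s).add_assoc]
  zero_add x := hinj <| funext fun s => by simp only [hadd, hzero, (hZ s).zero_add]
  one_smul x := hinj <| funext fun s => by simp only [hsmul, (hZ s).one_smul]
  mul_smul c e x := hinj <| funext fun s => by simp only [hsmul, (hZ s).mul_smul]
  smul_add c x y := hinj <| funext fun s => by simp only [hsmul, hadd, (hZ s).smul_add]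
  zero_smul x := hinj <| funext fun s => by simp only [hsmul, hzero, (hZ s).zero_smul]
  add_smul c e x hc he := hinj <| funext fun s => by
    simp only [hsmul, hadd, (hZ s).add_smul c e _ hc he]

end ConeAlgLaws

namespace ConeLaws

variable {X : Type} [Add X] [Zero X] [SMul ℝ X] [Dist X]

theorem dist_nonneg (h : ConeLaws X) (x y : X) : 0 ≤ dist x y := by
  have := h.dist_triangle x y x
  rw [h.dist_self, h.dist_comm y x] at this
  linarith

/-- The metric of a cone. -/
abbrev toMetricSpace (h : ConeLaws X) : MetricSpace X where
  dist_self := h.dist_self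
  dist_comm := h.dist_comm
  dist_triangle := h.dist_triangle
  eq_of_dist_eq_zero {x y} := h.eq_of_dist_eq_zero x y

theorem toMetricCone (h : ConeLaws X) :
    @MetricCone X h.toAddCommMonoid h.toDistribMulAction h.toMetricSpace :=
  letI := h.toAddCommMonoid
  letI := h.toDistribMulAction
  letI := h.toMetricSpace
  { zero_smul := h.zero_smul
    add_smul := h.add_smul
    dist_add_right := h.dist_add_right
    dist_smul := h.dist_smul
    complete := Metric.complete_of_cauchySeq_tendsto fun x hx => by
      obtain ⟨y, hy⟩ := h.complete x (Metric.cauchySeq_iff.1 hx)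
      refine ⟨y, Metric.tendsto_atTop.2 fun ε hε => ?_⟩
      obtain ⟨N, hN⟩ := hy (ε / 2) (half_pos hε)
      exact ⟨N, fun n hn => (hN n hn).trans_lt (half_lt_self hε)⟩ }

theorem fuzzyNumber : ConeLaws FuzzyNumber where
  add_comm := add_comm
  add_assoc := add_assoc
  zero_add := zero_add
  one_smul := one_smul ℝ
  mul_smul := mul_smul
  smul_add := smul_add
  zero_smul := MetricCone.zero_smul
  add_smul := MetricCone.add_smul
  dist_self := _root_.dist_self
  dist_comm := _root_.dist_comm
  dist_triangle := _root_.dist_triangle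
  eq_of_dist_eq_zero _ _ := _root_.eq_of_dist_eq_zero
  dist_add_right := MetricCone.dist_add_right
  dist_smul := MetricCone.dist_smul
  complete x hx := by
    obtain ⟨y, hy⟩ := cauchySeq_tendsto_of_complete (Metric.cauchySeq_iff.2 hx)
    refine ⟨y, fun ε hε => ?_⟩
    obtain ⟨N, hN⟩ := Metric.tendsto_atTop.1 hy ε hε
    exact ⟨N, fun n hn => (hN n hn).le⟩

/-- A space that is closed in a product with the supremum metric is a cone. -/
theorem of_iSup {S : Type} {Z : S → Type} [∀ s, Add (Z s)] [∀ s, Zero (Z s)]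
    [∀ s, SMul ℝ (Z s)] [∀ s, Dist (Z s)] (hZ : ∀ s, ConeLaws (Z s)) (Ψ : X → ∀ s, Z s)
    (hinj : Function.Injective Ψ) (hadd : ∀ x y s, Ψ (x + y) s = Ψ x s + Ψ y s)
    (hzero : ∀ s, Ψ 0 s = 0) (hsmul : ∀ (c : ℝ) x s, Ψ (c • x) s = c • Ψ x s)
    (hdist : ∀ x y, dist x y = ⨆ s, dist (Ψ x s) (Ψ y s))
    (hbdd : ∀ x y, BddAbove (range fun s => dist (Ψ x s) (Ψ y s)))
    (hclosed : ∀ (x : ℕ → X) (f : ∀ s, Z s),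
      (∀ ε > 0, ∃ N, ∀ n ≥ N, ∀ s, dist (Ψ (x n) s) (f s) ≤ ε) → ∃ y, Ψ y = f) :
    ConeLaws X := by
  have le : ∀ x y s, dist (Ψ x s) (Ψ y s) ≤ dist x y := fun x y s => by
    rw [hdist]; exact le_ciSup (hbdd x y) s
  have nonneg : ∀ x y : X, 0 ≤ dist x y := fun x y => by
    rw [hdist]; exact Real.iSup_nonneg fun s => (hZ s).dist_nonneg _ _
  -- The condition `0 ≤ M` admits an empty index set, which occurs for the empty Cartesian product.
  have dle : ∀ (x y : X) (M : ℝ), 0 ≤ M → (∀ s, dist (Ψ x s) (Ψ y s) ≤ M) → dist x y ≤ M :=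
    fun x y M hM h => by rw [hdist]; exact Real.iSup_le h hM
  refine ⟨ConeAlgLaws.of_pi (fun s => (hZ s).toConeAlgLaws) Ψ hinj hadd hzero hsmul,
    fun x => ?_, fun x y => ?_, fun x y z => ?_, fun x y h => ?_, fun x y z => ?_,
    fun c x y => ?_, fun x hx => ?_⟩
  · exact le_antisymm (dle x x 0 le_rfl fun s => ((hZ s).dist_self _).le) (nonneg x x)
  · simp only [hdist, (hZ _).dist_comm (Ψ x _)]
  · exact dle _ _ _ (add_nonneg (nonneg _ _) (nonneg _ _)) fun s =>
      ((hZ s).dist_triangle _ (Ψ y s) _).trans (add_le_add (le _ _ _) (le _ _ _))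
  · exact hinj <| funext fun s => (hZ s).eq_of_dist_eq_zero _ _
      (le_antisymm ((le x y s).trans h.le) ((hZ s).dist_nonneg _ _))
  · simp only [hdist, hadd, (hZ _).dist_add_right]
  · simp only [hdist, hsmul, (hZ _).dist_smul]
    exact (Real.mul_iSup_of_nonneg (abs_nonneg c) _).symm
  · have hlim : ∀ s, ∃ y, ∀ ε > 0, ∃ N, ∀ n ≥ N, dist (Ψ (x n) s) y ≤ ε := fun s => by
      refine (hZ s).complete (fun n => Ψ (x n) s) fun ε hε => ?_
      obtain ⟨N, hN⟩ := hx ε hε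
      exact ⟨N, fun m hm n hn => (le _ _ s).trans_lt (hN m hm n hn)⟩
    choose f hf using hlim
    have hunif : ∀ ε > 0, ∃ N, ∀ n ≥ N, ∀ s, dist (Ψ (x n) s) (f s) ≤ ε := by
      intro ε hε
      obtain ⟨N, hN⟩ := hx ε hε
      refine ⟨N, fun n hn s => le_of_forall_pos_le_add fun η hη => ?_⟩
      obtain ⟨N', hN'⟩ := hf s η hη
      exact ((hZ s).dist_triangle _ (Ψ (x (max N N')) s) _).trans (add_le_add
        ((le _ _ s).trans (hN n hn _ (le_max_left _ _)).le) (hN' _ (le_max_right _ _)))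
    obtain ⟨y, rfl⟩ := hclosed x f hunif
    refine ⟨y, fun ε hε => ?_⟩
    obtain ⟨N, hN⟩ := hunif ε hε
    exact ⟨N, fun n hn => dle _ _ _ hε.le (hN n hn)⟩

/-! ### Spaces with a supremum metric. -/

theorem tendstoUniformly_of_forall {S : Type} {f : ℕ → S → FuzzyNumber} {g : S → FuzzyNumber}
    (h : ∀ ε > 0, ∃ N, ∀ n ≥ N, ∀ s, dist (f n s) (g s) ≤ ε) : TendstoUniformly f g atTop := by
  rw [Metric.tendstoUniformly_iff]
  intro ε hε
  obtain ⟨N, hN⟩ := h (ε / 2) (half_pos hε)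
  filter_upwards [eventually_ge_atTop N] with n hn s
  rw [_root_.dist_comm]
  exact (hN n hn s).trans_lt (half_lt_self hε)

theorem _root_.FuzzyC.continuous {a b : ℝ} (f : FuzzyC a b) : Continuous f.toFun :=
  continuous_iff_continuousAt.2 fun x => tendsto_iff_dist_tendsto_zero.2 (f.cont x)

theorem fuzzyC (a b : ℝ) : ConeLaws (FuzzyC a b) := by
  refine of_iSup (fun _ => fuzzyNumber) FuzzyC.toFun (fun f g h => ?_) (fun _ _ _ => rfl)
    (fun _ => rfl) (fun _ _ _ => rfl) (fun _ _ => rfl) (fun f g => ?_) fun x f h => ?_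
  · cases f; cases g; congr
  · exact (isCompact_range (f.continuous.dist g.continuous)).bddAbove
  · have hc : Continuous f := (tendstoUniformly_of_forall h).continuous
      (Frequently.of_forall fun n => (x n).continuous)
    exact ⟨⟨f, fun s => tendsto_iff_dist_tendsto_zero.1 (hc.tendsto s)⟩, rfl⟩

theorem bddAbove_of_bounded {x y : ℕ → FuzzyNumber} {M M' : ℝ} (hx : ∀ n, dist 0 (x n) ≤ M)
    (hy : ∀ n, dist 0 (y n) ≤ M') : BddAbove (range fun n => dist (x n) (y n)) := by
  refine ⟨M + M', ?_⟩
  rintro _ ⟨n, rfl⟩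
  exact (dist_triangle_left _ _ 0).trans (add_le_add (hx n) (hy n))

theorem exists_bound_of_tendsto {x : ℕ → FuzzyNumber} {l : FuzzyNumber}
    (h : Tendsto x atTop (𝓝 l)) : ∃ M, ∀ n, dist 0 (x n) ≤ M := by
  obtain ⟨M, hM⟩ := (tendsto_const_nhds.dist h : Tendsto (fun n => dist 0 (x n)) atTop
    (𝓝 (dist 0 l))).bddAbove_range
  exact ⟨M, fun n => hM ⟨n, rfl⟩⟩

theorem fuzzyBdd : ConeLaws FuzzyBdd := by
  refine of_iSup (fun _ => fuzzyNumber) Subtype.val Subtype.val_injective (fun _ _ _ => rfl)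
    (fun _ => rfl) (fun _ _ _ => rfl) (fun _ _ => rfl) (fun x y => ?_) fun x f h => ?_
  · obtain ⟨M, -, h⟩ := x.2
    obtain ⟨M', -, h'⟩ := y.2
    exact bddAbove_of_bounded h h'
  · obtain ⟨N, hN⟩ := h 1 one_pos
    obtain ⟨M, hM0, hM⟩ := (x N).2
    exact ⟨⟨f, M + 1, by linarith, fun n => (_root_.dist_triangle _ ((x N).1 n) _).trans
      (add_le_add (hM n) (hN N le_rfl n))⟩, rfl⟩

theorem fuzzyConv : ConeLaws FuzzyConv := by
  refine of_iSup (fun _ => fuzzyNumber) Subtype.val Subtype.val_injective (fun _ _ _ => rfl)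
    (fun _ => rfl) (fun _ _ _ => rfl) (fun _ _ => rfl) (fun x y => ?_) fun x f h => ?_
  · obtain ⟨l, h⟩ := x.2
    obtain ⟨l', h'⟩ := y.2
    obtain ⟨M, hM⟩ := exists_bound_of_tendsto (tendsto_iff_dist_tendsto_zero.2 h)
    obtain ⟨M', hM'⟩ := exists_bound_of_tendsto (tendsto_iff_dist_tendsto_zero.2 h')
    exact bddAbove_of_bounded hM hM'
  · have hc : CauchySeq f := by
      refine Metric.cauchySeq_iff'.2 fun ε hε => ?_
      obtain ⟨N, hN⟩ := h (ε / 3) (by linarith)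
      obtain ⟨l, hl⟩ := (x N).2
      obtain ⟨K, hK⟩ := Metric.cauchySeq_iff'.1 (tendsto_iff_dist_tendsto_zero.2 hl).cauchySeq
        (ε / 3) (by linarith)
      refine ⟨K, fun k hk => ?_⟩
      have h1 := _root_.dist_triangle (f k) ((x N).1 k) (f K)
      have h2 := _root_.dist_triangle ((x N).1 k) ((x N).1 K) (f K)
      rw [_root_.dist_comm (f k) ((x N).1 k)] at h1
      linarith [hN N le_rfl k, hN N le_rfl K, hK k hk]
    obtain ⟨l, hl⟩ := cauchySeq_tendsto_of_complete hc
    exact ⟨⟨f, l, tendsto_iff_dist_tendsto_zero.1 hl⟩, rfl⟩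

theorem fuzzyNull : ConeLaws FuzzyNull := by
  refine of_iSup (fun _ => fuzzyNumber) Subtype.val Subtype.val_injective (fun _ _ _ => rfl)
    (fun _ => rfl) (fun _ _ _ => rfl) (fun _ _ => rfl) (fun x y => ?_) fun x f h => ?_
  · obtain ⟨M, hM⟩ := exists_bound_of_tendsto (tendsto_iff_dist_tendsto_zero.2 x.2)
    obtain ⟨M', hM'⟩ := exists_bound_of_tendsto (tendsto_iff_dist_tendsto_zero.2 y.2)
    exact bddAbove_of_bounded hM hM'
  · have hf : Tendsto f atTop (𝓝 0) := by
      rw [Metric.tendsto_atTop]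
      intro ε hε
      obtain ⟨N, hN⟩ := h (ε / 2) (half_pos hε)
      obtain ⟨K, hK⟩ := Metric.tendsto_atTop.1
        (tendsto_iff_dist_tendsto_zero.2 (x N).2) (ε / 2) (half_pos hε)
      refine ⟨K, fun k hk => ?_⟩
      have := dist_triangle_left (f k) 0 ((x N).1 k)
      linarith [hN N le_rfl k, hK k hk]
    exact ⟨⟨f, tendsto_iff_dist_tendsto_zero.1 hf⟩, rfl⟩

theorem prod {n : ℕ} (Y : Fin n → FuzzySpace) (hY : ∀ i, ConeLaws (Y i)) :
    ConeLaws (FuzzySpace.prod Y) :=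
  of_iSup (X := FuzzySpace.prod Y) hY (fun x => x) (fun _ _ h => h) (fun _ _ _ => rfl)
    (fun _ => rfl) (fun _ _ _ => rfl) (fun _ _ => rfl)
    (fun _ _ => (Set.finite_range _).bddAbove) fun _ f _ => ⟨f, rfl⟩

end ConeLaws

/-! ## Continuously differentiable functions -/

section Differentiable

open MetricCone

variable {X : Type} [AddCommMonoid X] [DistribMulAction ℝ X] [MetricSpace X] [MetricCone X]
variable {a b : ℝ} {f g : ℝ → X}

/-- The integral form of `f' = g` on `[a,b]`. -/
def IsConePrimitive (a b : ℝ) (f g : ℝ → X) : Prop :=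
  ∀ s t : ℝ, a ≤ s → s ≤ t → t ≤ b → emb (f t) - emb (f s) = ∫ r in s..t, emb (g r)

/-- In the envelope a Hukuhara difference is a true difference, and `emb` commutes with the positive
factor `1 / h`. -/
theorem HDiffTendsto.hasDerivWithinAt {x : ℝ} {L : X}
    (h : HDiffTendsto (fun h => f (x + h)) (fun _ => f x) (fun h => 1 / h) L) :
    HasDerivWithinAt (fun t => emb (f t)) (emb L) (Ioi x) x := by
  obtain ⟨w, h1, h2⟩ := h
  rw [hasDerivWithinAt_iff_tendsto_slope' (by simp)]
  have hshift : Tendsto (fun y : ℝ => y - x) (𝓝[>] x) (𝓝[>] 0) := by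
    refine tendsto_nhdsWithin_iff.2 ⟨?_, ?_⟩
    · have : Continuous fun y : ℝ => y - x := by fun_prop
      simpa using (this.tendsto x).mono_left (nhdsWithin_le_nhds (s := Ioi x))
    · filter_upwards [self_mem_nhdsWithin] with y hy
      exact sub_pos.2 (mem_Ioi.1 hy)
  have h3 : Tendsto (fun h => emb ((1 / h) • w h)) (𝓝[>] 0) (𝓝 (emb L)) :=
    (continuous_emb.tendsto L).comp (tendsto_iff_dist_tendsto_zero.2 h2)
  refine (h3.comp hshift).congr' ?_
  filter_upwards [hshift.eventually h1, self_mem_nhdsWithin] with y hy hxy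
  have hpos : 0 < y - x := sub_pos.2 hxy
  rw [add_sub_cancel] at hy
  rw [slope_def_module, hy, emb_add, add_sub_cancel_left, Function.comp_apply,
    emb_smul (by positivity), one_div]

/-- The fundamental theorem of calculus needs only the right derivative of a continuous function, so
the left condition plays no role here. -/
theorem isConePrimitive_of_right (hf : Continuous f) (hg : Continuous g)
    (h : ∀ x ∈ Ico a b, HDiffTendsto (fun h => f (x + h)) (fun _ => f x) (fun h => 1 / h) (g x)) :
    IsConePrimitive a b f g := by
  intro s t hs hst ht
  refine (intervalIntegral.integral_eq_sub_of_hasDeriv_right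
    (continuous_emb.comp hf).continuousOn (fun x hx => ?_)
    ((continuous_emb.comp hg).intervalIntegrable s t)).symm
  rw [min_eq_left hst, max_eq_right hst] at hx
  exact (h x ⟨hs.trans hx.1.le, hx.2.trans_le ht⟩).hasDerivWithinAt

theorem IsConePrimitive.of_tendsto {fs gs : ℕ → ℝ → X} (hg : Continuous g)
    (hgs : ∀ n, Continuous (gs n))
    (hflim : ∀ ε > 0, ∃ N, ∀ n ≥ N, ∀ s, dist (fs n s) (f s) ≤ ε)
    (hglim : ∀ ε > 0, ∃ N, ∀ n ≥ N, ∀ s, dist (gs n s) (g s) ≤ ε)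
    (h : ∀ n, IsConePrimitive a b (fs n) (gs n)) : IsConePrimitive a b f g := by
  intro s t hs hst ht
  rw [← sub_eq_zero, ← norm_le_zero_iff]
  refine le_of_forall_pos_le_add fun ε hε => ?_
  -- Each of the two endpoint values costs `η`, and the integral costs `η (t - s)`.
  set η := ε / (t - s + 2)
  have hη : 0 < η := div_pos hε (by linarith)
  obtain ⟨N, hN⟩ := hflim η hη
  obtain ⟨N', hN'⟩ := hglim η hη
  set n := max N N'
  have e := h n s t hs hst ht
  have h1 : ‖(∫ r in s..t, emb (gs n r)) - ∫ r in s..t, emb (g r)‖ ≤ η * |t - s| := by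
    have i1 : IntervalIntegrable (fun r => emb (gs n r)) volume s t :=
      (continuous_emb.comp (hgs n)).intervalIntegrable s t
    have i2 : IntervalIntegrable (fun r => emb (g r)) volume s t :=
      (continuous_emb.comp hg).intervalIntegrable s t
    rw [← intervalIntegral.integral_sub i1 i2]
    refine intervalIntegral.norm_integral_le_of_norm_le_const fun r _ => ?_
    rw [norm_emb_sub]
    exact hN' n (le_max_right _ _) r
  rw [abs_of_nonneg (by linarith)] at h1
  have h2 : ∀ r, ‖emb (f r) - emb (fs n r)‖ ≤ η := fun r => by
    rw [norm_emb_sub, dist_comm]; exact hN n (le_max_left _ _) r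
  have e2 : emb (f t) - emb (f s) - ∫ r in s..t, emb (g r) =
      (emb (f t) - emb (fs n t)) - (emb (f s) - emb (fs n s)) +
        ((∫ r in s..t, emb (gs n r)) - ∫ r in s..t, emb (g r)) := by
    rw [← e]; abel
  rw [e2, zero_add]
  calc _ ≤ ‖emb (f t) - emb (fs n t)‖ + ‖emb (f s) - emb (fs n s)‖ + η * (t - s) :=
        (norm_add_le _ _).trans (add_le_add (norm_sub_le _ _) h1)
    _ ≤ η + η + η * (t - s) := by gcongr <;> exact h2 _
    _ = η * (t - s + 2) := by ring
    _ = ε := div_mul_cancel₀ _ (by linarith)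

/-- The increment `W s h` is the cone element that represents the integral of `g` over `[s, s + h]`.
A moving base point `θ h` with `x` in the interval covers both one-sided limits, and `C` records a
closed subcone that contains the values of `g`. -/
theorem IsConePrimitive.exists_increment (hg : Continuous g) (hprim : IsConePrimitive a b f g)
    {C : Set X} (hC : IsClosed C) (h0 : (0 : X) ∈ C) (hadd : ∀ x ∈ C, ∀ y ∈ C, x + y ∈ C)
    (hsmul : ∀ c : ℝ, 0 ≤ c → ∀ x ∈ C, c • x ∈ C) (hgC : ∀ s ∈ Icc a b, g s ∈ C) :
    ∃ W : ℝ → ℝ → X,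
      (∀ s h, a ≤ s → 0 < h → s + h ≤ b → f (s + h) = f s + W s h ∧ W s h ∈ C) ∧
      ∀ (x : ℝ) (θ : ℝ → ℝ),
        (∀ᶠ h in 𝓝[>] 0, a ≤ θ h ∧ θ h + h ≤ b ∧ x ∈ Icc (θ h) (θ h + h)) →
        Tendsto (fun h => dist ((1 / h) • W (θ h) h) (g x)) (𝓝[>] 0) (𝓝 0) := by
  have hW : ∀ s h : ℝ, ∃ w, a ≤ s → 0 < h → s + h ≤ b →
      w ∈ C ∧ emb w = ∫ r in s..(s + h), emb (g r) := by
    intro s h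
    by_cases hs : a ≤ s ∧ 0 < h ∧ s + h ≤ b
    · obtain ⟨w, hw⟩ := exists_emb_eq_integral hC h0 hadd hsmul hg (α := s) (β := s + h)
        (fun r hr => hgC r ⟨hs.1.trans hr.1.le, hr.2.trans hs.2.2⟩) (by linarith)
      exact ⟨w, fun _ _ _ => hw⟩
    · exact ⟨0, fun h1 h2 h3 => absurd ⟨h1, h2, h3⟩ hs⟩
  choose W hW using hW
  refine ⟨W, fun s h hs hh hb => ⟨?_, (hW s h hs hh hb).1⟩, fun x θ hθ => ?_⟩
  · apply emb_injective
    rw [emb_add, (hW s h hs hh hb).2, ← hprim s (s + h) hs (by linarith) hb]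
    abel
  · rw [Metric.tendsto_nhds]
    intro ε hε
    obtain ⟨δ, hδ, hgδ⟩ := Metric.continuous_iff.1 hg x (ε / 2) (half_pos hε)
    filter_upwards [hθ, self_mem_nhdsWithin, nhdsWithin_le_nhds (eventually_lt_nhds hδ)]
      with h hh hpos hhδ
    replace hpos : 0 < h := hpos
    obtain ⟨ha, hb, hx1, hx2⟩ := hh
    rw [Real.dist_0_eq_abs, abs_of_nonneg dist_nonneg]
    refine lt_of_le_of_lt ?_ (half_lt_self hε)
    have e : g x = (1 / h) • h • g x := by
      rw [smul_smul, one_div_mul_cancel hpos.ne', one_smul]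
    rw [e, MetricCone.dist_smul, abs_of_pos (by positivity), one_div, inv_mul_le_iff₀ hpos,
      ← norm_emb_sub, (hW (θ h) h ha hpos hb).2, emb_smul hpos.le]
    have e2 : h • emb (g x) = ∫ _ in θ h..(θ h + h), emb (g x) := by simp
    have i1 : IntervalIntegrable (fun r => emb (g r)) volume (θ h) (θ h + h) :=
      (continuous_emb.comp hg).intervalIntegrable _ _
    rw [e2, ← intervalIntegral.integral_sub i1 intervalIntegrable_const]
    have := intervalIntegral.norm_integral_le_of_norm_le_const (a := θ h) (b := θ h + h)
      (f := fun s => emb (g s) - emb (g x)) (C := ε / 2) fun s hs => by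
        rw [uIoc_of_le (by linarith)] at hs
        rw [norm_emb_sub]
        refine (hgδ s ?_).le
        rw [Real.dist_eq, abs_lt]
        constructor <;> linarith [hs.1, hs.2]
    rwa [add_sub_cancel_left, abs_of_pos hpos, mul_comm] at this

theorem IsConePrimitive.hasKindDeriv_one (hg : Continuous g) (h : IsConePrimitive a b f g)
    {x : ℝ} (hx : x ∈ Icc a b) : HasKindDeriv .one (Icc a b) f (g x) x := by
  obtain ⟨W, hW, hlim⟩ := h.exists_increment hg isClosed_univ (mem_univ _)
    (fun _ _ _ _ => mem_univ _) (fun _ _ _ _ => mem_univ _) (fun _ _ => mem_univ _)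
  refine ⟨fun ⟨s, hs, hxs⟩ => ?_, fun ⟨s, hs, hxs⟩ => ?_⟩
  · have hev : ∀ᶠ h in 𝓝[>] (0 : ℝ), h < b - x :=
      nhdsWithin_le_nhds (eventually_lt_nhds (by linarith [hs.2]))
    refine ⟨fun h => W x h, ?_, hlim x (fun _ => x) ?_⟩
    · filter_upwards [hev, self_mem_nhdsWithin] with h hh hpos
      exact (hW x h hx.1 hpos (by linarith)).1
    · filter_upwards [hev, self_mem_nhdsWithin] with h hh hpos
      have hpos' : 0 < h := hpos
      exact ⟨hx.1, by linarith, le_rfl, by linarith⟩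
  · have hev : ∀ᶠ h in 𝓝[>] (0 : ℝ), h < x - a :=
      nhdsWithin_le_nhds (eventually_lt_nhds (by linarith [hs.1]))
    refine ⟨fun h => W (x - h) h, ?_, hlim x (fun h => x - h) ?_⟩
    · filter_upwards [hev, self_mem_nhdsWithin] with h hh hpos
      have := (hW (x - h) h (by linarith) hpos (by linarith [hx.2])).1
      rwa [sub_add_cancel] at this
    · filter_upwards [hev, self_mem_nhdsWithin] with h hh hpos
      have hpos' : 0 < h := hpos
      exact ⟨by linarith, by linarith [hx.2], by linarith, by linarith⟩

theorem HDiffTendsto.neg' {p q : ℝ → X} {L : X}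
    (h : HDiffTendsto p q (fun s => -(1 / s)) L) :
    HDiffTendsto p q (fun s => 1 / s) ((-1 : ℝ) • L) := by
  simpa only [neg_neg] using h.neg

/-- The reflection of the interval exchanges the two sides and keeps each Hukuhara difference; only
the sign of the factor changes. -/
theorem HasKindDeriv.reflect_two {L : X} {x : ℝ} (h : HasKindDeriv .two (Icc a b) f L x) :
    HasKindDeriv .one (Icc a b) (fun t => f (a + b - t)) ((-1 : ℝ) • L) (a + b - x) := by
  refine ⟨fun ⟨s, hs, hxs⟩ => ?_, fun ⟨s, hs, hxs⟩ => ?_⟩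
  · have := HDiffTendsto.neg' (h.2 ⟨a + b - s, ⟨by linarith [hs.2], by linarith [hs.1]⟩, by linarith⟩)
    simpa only [DiffKind.Right, sub_sub_cancel, ← sub_sub] using this
  · have := HDiffTendsto.neg' (h.1 ⟨a + b - s, ⟨by linarith [hs.2], by linarith [hs.1]⟩, by linarith⟩)
    simpa only [DiffKind.Left, sub_sub_cancel, ← sub_add] using this

theorem HasKindDeriv.reflect_one {L : X} {x : ℝ} (h : HasKindDeriv .one (Icc a b) f L x) :
    HasKindDeriv .two (Icc a b) (fun t => f (a + b - t)) ((-1 : ℝ) • L) (a + b - x) := by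
  refine ⟨fun ⟨s, hs, hxs⟩ => ?_, fun ⟨s, hs, hxs⟩ => ?_⟩
  · have := HDiffTendsto.neg (h.2 ⟨a + b - s, ⟨by linarith [hs.2], by linarith [hs.1]⟩, by linarith⟩)
    simpa only [DiffKind.Right, sub_sub_cancel, ← sub_sub] using this
  · have := HDiffTendsto.neg (h.1 ⟨a + b - s, ⟨by linarith [hs.2], by linarith [hs.1]⟩, by linarith⟩)
    simpa only [DiffKind.Left, sub_sub_cancel, ← sub_add] using this

end Differentiable

/-! ### Continuous functions with a one-sided local minimum at every point. -/

section LocalExtrema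

/-- Continuous induction: the set of `y` with `Φ a ≤ Φ y` is closed and extends to the right of each
of its points. -/
theorem le_of_forall_local_min {Φ : ℝ → ℝ} {a b : ℝ} (hΦ : ContinuousOn Φ (Icc a b))
    (h : ∀ x ∈ Ico a b, ∀ᶠ h in 𝓝[>] (0 : ℝ), Φ x ≤ Φ (x + h)) {x : ℝ} (hx : x ∈ Icc a b) :
    Φ a ≤ Φ x := by
  have hclosed : IsClosed ({y | Φ a ≤ Φ y} ∩ Icc a b) := by
    rw [inter_comm]
    exact hΦ.preimage_isClosed_of_isClosed isClosed_Icc isClosed_Ici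
  refine hclosed.Icc_subset_of_forall_exists_gt (le_refl (Φ a)) (fun y hy z hz => ?_) hx
  have hz' : y < z := hz
  have hev : ∀ᶠ h in 𝓝[>] (0 : ℝ), h < z - y :=
    nhdsWithin_le_nhds (eventually_lt_nhds (by linarith))
  obtain ⟨k, hk1, hk2, hk3⟩ := ((h y hy.2).and (hev.and self_mem_nhdsWithin)).exists
  have hk3' : 0 < k := hk3
  exact ⟨y + k, le_trans hy.1 hk1, by linarith, by linarith⟩

theorem eq_of_forall_local_min {Φ : ℝ → ℝ} (hΦ : Continuous Φ) {a b : ℝ}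
    (hr : ∀ x ∈ Ico a b, ∀ᶠ h in 𝓝[>] (0 : ℝ), Φ x ≤ Φ (x + h))
    (hl : ∀ x ∈ Ioc a b, ∀ᶠ h in 𝓝[>] (0 : ℝ), Φ x ≤ Φ (x - h)) {x y : ℝ} (hx : x ∈ Icc a b)
    (hy : y ∈ Icc a b) : Φ x = Φ y := by
  wlog hxy : x ≤ y generalizing x y
  · exact (this hy hx (le_of_not_ge hxy)).symm
  apply le_antisymm
  · exact le_of_forall_local_min (b := y) hΦ.continuousOn
      (fun z hz => hr z ⟨hx.1.trans hz.1, hz.2.trans_le hy.2⟩) ⟨hxy, le_rfl⟩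
  · have := le_of_forall_local_min (Φ := fun t => Φ (-t)) (a := -y) (b := -x)
      (by fun_prop) (fun z hz => ?_) (x := -x) ⟨neg_le_neg hxy, le_rfl⟩
    · simpa using this
    · have := hl (-z) ⟨by linarith [hz.2, hx.1], by linarith [hz.1, hy.2]⟩
      filter_upwards [this] with h hh
      rwa [neg_add]

end LocalExtrema

/-! ### Length of the support, and uniform limits of differentiable functions. -/

namespace FuzzyNumber

/-- The length of the support of a fuzzy number. -/
noncomputable def len (u : FuzzyNumber) : ℝ := u.upper 0 - u.lower 0

theorem zero_mem_unit : (0 : ℝ) ∈ Icc (0 : ℝ) 1 := by simp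

theorem len_nonneg (u : FuzzyNumber) : 0 ≤ u.len :=
  sub_nonneg.2 (u.endpoint_mem zero_mem_unit).2.1

theorem len_zero : (0 : FuzzyNumber).len = 0 := by
  rw [len, upper_zero_number zero_mem_unit, lower_zero_number zero_mem_unit, sub_zero]

theorem len_add (u v : FuzzyNumber) : (u + v).len = u.len + v.len := by
  rw [len, len, len, upper_add _ _ zero_mem_unit, lower_add _ _ zero_mem_unit]
  ring

theorem len_smul (c : ℝ) (u : FuzzyNumber) : (c • u).len = |c| * u.len := by
  rw [len, len]
  rcases lower_upper_smul c u zero_mem_unit with ⟨h, h1, h2⟩ | ⟨h, h1, h2⟩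
  · rw [h1, h2, abs_of_nonneg h]; ring
  · rw [h1, h2, abs_of_nonpos h]; ring

theorem continuous_len : Continuous len := by
  refine continuous_iff_continuousAt.2 fun u => ?_
  rw [ContinuousAt, tendsto_iff_dist_tendsto_zero]
  have h1 : Tendsto (fun v => 2 * dist v u) (𝓝 u) (𝓝 0) := by
    have : Continuous fun v : FuzzyNumber => 2 * dist v u := by fun_prop
    simpa using this.tendsto u
  refine squeeze_zero (fun _ => dist_nonneg) (fun v => ?_) h1
  obtain ⟨h1, h2⟩ := le_dist v u zero_mem_unit
  rw [Real.dist_eq, len, len]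
  rw [abs_le] at *
  constructor <;> linarith

/-- If the support has length zero, all endpoints coincide: `u` is a real number and has an additive
inverse. -/
theorem add_neg_of_len_eq_zero {u : FuzzyNumber} (h : u.len = 0) : u + (-1 : ℝ) • u = 0 := by
  refine ext_levels fun r hr => ?_
  obtain ⟨h1, h2, h3⟩ := u.endpoint_mem hr
  rw [len] at h
  rw [lower_add _ _ hr, upper_add _ _ hr, (lower_smul_of_nonpos (by norm_num) u hr).1,
    (lower_smul_of_nonpos (by norm_num) u hr).2, lower_zero_number hr, upper_zero_number hr]
  constructor <;> linarith

theorem len_eq_zero_of_hDiffTendsto {p q : ℝ → FuzzyNumber} {c : ℝ → ℝ} {L : FuzzyNumber}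
    (h : _root_.HDiffTendsto p q c L) (hpq : ∀ᶠ h in 𝓝[>] (0 : ℝ), (p h).len = (q h).len) :
    L.len = 0 := by
  obtain ⟨w, h1, h2⟩ := h
  have h3 := (continuous_len.tendsto L).comp (tendsto_iff_dist_tendsto_zero.2 h2)
  refine tendsto_nhds_unique_of_eventuallyEq h3 tendsto_const_nhds ?_
  filter_upwards [h1, hpq] with h hh hl
  have : (w h).len = 0 := by
    rw [hh, len_add] at hl
    linarith
  rw [Function.comp_apply, len_smul, this, mul_zero]

/-- Length is additive and nonnegative, so the mere existence of the difference forces the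
subtracted number to be the shorter one. -/
theorem len_le_of_hDiffTendsto {p q : ℝ → FuzzyNumber} {c : ℝ → ℝ} {L : FuzzyNumber}
    (h : _root_.HDiffTendsto p q c L) : ∀ᶠ h in 𝓝[>] (0 : ℝ), (q h).len ≤ (p h).len := by
  obtain ⟨w, h1, -⟩ := h
  filter_upwards [h1] with h hh
  rw [hh, len_add]
  linarith [(w h).len_nonneg]

variable {a b : ℝ} {f g : ℝ → FuzzyNumber}

theorem mem_Icc_add {x : ℝ} (hx : x ∈ Ico a b) : ∀ᶠ h in 𝓝[>] (0 : ℝ), x + h ∈ Icc a b := by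
  have hev : ∀ᶠ h in 𝓝[>] (0 : ℝ), h < b - x :=
    nhdsWithin_le_nhds (eventually_lt_nhds (by linarith [hx.2]))
  filter_upwards [hev, self_mem_nhdsWithin] with h hh hpos
  have hpos' : 0 < h := hpos
  exact ⟨by linarith [hx.1], by linarith⟩

theorem mem_Icc_sub {x : ℝ} (hx : x ∈ Ioc a b) : ∀ᶠ h in 𝓝[>] (0 : ℝ), x - h ∈ Icc a b := by
  have hev : ∀ᶠ h in 𝓝[>] (0 : ℝ), h < x - a :=
    nhdsWithin_le_nhds (eventually_lt_nhds (by linarith [hx.1]))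
  filter_upwards [hev, self_mem_nhdsWithin] with h hh hpos
  have hpos' : 0 < h := hpos
  exact ⟨by linarith, by linarith [hx.2]⟩

/-- In the third and the fourth case the length of the support is constant. -/
theorem len_eq_of_hasKindDeriv (hab : a < b) (hf : Continuous f) {k : DiffKind}
    (hk : k = .three ∨ k = .four) (h : ∀ x ∈ Icc a b, HasKindDeriv k (Icc a b) f (g x) x)
    {x y : ℝ} (hx : x ∈ Icc a b) (hy : y ∈ Icc a b) : (f x).len = (f y).len := by
  have hR : ∀ x ∈ Ico a b, k.Right f (g x) x := fun x hx =>
    (h x ⟨hx.1, hx.2.le⟩).1 ⟨b, ⟨hab.le, le_rfl⟩, hx.2⟩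
  have hL : ∀ x ∈ Ioc a b, k.Left f (g x) x := fun x hx =>
    (h x ⟨hx.1.le, hx.2⟩).2 ⟨a, ⟨le_rfl, hab.le⟩, hx.1⟩
  rcases hk with rfl | rfl
  -- In case 3 both differences subtract `f t`, so the length has a local minimum at every point; in
  -- case 4 it has a local maximum.
  · exact eq_of_forall_local_min (Φ := fun t => (f t).len) (continuous_len.comp hf)
      (fun z hz => len_le_of_hDiffTendsto (hR z hz))
      (fun z hz => len_le_of_hDiffTendsto (hL z hz)) hx hy
  · exact neg_injective (eq_of_forall_local_min (Φ := fun t => -(f t).len)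
      (continuous_len.comp hf).neg
      (fun z hz => (len_le_of_hDiffTendsto (hR z hz)).mono fun _ => neg_le_neg)
      (fun z hz => (len_le_of_hDiffTendsto (hL z hz)).mono fun _ => neg_le_neg) hx hy)

/-- In the third and the fourth case the derivative consists of real numbers. -/
theorem len_deriv_eq_zero (hab : a < b) (hf : Continuous f) {k : DiffKind}
    (hk : k = .three ∨ k = .four)
    (h : ∀ x ∈ Icc a b, HasKindDeriv k (Icc a b) f (g x) x) {x : ℝ} (hx : x ∈ Icc a b) :
    (g x).len = 0 := by
  have hconst : ∀ x ∈ Icc a b, ∀ y ∈ Icc a b, (f x).len = (f y).len := fun _ hx _ hy =>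
    len_eq_of_hasKindDeriv hab hf hk h hx hy
  rcases hx.2.lt_or_eq with hxb | hxb
  · have hev := mem_Icc_add (a := a) (b := b) ⟨hx.1, hxb⟩
    have hr := (h x hx).1 ⟨b, ⟨hab.le, le_rfl⟩, hxb⟩
    rcases hk with rfl | rfl <;> refine len_eq_zero_of_hDiffTendsto hr (hev.mono fun h hh => ?_)
    · exact hconst _ hh _ hx
    · exact hconst _ hx _ hh
  · have hxa : a < x := hxb ▸ hab
    have hev := mem_Icc_sub (a := a) (b := b) ⟨hxa, hx.2⟩
    have hl := (h x hx).2 ⟨a, ⟨le_rfl, hab.le⟩, hxa⟩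
    rcases hk with rfl | rfl <;> refine len_eq_zero_of_hDiffTendsto hl (hev.mono fun h hh => ?_)
    · exact hconst _ hh _ hx
    · exact hconst _ hx _ hh

/-- Equal lengths make the difference a real number, whose negative is the difference in the other
order. The two signs cancel in the quotient, so cases 3 and 4 can be exchanged with case 1. -/
theorem hDiffTendsto_swap {p q : ℝ → FuzzyNumber} {c : ℝ → ℝ} {L : FuzzyNumber}
    (h : _root_.HDiffTendsto p q c L) (hpq : ∀ᶠ h in 𝓝[>] (0 : ℝ), (p h).len = (q h).len) :
    _root_.HDiffTendsto q p (fun s => -c s) L := by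
  obtain ⟨w, h1, h2⟩ := h
  refine ⟨fun s => (-1 : ℝ) • w s, ?_, ?_⟩
  · filter_upwards [h1, hpq] with h hh hl
    have : (w h).len = 0 := by
      rw [hh, len_add] at hl
      linarith
    rw [hh, add_assoc, add_neg_of_len_eq_zero this, add_zero]
  · simpa only [smul_smul, neg_mul_neg, mul_one] using h2

/-- The elements of length zero form a closed subcone, so the integrals of `g`, which are the
increments of `f`, belong to it. -/
theorem len_eq_of_isConePrimitive (hg : Continuous g) (h : IsConePrimitive a b f g)
    (hlen : ∀ x ∈ Icc a b, (g x).len = 0) {s t : ℝ} (hs : s ∈ Icc a b) (ht : t ∈ Icc a b) :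
    (f s).len = (f t).len := by
  wlog hst : s < t generalizing s t
  · rcases (not_lt.1 hst).eq_or_lt with rfl | hlt
    · rfl
    · exact (this ht hs hlt).symm
  obtain ⟨W, hW, -⟩ := h.exists_increment hg (C := {u | u.len = 0})
    (isClosed_eq continuous_len continuous_const) len_zero
    (fun x (hx : x.len = 0) y (hy : y.len = 0) => by
      rw [mem_ofPred_eq, len_add, hx, hy, add_zero])
    (fun c _ x (hx : x.len = 0) => by rw [mem_ofPred_eq, len_smul, hx, mul_zero]) hlen
  obtain ⟨h1, h2⟩ := hW s (t - s) hs.1 (sub_pos.2 hst) (by linarith [ht.2])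
  replace h2 : (W s (t - s)).len = 0 := h2
  rw [add_sub_cancel] at h1
  rw [h1, len_add, h2, add_zero]

/-- Differentiability in a fixed case is preserved by uniform limits of the function and of the
derivative. -/
theorem hasKindDeriv_of_tendsto (hab : a < b) {k : DiffKind} {fs gs : ℕ → ℝ → FuzzyNumber}
    (hg : Continuous g) (hfs : ∀ n, Continuous (fs n))
    (hgs : ∀ n, Continuous (gs n))
    (hflim : ∀ ε > 0, ∃ N, ∀ n ≥ N, ∀ s, dist (fs n s) (f s) ≤ ε)
    (hglim : ∀ ε > 0, ∃ N, ∀ n ≥ N, ∀ s, dist (gs n s) (g s) ≤ ε)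
    (h : ∀ n, ∀ x ∈ Icc a b, HasKindDeriv k (Icc a b) (fs n) (gs n x) x) {x : ℝ}
    (hx : x ∈ Icc a b) : HasKindDeriv k (Icc a b) f (g x) x := by
  have hone : ∀ {f g : ℝ → FuzzyNumber} {fs gs : ℕ → ℝ → FuzzyNumber}, Continuous g →
      (∀ n, Continuous (fs n)) → (∀ n, Continuous (gs n)) →
      (∀ ε > 0, ∃ N, ∀ n ≥ N, ∀ s, dist (fs n s) (f s) ≤ ε) →
      (∀ ε > 0, ∃ N, ∀ n ≥ N, ∀ s, dist (gs n s) (g s) ≤ ε) →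
      (∀ n, ∀ x ∈ Ico a b, DiffKind.one.Right (fs n) (gs n x) x) → IsConePrimitive a b f g := by
    intro f g fs gs hg hfs hgs hflim hglim h
    exact IsConePrimitive.of_tendsto hg hgs hflim hglim fun n =>
      isConePrimitive_of_right (hfs n) (hgs n) (h n)
  have hbmem : b ∈ Icc a b := ⟨hab.le, le_rfl⟩
  -- In cases 3 and 4 all the derivatives have length zero, and so does their limit; the right
  -- condition can then be brought to the form of case 1.
  have crisp : ∀ hk : k = .three ∨ k = .four, IsConePrimitive a b f g ∧
      ∀ x ∈ Icc a b, ∀ y ∈ Icc a b, (f x).len = (f y).len := by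
    intro hk
    have hlen : ∀ n, ∀ x ∈ Icc a b, (gs n x).len = 0 := fun n x hx =>
      len_deriv_eq_zero hab (hfs n) hk (h n) hx
    have hlenf : ∀ x ∈ Icc a b, (g x).len = 0 := fun x hx => by
      have ht : Tendsto (fun n => gs n x) atTop (𝓝 (g x)) := by
        rw [Metric.tendsto_atTop]
        intro ε hε
        obtain ⟨N, hN⟩ := hglim (ε / 2) (half_pos hε)
        exact ⟨N, fun n hn => (hN n hn x).trans_lt (half_lt_self hε)⟩
      refine tendsto_nhds_unique ((continuous_len.tendsto _).comp ht) ?_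
      simp only [Function.comp_def, hlen _ x hx]
      exact tendsto_const_nhds
    have hprim : IsConePrimitive a b f g := by
      refine hone hg hfs hgs hflim hglim fun n x hx => ?_
      have hr := (h n x ⟨hx.1, hx.2.le⟩).1 ⟨b, hbmem, hx.2⟩
      rcases hk with rfl | rfl
      · exact hr
      · have hconst : ∀ᶠ h in 𝓝[>] (0 : ℝ), (fs n x).len = (fs n (x + h)).len :=
          (mem_Icc_add hx).mono fun _ hh =>
            len_eq_of_hasKindDeriv hab (hfs n) (Or.inr rfl) (h n) ⟨hx.1, hx.2.le⟩ hh
        simpa only [DiffKind.Right, neg_neg] using hDiffTendsto_swap hr hconst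
    exact ⟨hprim, fun x hx y hy => len_eq_of_isConePrimitive hg hprim hlenf hx hy⟩
  cases k with
  | one =>
    exact (hone hg hfs hgs hflim hglim fun n x hx =>
      (h n x ⟨hx.1, hx.2.le⟩).1 ⟨b, hbmem, hx.2⟩).hasKindDeriv_one hg hx
  | two =>
    have hx' : a + b - x ∈ Icc a b := ⟨by linarith [hx.2], by linarith [hx.1]⟩
    -- Case 2 becomes case 1 after reflection of the interval; the limit is taken there and
    -- reflected back.
    have hprim : IsConePrimitive a b (fun t => f (a + b - t))
        (fun t => (-1 : ℝ) • g (a + b - t)) := by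
      refine hone (fs := fun n t => fs n (a + b - t)) (gs := fun n t => (-1 : ℝ) • gs n (a + b - t))
        (by fun_prop) (fun n => by have := hfs n; fun_prop) (fun n => by have := hgs n; fun_prop)
        (fun ε hε => ?_) (fun ε hε => ?_) fun n y hy => ?_
      · obtain ⟨N, hN⟩ := hflim ε hε
        exact ⟨N, fun n hn s => hN n hn _⟩
      · obtain ⟨N, hN⟩ := hglim ε hε
        refine ⟨N, fun n hn s => ?_⟩
        rw [MetricCone.dist_smul]
        simpa using hN n hn (a + b - s)
      · have := (h n (a + b - y) ⟨by linarith [hy.2], by linarith [hy.1]⟩).reflect_two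
        rw [sub_sub_cancel] at this
        exact this.1 ⟨b, hbmem, hy.2⟩
    have := (hprim.hasKindDeriv_one (by fun_prop) hx').reflect_one
    simpa only [sub_sub_cancel, smul_smul, neg_mul_neg, mul_one, one_smul] using this
  | three =>
    obtain ⟨hprim, hlen⟩ := crisp (Or.inl rfl)
    have h1 := hprim.hasKindDeriv_one hg hx
    refine ⟨h1.1, fun hs => ?_⟩
    refine hDiffTendsto_swap (h1.2 hs) ?_
    obtain ⟨s, hs, hsx⟩ := hs
    filter_upwards [mem_Icc_sub (a := a) (b := b) ⟨hs.1.trans_lt hsx, hx.2⟩] with h hh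
    exact hlen _ hx _ hh
  | four =>
    obtain ⟨hprim, hlen⟩ := crisp (Or.inr rfl)
    have h1 := hprim.hasKindDeriv_one hg hx
    refine ⟨fun hs => ?_, h1.2⟩
    refine hDiffTendsto_swap (h1.1 hs) ?_
    obtain ⟨s, hs, hsx⟩ := hs
    filter_upwards [mem_Icc_add (a := a) (b := b) ⟨hx.1, hsx.trans_le hs.2⟩] with h hh
    exact hlen _ hh _ hx

end FuzzyNumber

/-! ### Completeness of the spaces of continuously differentiable functions. -/

namespace ConeLaws

theorem dist_apply_le_fuzzyC {a b : ℝ} (f g : FuzzyC a b) (x : Icc a b) :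
    dist (f.toFun x) (g.toFun x) ≤ dist f g :=
  le_ciSup (f := fun x => dist (f.toFun x) (g.toFun x))
    (isCompact_range (f.continuous.dist g.continuous)).bddAbove x

theorem fuzzyCp {a b : ℝ} (hab : a < b) (p : ℕ) (k : DiffKind) :
    ConeLaws (FuzzyCp a b hab p k) := by
  have hC := fuzzyC a b
  have hdist : ∀ f g : FuzzyCp a b hab p k, dist f g = ∑ i, dist (f.der i) (g.der i) :=
    fun _ _ => rfl
  have hle : ∀ (f g : FuzzyCp a b hab p k) i, dist (f.der i) (g.der i) ≤ dist f g := fun f g i =>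
    Finset.single_le_sum (f := fun i => dist (f.der i) (g.der i))
      (fun i _ => hC.dist_nonneg _ _) (Finset.mem_univ i)
  have hinj : Function.Injective (FuzzyCp.der : FuzzyCp a b hab p k → _) := fun f g h => by
    cases f; cases g; congr
  refine ⟨ConeAlgLaws.of_pi (fun _ => hC.toConeAlgLaws) FuzzyCp.der hinj (fun _ _ _ => rfl)
    (fun _ => rfl) (fun _ _ _ => rfl), fun f => ?_, fun f g => ?_, fun f g h => ?_, fun f g h => ?_,
    fun f g h => ?_, fun c f g => ?_, fun x hx => ?_⟩
  · simp only [hdist, hC.dist_self, Finset.sum_const_zero]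
  · simp only [hdist, hC.dist_comm (f.der _)]
  · rw [hdist, hdist, hdist, ← Finset.sum_add_distrib]
    exact Finset.sum_le_sum fun i _ => hC.dist_triangle _ _ _
  · exact hinj <| funext fun i => hC.eq_of_dist_eq_zero _ _
      (le_antisymm ((hle f g i).trans h.le) (hC.dist_nonneg _ _))
  · exact Finset.sum_congr rfl fun i _ => hC.dist_add_right _ _ _
  · rw [hdist, hdist, Finset.mul_sum]
    exact Finset.sum_congr rfl fun i _ => hC.dist_smul _ _ _
  · have hlim : ∀ i, ∃ y, ∀ ε > 0, ∃ N, ∀ n ≥ N, dist ((x n).der i) y ≤ ε := fun i => by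
      refine hC.complete (fun n => (x n).der i) fun ε hε => ?_
      obtain ⟨N, hN⟩ := hx ε hε
      exact ⟨N, fun m hm n hn => (hle _ _ i).trans_lt (hN m hm n hn)⟩
    choose d hd using hlim
    -- The extensions are constant outside `[a,b]`, so uniform convergence on the interval is
    -- uniform on the line.
    have hunif : ∀ i, ∀ ε > 0, ∃ N, ∀ n ≥ N, ∀ s, dist (IccExtend hab.le ((x n).der i).toFun s)
        (IccExtend hab.le (d i).toFun s) ≤ ε := fun i ε hε => by
      obtain ⟨N, hN⟩ := hd i ε hε
      exact ⟨N, fun n hn s => (dist_apply_le_fuzzyC _ _ _).trans (hN n hn)⟩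
    refine ⟨⟨d, fun i s => ?_⟩, fun ε hε => ?_⟩
    · have h := FuzzyNumber.hasKindDeriv_of_tendsto hab (k := k)
        (f := IccExtend hab.le (d i.castSucc).toFun) (g := IccExtend hab.le (d i.succ).toFun)
        (fs := fun n => IccExtend hab.le ((x n).der i.castSucc).toFun)
        (gs := fun n => IccExtend hab.le ((x n).der i.succ).toFun)
        (d i.succ).continuous.Icc_extend' (fun n => ((x n).der _).continuous.Icc_extend')
        (fun n => ((x n).der _).continuous.Icc_extend') (hunif _) (hunif _)
        (fun n y hy => by
          rw [IccExtend_of_mem _ _ hy]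
          exact (x n).hasDeriv i ⟨y, hy⟩) s.2
      rwa [IccExtend_of_mem _ _ s.2] at h
    · have hη : 0 < ε / (p + 1) := by positivity
      choose N hN using fun i => hd i (ε / (p + 1)) hη
      refine ⟨Finset.univ.sup N, fun n hn => ?_⟩
      rw [hdist]
      calc _ ≤ ∑ _i : Fin (p + 1), ε / (p + 1) := Finset.sum_le_sum fun i _ =>
            hN i n ((Finset.le_sup (Finset.mem_univ i)).trans hn)
        _ = ε := by simp; field_simp

end ConeLaws

/-! ## Spaces of integrable functions and summable sequences -/

namespace FuzzyNumber

theorem continuous_lower {r : ℝ} (hr : r ∈ Icc (0 : ℝ) 1) :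
    Continuous fun u : FuzzyNumber => u.lower r :=
  LipschitzWith.continuous (LipschitzWith.of_dist_le_mul (K := 1) fun u v => by
    simpa [Real.dist_eq] using (le_dist u v hr).1)

theorem continuous_upper {r : ℝ} (hr : r ∈ Icc (0 : ℝ) 1) :
    Continuous fun u : FuzzyNumber => u.upper r :=
  LipschitzWith.continuous (LipschitzWith.of_dist_le_mul (K := 1) fun u v => by
    simpa [Real.dist_eq] using (le_dist u v hr).2)

/-- Left continuity of the endpoints lets rational levels below `r` replace `r > 0`, and `0` is
itself rational. The distance is thus a countable supremum, hence measurable for functions with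
measurable levels. -/
theorem dist_le_of_rat (u v : FuzzyNumber) (M : ℝ)
    (h : ∀ q : ℚ, (q : ℝ) ∈ Icc (0 : ℝ) 1 →
      |u.lower q - v.lower q| ≤ M ∧ |u.upper q - v.upper q| ≤ M) : dist u v ≤ M := by
  refine dist_le _ _ _ fun r hr => ?_
  rcases hr.1.eq_or_lt with rfl | h0
  · simpa using h 0 (by simp)
  have hr' : r ∈ Ioc (0 : ℝ) 1 := ⟨h0, hr.2⟩
  constructor <;> refine le_of_forall_pos_le_add fun ε hε => ?_
  · obtain ⟨q, hq, h1⟩ := u.lower_left_cont hr' hε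
    obtain ⟨q', hq', h2⟩ := v.lower_left_cont hr' hε
    -- Above both `q` and `q'` the endpoints of `u` and `v` are within `ε` of their values at `r`.
    -- Both errors have the same sign, so a single `ε` is lost.
    obtain ⟨s, hs1, hs2⟩ := exists_rat_btwn (max_lt hq.2 hq'.2)
    obtain ⟨hs1, hs1'⟩ := max_lt_iff.1 hs1
    have a1 := (u.level_antitone hq.1 hs1.le (hs2.le.trans hr.2)).1
    have a2 := (v.level_antitone hq'.1 hs1'.le (hs2.le.trans hr.2)).1
    have a3 := (u.level_antitone (hq.1.trans hs1.le) hs2.le hr.2).1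
    have a4 := (v.level_antitone (hq.1.trans hs1.le) hs2.le hr.2).1
    have := (h s ⟨hq.1.trans hs1.le, hs2.le.trans hr.2⟩).1
    rw [abs_le] at this ⊢
    constructor <;> linarith
  · obtain ⟨q, hq, h1⟩ := u.upper_left_cont hr' hε
    obtain ⟨q', hq', h2⟩ := v.upper_left_cont hr' hε
    obtain ⟨s, hs1, hs2⟩ := exists_rat_btwn (max_lt hq.2 hq'.2)
    obtain ⟨hs1, hs1'⟩ := max_lt_iff.1 hs1
    have a1 := (u.level_antitone hq.1 hs1.le (hs2.le.trans hr.2)).2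
    have a2 := (v.level_antitone hq'.1 hs1'.le (hs2.le.trans hr.2)).2
    have a3 := (u.level_antitone (hq.1.trans hs1.le) hs2.le hr.2).2
    have a4 := (v.level_antitone (hq.1.trans hs1.le) hs2.le hr.2).2
    have := (h s ⟨hq.1.trans hs1.le, hs2.le.trans hr.2⟩).2
    rw [abs_le] at this ⊢
    constructor <;> linarith

theorem dist_eq_iSup_rat (u v : FuzzyNumber) :
    dist u v = ⨆ q : {q : ℚ // (q : ℝ) ∈ Icc (0 : ℝ) 1},
      max |u.lower q.1 - v.lower q.1| |u.upper q.1 - v.upper q.1| := by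
  have hb : BddAbove (range fun q : {q : ℚ // (q : ℝ) ∈ Icc (0 : ℝ) 1} =>
      max |u.lower q.1 - v.lower q.1| |u.upper q.1 - v.upper q.1|) := by
    refine ⟨dist u v, ?_⟩
    rintro _ ⟨q, rfl⟩
    exact max_le (le_dist u v q.2).1 (le_dist u v q.2).2
  apply le_antisymm
  · exact dist_le_of_rat u v _ fun q hq => max_le_iff.1 (le_ciSup hb ⟨q, hq⟩)
  · have : Nonempty {q : ℚ // (q : ℝ) ∈ Icc (0 : ℝ) 1} := ⟨⟨0, by simp⟩⟩
    exact ciSup_le fun q => max_le (le_dist u v q.2).1 (le_dist u v q.2).2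

/-! ### Functions with integrable powers over a measure space. -/

section Lp

variable {S : Type} [MeasurableSpace S] {μ : Measure S} {q : ℝ≥0∞}

/-- All endpoints of the levels are measurable. -/
def LevelMeas (μ : Measure S) (f : S → FuzzyNumber) : Prop :=
  ∀ r ∈ Icc (0 : ℝ) 1, AEMeasurable (fun x => (f x).lower r) μ ∧
    AEMeasurable (fun x => (f x).upper r) μ

theorem LevelMeas.dist {f g : S → FuzzyNumber} (hf : LevelMeas μ f) (hg : LevelMeas μ g) :
    AEStronglyMeasurable (fun x => dist (f x) (g x)) μ := by
  simp only [dist_eq_iSup_rat]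
  refine AEMeasurable.aestronglyMeasurable (AEMeasurable.iSup fun r => ?_)
  exact (measurable_abs.comp_aemeasurable ((hf r.1 r.2).1.sub (hg r.1 r.2).1)).max
    (measurable_abs.comp_aemeasurable ((hf r.1 r.2).2.sub (hg r.1 r.2).2))

theorem LevelMeas.zero : LevelMeas μ (fun _ => (0 : FuzzyNumber)) :=
  fun _ _ => ⟨aemeasurable_const, aemeasurable_const⟩

theorem LevelMeas.add {f g : S → FuzzyNumber} (hf : LevelMeas μ f) (hg : LevelMeas μ g) :
    LevelMeas μ fun x => f x + g x := fun r hr => by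
  simp only [lower_add _ _ hr, upper_add _ _ hr]
  exact ⟨(hf r hr).1.add (hg r hr).1, (hf r hr).2.add (hg r hr).2⟩

theorem LevelMeas.smul {f : S → FuzzyNumber} (hf : LevelMeas μ f) (c : ℝ) :
    LevelMeas μ fun x => c • f x := fun r hr => by
  rcases le_total 0 c with hc | hc
  · simp only [(lower_smul_of_nonneg hc _ hr).1, (lower_smul_of_nonneg hc _ hr).2]
    exact ⟨(hf r hr).1.const_mul c, (hf r hr).2.const_mul c⟩
  · simp only [(lower_smul_of_nonpos hc _ hr).1, (lower_smul_of_nonpos hc _ hr).2]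
    exact ⟨(hf r hr).2.const_mul c, (hf r hr).1.const_mul c⟩

/-- Functions with measurable levels and integrable `q`-th power of the norm. -/
def LpFun (q : ℝ≥0∞) (μ : Measure S) : Type :=
  {f : S → FuzzyNumber // LevelMeas μ f ∧ MemLp (fun x => dist 0 (f x)) q μ}

namespace LpFun

/-- The distance of two functions in the mean of order `q`. -/
noncomputable def edist (f g : LpFun q μ) : ℝ≥0∞ := eLpNorm (fun x => dist (f.1 x) (g.1 x)) q μ

theorem aesm (f g : LpFun q μ) : AEStronglyMeasurable (fun x => dist (f.1 x) (g.1 x)) μ :=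
  f.2.1.dist g.2.1

theorem memLp_dist (f g : LpFun q μ) : MemLp (fun x => dist (f.1 x) (g.1 x)) q μ := by
  refine (f.2.2.add g.2.2).mono (f.aesm g) (Eventually.of_forall fun x => ?_)
  rw [Real.norm_of_nonneg dist_nonneg]
  exact (dist_triangle_left _ _ _).trans (le_abs_self _)

theorem edist_ne_top (f g : LpFun q μ) : edist f g ≠ ⊤ := (f.memLp_dist g).2.ne

theorem edist_comm (f g : LpFun q μ) : edist f g = edist g f := by
  simp only [edist, dist_comm]

theorem edist_triangle (hq : 1 ≤ q) (f g h : LpFun q μ) :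
    edist f h ≤ edist f g + edist g h := by
  refine le_trans (eLpNorm_mono_real fun x => ?_) (eLpNorm_add_le (f.aesm g) (g.aesm h) hq)
  rw [Real.norm_of_nonneg dist_nonneg]
  exact dist_triangle _ _ _

noncomputable instance : Zero (LpFun q μ) :=
  ⟨⟨fun _ => 0, LevelMeas.zero, by simp⟩⟩

noncomputable instance : Add (LpFun q μ) :=
  ⟨fun f g => ⟨fun x => f.1 x + g.1 x, f.2.1.add g.2.1, by
    refine (f.2.2.add g.2.2).mono (LevelMeas.zero.dist (f.2.1.add g.2.1))
      (Eventually.of_forall fun x => ?_)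
    rw [Real.norm_of_nonneg dist_nonneg]
    exact (dist_zero_add_le _ _).trans (le_abs_self _)⟩⟩

noncomputable instance : SMul ℝ (LpFun q μ) :=
  ⟨fun c f => ⟨fun x => c • f.1 x, f.2.1.smul c, by
    refine (f.2.2.const_mul |c|).mono (LevelMeas.zero.dist (f.2.1.smul c))
      (Eventually.of_forall fun x => ?_)
    rw [Real.norm_of_nonneg dist_nonneg]
    exact (dist_zero_smul_le _ _).trans (le_abs_self _)⟩⟩

theorem coneAlgLaws : ConeAlgLaws (LpFun q μ) :=
  ConeAlgLaws.of_pi (fun _ => ConeLaws.fuzzyNumber.toConeAlgLaws) Subtype.val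
    Subtype.val_injective (fun _ _ _ => rfl) (fun _ => rfl) (fun _ _ _ => rfl)

theorem sum_Ico_half (m n : ℕ) (h : m ≤ n) :
    (∑ k ∈ Finset.Ico m n, (2⁻¹ : ℝ≥0∞) ^ k) + 2 * 2⁻¹ ^ n = 2 * 2⁻¹ ^ m := by
  induction n, h using Nat.le_induction with
  | base => simp
  | succ n hn ih =>
    rw [Finset.sum_Ico_succ_top hn, ← ih, add_assoc, pow_succ', ← mul_assoc,
      ENNReal.mul_inv_cancel two_ne_zero ENNReal.ofNat_ne_top, one_mul, two_mul]

/-- The partial sums of the consecutive distances are real functions, Cauchy at a geometric rate in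
the mean. They converge almost everywhere, so the consecutive distances are summable there. -/
theorem ae_cauchySeq (hq : 1 ≤ q) (f : ℕ → LpFun q μ)
    (h : ∀ k, edist (f k) (f (k + 1)) ≤ 2⁻¹ ^ k) : ∀ᵐ x ∂μ, CauchySeq fun k => (f k).1 x := by
  set F : ℕ → S → ℝ := fun k x => dist ((f k).1 x) ((f (k + 1)).1 x) with hF
  have hFm : ∀ k, AEStronglyMeasurable (F k) μ := fun k => (f k).aesm (f (k + 1))
  set H : ℕ → S → ℝ := fun n => ∑ k ∈ Finset.range n, F k with hH
  have hHm : ∀ n, AEStronglyMeasurable (H n) μ := fun n =>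
    Finset.aestronglyMeasurable_sum _ fun k _ => hFm k
  -- The geometric tail is at most `2 * 2⁻¹ ^ N`; the factor `3` provides the strict inequality.
  have key : ∀ N n m : ℕ, N ≤ m → m ≤ n → eLpNorm (H n - H m) q μ < 3 * 2⁻¹ ^ N := by
    intro N n m hm hmn
    have e : H n - H m = ∑ k ∈ Finset.Ico m n, F k := (Finset.sum_Ico_eq_sub _ hmn).symm
    have h0 : (2⁻¹ : ℝ≥0∞) ^ N ≠ 0 := pow_ne_zero _ (ENNReal.inv_ne_zero.2 ENNReal.ofNat_ne_top)
    have ht : (2⁻¹ : ℝ≥0∞) ^ N ≠ ⊤ := ENNReal.pow_ne_top (ENNReal.inv_ne_top.2 two_ne_zero)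
    calc eLpNorm (H n - H m) q μ ≤ ∑ k ∈ Finset.Ico m n, eLpNorm (F k) q μ := by
          rw [e]; exact eLpNorm_sum_le (fun k _ => hFm k) hq
      _ ≤ ∑ k ∈ Finset.Ico m n, 2⁻¹ ^ k := Finset.sum_le_sum fun k _ => h k
      _ ≤ 2 * 2⁻¹ ^ m := by rw [← sum_Ico_half m n hmn]; exact le_self_add
      _ ≤ 2 * 2⁻¹ ^ N := by
          gcongr 2 * ?_
          exact pow_le_pow_right_of_le_one' (ENNReal.inv_le_one.2 one_le_two) hm
      _ < 3 * 2⁻¹ ^ N := by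
          exact (ENNReal.mul_lt_mul_iff_left h0 ht).2 (by norm_num)
  have hae := Lp.ae_tendsto_of_cauchy_eLpNorm hHm hq (B := fun N => 3 * 2⁻¹ ^ N)
    (by
      rw [ENNReal.tsum_mul_left, ENNReal.tsum_geometric]
      exact ENNReal.mul_ne_top (by simp) (by simp))
    (fun N n m hn hm => by
      rcases le_total m n with hmn | hmn
      · exact key N n m hm hmn
      · rw [eLpNorm_sub_comm]; exact key N m n hn hmn)
  filter_upwards [hae] with x hx
  obtain ⟨l, hl⟩ := hx
  refine cauchySeq_of_summable_dist (HasSum.summable (a := l) ?_)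
  rw [hasSum_iff_tendsto_nat_of_nonneg fun _ => dist_nonneg]
  simpa only [hH, Finset.sum_apply] using hl

/-- Riesz–Fischer: a rapidly converging subsequence has a limit almost everywhere, and Fatou's lemma
gives convergence of the whole sequence in the mean. -/
theorem exists_limit (hq : 1 ≤ q) (f : ℕ → LpFun q μ)
    (h : ∀ ε : ℝ≥0∞, 0 < ε → ∃ N, ∀ m ≥ N, ∀ n ≥ N, edist (f m) (f n) < ε) :
    ∃ g : LpFun q μ, ∀ ε : ℝ≥0∞, 0 < ε → ∃ N, ∀ n ≥ N, edist (f n) g ≤ ε := by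
  obtain ⟨θ, hθ, hθP⟩ := extraction_forall_of_eventually'
    (P := fun k n => ∀ m ≥ n, edist (f n) (f m) < 2⁻¹ ^ k) fun k => by
      obtain ⟨N, hN⟩ := h (2⁻¹ ^ k) (ENNReal.pow_pos (ENNReal.inv_pos.2 ENNReal.ofNat_ne_top) _)
      exact ⟨N, fun n hn m hm => hN n hn m (hn.trans hm)⟩
  have hae := ae_cauchySeq hq (fun k => f (θ k)) fun k =>
    (hθP k (θ (k + 1)) (hθ.monotone k.le_succ)).le
  have hex : ∀ x, ∃ l : FuzzyNumber, CauchySeq (fun k => (f (θ k)).1 x) →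
      Tendsto (fun k => (f (θ k)).1 x) atTop (𝓝 l) := fun x => by
    by_cases hx : CauchySeq fun k => (f (θ k)).1 x
    · obtain ⟨l, hl⟩ := cauchySeq_tendsto_of_complete hx
      exact ⟨l, fun _ => hl⟩
    -- The value on the null set without convergence is irrelevant.
    · exact ⟨0, fun h => absurd h hx⟩
  choose G hG using hex
  have hlim : ∀ᵐ x ∂μ, Tendsto (fun k => (f (θ k)).1 x) atTop (𝓝 (G x)) := by
    filter_upwards [hae] with x hx using hG x hx
  have hGm : LevelMeas μ G := fun r hr =>
    ⟨aemeasurable_of_tendsto_metrizable_ae atTop (fun k => ((f (θ k)).2.1 r hr).1) (by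
      filter_upwards [hlim] with x hx using ((continuous_lower hr).tendsto _).comp hx),
    aemeasurable_of_tendsto_metrizable_ae atTop (fun k => ((f (θ k)).2.1 r hr).2) (by
      filter_upwards [hlim] with x hx using ((continuous_upper hr).tendsto _).comp hx)⟩
  have hfatou : ∀ ε : ℝ≥0∞, 0 < ε → ∃ N, ∀ n ≥ N,
      eLpNorm (fun x => dist ((f n).1 x) (G x)) q μ ≤ ε := by
    intro ε hε
    obtain ⟨N, hN⟩ := h ε hε
    refine ⟨N, fun n hn => ?_⟩
    refine (Lp.eLpNorm_lim_le_liminf_eLpNorm (f := fun k x => dist ((f n).1 x) ((f (θ k)).1 x))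
      (fun k => (f n).aesm (f (θ k))) _ (by
        filter_upwards [hlim] with x hx using tendsto_const_nhds.dist hx)).trans ?_
    refine liminf_le_of_frequently_le' (Eventually.frequently ?_)
    filter_upwards [eventually_ge_atTop N] with k hk
    exact (hN n hn (θ k) (hk.trans (hθ.id_le k))).le
  have hmem : MemLp (fun x => dist 0 (G x)) q μ := by
    obtain ⟨N, hN⟩ := hfatou 1 one_pos
    have h1 : MemLp (fun x => dist ((f N).1 x) (G x)) q μ :=
      ⟨(f N).2.1.dist hGm, (hN N le_rfl).trans_lt ENNReal.one_lt_top⟩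
    refine ((f N).2.2.add h1).mono (LevelMeas.zero.dist hGm) (Eventually.of_forall fun x => ?_)
    rw [Real.norm_of_nonneg dist_nonneg]
    exact (dist_triangle _ _ _).trans (le_abs_self _)
  exact ⟨⟨G, hGm, hmem⟩, hfatou⟩

end LpFun

end Lp

end FuzzyNumber

/-! ### The spaces `L^p` and `l^p`. -/

namespace ConeLaws

open FuzzyNumber

/-- A space of classes of functions with the metric of the mean of order `q` is a cone. -/
theorem of_LpFun {X S : Type} [Add X] [Zero X] [SMul ℝ X] [Dist X] [MeasurableSpace S]
    {μ : Measure S} {q : ℝ≥0∞} (hq : 1 ≤ q) (rep : LpFun q μ → X)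
    (hsurj : Function.Surjective rep) (hrep : ∀ f g : LpFun q μ, f.1 =ᵐ[μ] g.1 → rep f = rep g)
    (hadd : ∀ f g, rep (f + g) = rep f + rep g) (hzero : rep 0 = 0)
    (hsmul : ∀ (c : ℝ) f, rep (c • f) = c • rep f)
    (hdist : ∀ f g, dist (rep f) (rep g) = (LpFun.edist f g).toReal) : ConeLaws X := by
  have hL := LpFun.coneAlgLaws (q := q) (μ := μ)
  constructor
  · constructor
    · intro x y
      obtain ⟨f, rfl⟩ := hsurj x
      obtain ⟨g, rfl⟩ := hsurj y
      rw [← hadd, ← hadd, hL.add_comm]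
    · intro x y z
      obtain ⟨f, rfl⟩ := hsurj x
      obtain ⟨g, rfl⟩ := hsurj y
      obtain ⟨k, rfl⟩ := hsurj z
      simp only [← hadd, hL.add_assoc]
    · intro x
      obtain ⟨f, rfl⟩ := hsurj x
      rw [← hzero, ← hadd, hL.zero_add]
    · intro x
      obtain ⟨f, rfl⟩ := hsurj x
      rw [← hsmul, hL.one_smul]
    · intro c e x
      obtain ⟨f, rfl⟩ := hsurj x
      simp only [← hsmul, hL.mul_smul]
    · intro c x y
      obtain ⟨f, rfl⟩ := hsurj x
      obtain ⟨g, rfl⟩ := hsurj y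
      simp only [← hsmul, ← hadd, hL.smul_add]
    · intro x
      obtain ⟨f, rfl⟩ := hsurj x
      rw [← hsmul, hL.zero_smul, hzero]
    · intro c e x hc he
      obtain ⟨f, rfl⟩ := hsurj x
      simp only [← hsmul, ← hadd, hL.add_smul c e f hc he]
  · intro x
    obtain ⟨f, rfl⟩ := hsurj x
    rw [hdist, LpFun.edist]
    simp
  · intro x y
    obtain ⟨f, rfl⟩ := hsurj x
    obtain ⟨g, rfl⟩ := hsurj y
    rw [hdist, hdist, LpFun.edist_comm]
  · intro x y z
    obtain ⟨f, rfl⟩ := hsurj x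
    obtain ⟨g, rfl⟩ := hsurj y
    obtain ⟨k, rfl⟩ := hsurj z
    rw [hdist, hdist, hdist,
      ← ENNReal.toReal_add (LpFun.edist_ne_top f g) (LpFun.edist_ne_top g k)]
    exact ENNReal.toReal_mono
      (ENNReal.add_ne_top.2 ⟨LpFun.edist_ne_top f g, LpFun.edist_ne_top g k⟩)
      (LpFun.edist_triangle hq f g k)
  · intro x y h
    obtain ⟨f, rfl⟩ := hsurj x
    obtain ⟨g, rfl⟩ := hsurj y
    rw [hdist, ENNReal.toReal_eq_zero_iff, or_iff_left (LpFun.edist_ne_top f g), LpFun.edist,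
      eLpNorm_eq_zero_iff (f.aesm g) (zero_lt_one.trans_le hq).ne'] at h
    refine hrep f g ?_
    filter_upwards [h] with x hx
    exact _root_.eq_of_dist_eq_zero hx
  · intro x y z
    obtain ⟨f, rfl⟩ := hsurj x
    obtain ⟨g, rfl⟩ := hsurj y
    obtain ⟨k, rfl⟩ := hsurj z
    rw [← hadd, ← hadd, hdist, hdist]
    have e : (fun s => dist ((f + k : LpFun q μ).1 s) ((g + k : LpFun q μ).1 s)) =
        fun s => dist (f.1 s) (g.1 s) := funext fun s => MetricCone.dist_add_right _ _ _
    rw [LpFun.edist, LpFun.edist, e]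
  · intro c x y
    obtain ⟨f, rfl⟩ := hsurj x
    obtain ⟨g, rfl⟩ := hsurj y
    rw [← hsmul, ← hsmul, hdist, hdist, LpFun.edist, LpFun.edist]
    have e : (fun s => dist ((c • f : LpFun q μ).1 s) ((c • g : LpFun q μ).1 s)) =
        |c| • fun s => dist (f.1 s) (g.1 s) := funext fun s => MetricCone.dist_smul _ _ _
    rw [e, eLpNorm_const_smul, ENNReal.toReal_mul]
    simp
  · intro x hx
    choose f hf using fun n => hsurj (x n)
    obtain rfl : (fun n => rep (f n)) = x := funext hf
    obtain ⟨g, hg⟩ := LpFun.exists_limit hq f fun ε hε => by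
      rcases eq_or_ne ε ⊤ with rfl | hε'
      · exact ⟨0, fun m _ n _ => (LpFun.edist_ne_top _ _).lt_top⟩
      · obtain ⟨N, hN⟩ := hx ε.toReal (ENNReal.toReal_pos hε.ne' hε')
        refine ⟨N, fun m hm n hn => ?_⟩
        have := hN m hm n hn
        rw [hdist] at this
        exact (ENNReal.toReal_lt_toReal (LpFun.edist_ne_top _ _) hε').1 this
    refine ⟨rep g, fun ε hε => ?_⟩
    obtain ⟨N, hN⟩ := hg (ENNReal.ofReal ε) (ENNReal.ofReal_pos.2 hε)
    refine ⟨N, fun n hn => ?_⟩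
    rw [hdist]
    exact ENNReal.toReal_le_of_le_ofReal hε.le (hN n hn)

theorem fuzzyLp (a b p : ℝ) (hp : 1 ≤ p) : ConeLaws (FuzzyLp a b p) := by
  refine of_LpFun (μ := lebIcc a b) (q := ENNReal.ofReal p)
    (by rwa [ENNReal.one_le_ofReal])
    (fun f => Quotient.mk (PreFuzzyLp.setoid a b p) ⟨f.1, f.2.1, f.2.2⟩) ?_
    (fun f g h => Quotient.sound h) (fun _ _ => rfl) rfl (fun _ _ => rfl) (fun _ _ => rfl)
  intro x
  induction x using Quotient.inductionOn with
  | h f => exact ⟨⟨f.toFun, f.meas, f.memLp⟩, rfl⟩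

/-- Sequences are functions on `ℕ` with the counting measure, so `l^p` inherits its laws from the
integral case. -/
theorem memLp_count_iff {p : ℝ} (hp : 1 ≤ p) (f : ℕ → ℝ) :
    MemLp f (ENNReal.ofReal p) Measure.count ↔ Memℓp f (ENNReal.ofReal p) := by
  have hp0 : 0 < p := one_pos.trans_le hp
  have h0 : ENNReal.ofReal p ≠ 0 := (ENNReal.ofReal_pos.2 hp0).ne'
  have hr : (ENNReal.ofReal p).toReal = p := ENNReal.toReal_ofReal hp0.le
  have e : ∀ n, ‖f n‖ₑ ^ p = ENNReal.ofReal (‖f n‖ ^ p) := fun n => by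
    rw [← ofReal_norm, ENNReal.ofReal_rpow_of_nonneg (norm_nonneg _) hp0.le]
  rw [memℓp_gen_iff (by rwa [hr]), hr, MemLp,
    and_iff_right (measurable_of_countable f).aestronglyMeasurable,
    eLpNorm_lt_top_iff_lintegral_rpow_enorm_lt_top h0 ENNReal.ofReal_ne_top, hr,
    lintegral_count]
  simp only [e]
  have hnn : ∀ n, 0 ≤ ‖f n‖ ^ p := fun n => by positivity
  refine ⟨fun h => ?_, fun h => ?_⟩
  · simpa only [ENNReal.toReal_ofReal (hnn _)] using ENNReal.summable_toReal h.ne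
  · exact h.tsum_ofReal_lt_top

theorem eLpNorm_count {p : ℝ} (hp : 1 ≤ p) (f : ℕ → ℝ) (hf : ∀ n, 0 ≤ f n) :
    (eLpNorm f (ENNReal.ofReal p) Measure.count).toReal = (∑' n, f n ^ p) ^ (1 / p) := by
  have hp0 : 0 < p := one_pos.trans_le hp
  have h0 : ENNReal.ofReal p ≠ 0 := (ENNReal.ofReal_pos.2 hp0).ne'
  have e : ∀ n, ‖f n‖ₑ ^ p = ENNReal.ofReal (f n ^ p) := fun n => by
    rw [← ofReal_norm, ENNReal.ofReal_rpow_of_nonneg (norm_nonneg _) hp0.le,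
      Real.norm_of_nonneg (hf n)]
  rw [eLpNorm_eq_lintegral_rpow_enorm_toReal h0 ENNReal.ofReal_ne_top,
    ENNReal.toReal_ofReal hp0.le, lintegral_count, ← ENNReal.toReal_rpow]
  simp only [e]
  rw [ENNReal.tsum_toReal_eq fun n => ENNReal.ofReal_ne_top]
  simp only [ENNReal.toReal_ofReal (Real.rpow_nonneg (hf _) p)]

theorem fuzzySeqLp (p : ℝ) (hp : 1 ≤ p) : ConeLaws (FuzzySeqLp p) := by
  refine of_LpFun (μ := (Measure.count : Measure ℕ)) (q := ENNReal.ofReal p)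
    (by rwa [ENNReal.one_le_ofReal])
    (fun f => (⟨f.1, (memLp_count_iff hp _).1 f.2.2⟩ : FuzzySeqLp p)) ?_
    (fun f g h => Subtype.ext ?_) (fun _ _ => rfl) rfl (fun _ _ => rfl) (fun f g => ?_)
  · intro x
    exact ⟨⟨x.1, fun r hr => ⟨(measurable_of_countable _).aemeasurable,
      (measurable_of_countable _).aemeasurable⟩, (memLp_count_iff hp _).2 x.2⟩, rfl⟩
  · funext n
    exact Measure.ae_count_iff.1 h n
  · exact (eLpNorm_count hp _ fun _ => _root_.dist_nonneg).symm

end ConeLaws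

/-! ### The theorem for the listed spaces. -/

theorem ConeLaws.of_isStandard {X : FuzzySpace} (hX : X.IsStandard) : ConeLaws X := by
  induction hX with
  | number => exact ConeLaws.fuzzyNumber
  | cont a b hab => exact ConeLaws.fuzzyC a b
  | contDiff a b hab p k => exact ConeLaws.fuzzyCp hab p k
  | lebesgue a b hab p hp => exact ConeLaws.fuzzyLp a b p hp
  | seqLp p hp => exact ConeLaws.fuzzySeqLp p hp
  | bounded => exact ConeLaws.fuzzyBdd
  | convergent => exact ConeLaws.fuzzyConv
  | null => exact ConeLaws.fuzzyNull
  | prod n Y hY ih => exact ConeLaws.prod Y ih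

theorem theorem3p9 (X : FuzzySpace) (hX : X.IsStandard) (A : X → X) (hA : IsContLinOp A) :
    ∃ T : ℝ → X → X,
      -- the series converges in the operator metric, and its limit is unique
      (∀ t : ℝ, IsExpOp A t (T t)) ∧
      (∀ (t : ℝ) (S : X → X), IsExpOp A t S → S = T t) ∧
      -- semigroup law
      (∀ t s : ℝ, (0 ≤ t ∧ 0 ≤ s) ∨ (t ≤ 0 ∧ s ≤ 0) → ∀ x : X, T (t + s) x = T t (T s x)) ∧
      -- generator
      (∀ x : X, HDiffTendsto (fun h => T h x) (fun _ => x) (fun h => 1 / h) (A x)) ∧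
      -- continuity and differentiability
      (∀ t : ℝ, Tendsto (fun s => opDist (T s) (T t)) (𝓝 t) (𝓝 0)) ∧
      (∀ x : X, T 0 x = x) ∧
      (∀ (x : X) (t : ℝ), HasGenDeriv (fun s => T s x) (A (T t x)) t) ∧
      (∀ (x : X) (t : ℝ), 0 ≤ t → HasHukuharaDeriv (Ici 0) (fun s => T s x) (A (T t x)) t) ∧
      (∀ (x : X) (t : ℝ), t < 0 → HasKindDeriv .two univ (fun s => T s x) (A (T t x)) t) ∧
      -- variation of parameters
      (∀ (u₀ : X) (g : ℝ → X), (∀ t, Tendsto (fun s => dist (g s) (g t)) (𝓝 t) (𝓝 0)) →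
        (∀ t : ℝ, ∃ L : X, HasRiemannIntegral (fun s => T (t - s) (g s)) 0 t L) ∧
        ∀ u J : ℝ → X, (∀ t, HasRiemannIntegral (fun s => T (t - s) (g s)) 0 t (J t)) →
          (∀ t, u t = T t u₀ + J t) →
          u 0 = u₀ ∧
          (∀ t : ℝ, HasGenDeriv u (A (u t) + g t) t) ∧
          (∀ t : ℝ, 0 ≤ t → HasHukuharaDeriv (Ici 0) u (A (u t) + g t) t) ∧
          (∀ t : ℝ, t < 0 → HasKindDeriv .two univ u (A (u t) + g t) t)) := by

  have h := ConeLaws.of_isStandard hX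
  -- These structures are built on the given operations and distance, so the hypothesis on `A` and
  -- the conclusion keep their meaning.
  let _ := h.toAddCommMonoid
  let _ := h.toDistribMulAction
  let _ := h.toMetricSpace
  have _ := h.toMetricCone
  exact coneExp_spec hA
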